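/- **Slowly growing functions.** For integers $k,n\ge 0$ let $A_0(n)=2n$, $B_0(n)=n^2$, and for $k\ge1$ let $A_k(0)=1$, $B_k(0)=2$, $A_k(n)=A_{k-1}(A_k(n-1))$ and $B_k(n)=B_{k-1}(B_k(n-1))$ for $n\ge 1$. Put $\alpha_{2k}(n)=\min\{s\ge0: A_k(s)\ge n\}$ and $\alpha_{2k+1}(n)=\min\{s\ge 0: B_k(s)\ge n\}$. Put $\alpha'_0=\alpha_0$, $\alpha'_1=\alpha_1$, and for $k\ge2$ put $\alpha'_k(n)=\alpha_k(n)$ if $n\le k+1$ and $\alpha'_k(n)=2+\alpha'_k(\alpha'_{k-2}(n))$ if $n\ge k+2$. **Trees.** A Steiner rooted tree $(T,rt)$ is a finite (possibly empty) rooted tree with a set $R(T)\subseteq V(T)$ of required vertices; the other vertices are its Steiner vertices, and $|R(T)|$ is its required-size. It is *pruned* if every Steiner vertex is the least common ancestor of two required vertices. $Prune$ turns any Steiner rooted tree bottom-up into a pruned one: after the subtrees of the children of a vertex $x$ have been pruned, $x$ is kept, with the non-empty results as its subtrees, if it is required or if at least two results are non-empty; otherwise $x$ is deleted and replaced by the non-empty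 result, if there is one. $Decomp(T,\ell)$ visits the vertices in post-order and makes a vertex $v$ a cut vertex, removing its subtree, as soon as the part of its subtree that is still present contains more than $\ell$ required vertices; the set of cut vertices is $CV_\ell$. **Spanners.** For a graph $H$ on $V(T)$, a path in $H$ between $u$ and $v$ is *$T$-monotone* if its vertex sequence is a subsequence of that of the path in $T$ between $u$ and $v$. The *$T$-monotone diameter* of $H$ is the maximum over all pairs of required vertices of the minimum number of edges of a $T$-monotone path in $H$ between them. $H$ is a *1-spanner* for $T$ if for all non-negative edge weights of $T$, when each edge $xy$ of $H$ gets as its weight the distance of $x$ and $y$ in $T$, the distance in $H$ of any two required vertices is equal to their distance in $T$. **Algorithm** $Tree1Spanner((T,rt),n,k)$, for a pruned tree of required-size $n$ and $k\ge2$. If $n\le k$, return $E(T)$. If $n=k+1$, return $E(T)$, together with the edge $c_1c_2$ in case $rt$ has exactly two children $c_1,c_2$. If $n\ge k+2$: (1) let $\ell=\alpha'_{k-2}(n)$ and compute $CV_\ell$ by $Decomp(T,\ell)$. (2) Let $E'=\emptyset$ if $k=2$; let $E'$ be the edge set of the complete graph on $CV_\ell$ if $k=3$; if $k\ge4$, let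 $\tau'$ be the result of $Prune$ on the copy of $T$ whose set of required vertices is $CV_\ell$, and let $E'$ be the result of $Tree1Spanner(\tau',|CV_\ell|,k-2)$. (3) Let $T_1,\dots,T_g$ be the subtrees in $T\setminus CV_\ell$. (4) Let $E''$ consist of all edges $uv$ with $v\in R(T)\setminus CV_\ell$ and $u\in CV_\ell$ such that $u$ is adjacent in $T$ to some vertex of the subtree $T_i$ that contains $v$. (5) Let $E_i$ be the result of $Tree1Spanner(Prune(T_i),|R(T)\cap V(T_i)|,k)$ for each $i$. (6) Return $E'\cup E''\cup\bigcup_i E_i$. **Theorem.** There is an absolute constant $C$ such that the following holds. Let $k\ge2$ and $n\ge0$ be integers, and let $(T,rt)$ be a pruned Steiner rooted tree with required-size $n$. Then Algorithm $Tree1Spanner((T,rt),n,k)$ terminates and returns the edge set $E$ of a graph $G_T=(V(T),E)$ that is a 1-spanner for $T$ and whose $T$-monotone diameter is at most $k$. Moreover $|E|\le 2n\alpha'_k(n)$ if $k$ is even, $|E|\le 3n\alpha'_k(n)+2$ if $k$ is odd, and $|E|\le C\,(n\alpha_k(n)+1)$; and the algorithm takes at most $C\,(n\alpha_k(n)+1)$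 steps (the number of procedure calls in an implementation on linked lists and trees in which each call performs $O(1)$ elementary operations). -/

import Mathlib

namespace TreeSpanner

/-! ### The slowly growing functions -/

/-- The rapidly growing functions `A_k`. -/
def ackA : ℕ → ℕ → ℕ
  | 0, n => 2 * n
  | _ + 1, 0 => 1
  | k + 1, n + 1 => ackA k (ackA (k + 1) n)

/-- The rapidly growing functions `B_k`. -/
def ackB : ℕ → ℕ → ℕ
  | 0, n => n ^ 2
  | _ + 1, 0 => 2
  | k + 1, n + 1 => ackB k (ackB (k + 1) n)

/-- `α_{2j}(n) = min {s : A_j(s) ≥ n}` and `α_{2j+1}(n) = min {s : B_j(s) ≥ n}`. -/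
noncomputable def alpha (k n : ℕ) : ℕ :=
  if k % 2 = 0 then sInf {s | n ≤ ackA (k / 2) s} else sInf {s | n ≤ ackB (k / 2) s}

/-- The variant `α'_k`: it agrees with `α_k` for `k ≤ 1` and for `n ≤ k + 1`, and satisfies
`α'_k(n) = 2 + α'_k(α'_{k-2}(n))` for `k ≥ 2` and `n ≥ k + 2`. The cap at `n - 1` only makes
the termination evident; it is never active, see `alphaPrime_rec`. -/
noncomputable def alphaPrime : ℕ → ℕ → ℕ
  | 0, n => alpha 0 n
  | 1, n => alpha 1 n
  | k + 2, n =>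
    if k + 4 ≤ n then 2 + alphaPrime (k + 2) (min (alphaPrime k n) (n - 1))
    else alpha (k + 2) n
termination_by k n => (k, n)
decreasing_by
  · exact Prod.Lex.left _ _ (by omega)
  · exact Prod.Lex.right _ (by omega)

theorem ackA_succ (k n : ℕ) : ackA (k + 1) (n + 1) = ackA k (ackA (k + 1) n) := by
  rw [ackA]

theorem ackB_succ (k n : ℕ) : ackB (k + 1) (n + 1) = ackB k (ackB (k + 1) n) := by
  rw [ackB]

theorem two_mul_le_ackA (k n : ℕ) : 2 * n ≤ ackA k n ∧ n + 1 ≤ ackA (k + 1) n := by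
  induction k generalizing n with
  | zero =>
    refine ⟨by simp [ackA], ?_⟩
    induction n with
    | zero => simp [ackA]
    | succ n ih => simp only [ackA] at *; omega
  | succ k ih =>
    have h1 : ∀ m, m + 1 ≤ ackA (k + 1) m := fun m => (ih m).2
    have h2 : ∀ m, 2 * m ≤ ackA (k + 1) m := by
      intro m
      cases m with
      | zero => omega
      | succ m =>
        have := (ih (ackA (k + 1) m)).1
        have := h1 m
        simp only [ackA] at *; omega
    refine ⟨h2 n, ?_⟩
    induction n with
    | zero => simp [ackA]
    | succ n ihn =>
      have := h2 (ackA (k + 1 + 1) n)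
      rw [ackA_succ]; omega

theorem sq_le_ackB (k n : ℕ) : n ^ 2 ≤ ackB k n ∧ n + 2 ≤ ackB (k + 1) n := by
  induction k generalizing n with
  | zero =>
    refine ⟨by simp [ackB], ?_⟩
    induction n with
    | zero => simp [ackB]
    | succ n ih => simp only [ackB] at *; nlinarith
  | succ k ih =>
    have h1 : ∀ m, m + 2 ≤ ackB (k + 1) m := fun m => (ih m).2
    have h2 : ∀ m, m ^ 2 ≤ ackB (k + 1) m := by
      intro m
      cases m with
      | zero => simp
      | succ m =>
        have := (ih (ackB (k + 1) m)).1
        have := h1 m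
        simp only [ackB] at *; nlinarith
    refine ⟨h2 n, ?_⟩
    induction n with
    | zero => simp [ackB]
    | succ n ihn =>
      have := h2 (ackB (k + 1 + 1) n)
      rw [ackB_succ]; nlinarith

theorem ackA_three (k : ℕ) : 2 * k + 3 ≤ ackA (k + 1) 3 := by
  induction k with
  | zero => simp [ackA]
  | succ k ih =>
    have hm : Monotone (ackA (k + 1)) := monotone_nat_of_le_succ fun m => by
      have := (two_mul_le_ackA k (ackA (k + 1) m)).1
      simp only [ackA] at *; omega
    have h1 : ackA (k + 1) 4 ≤ ackA (k + 1 + 1) 3 := by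
      rw [ackA_succ (k + 1) 2]; exact hm (two_mul_le_ackA (k + 2) 2).1
    have h2 : 2 * ackA (k + 1) 3 ≤ ackA (k + 1) 4 := by
      rw [ackA_succ k 3]; exact (two_mul_le_ackA k (ackA (k + 1) 3)).1
    omega

theorem ackB_three (k : ℕ) : 2 * k + 4 ≤ ackB (k + 1) 3 := by
  induction k with
  | zero => simp [ackB]
  | succ k ih =>
    have hm : Monotone (ackB (k + 1)) := monotone_nat_of_le_succ fun m => by
      have := (sq_le_ackB k (ackB (k + 1) m)).1
      simp only [ackB] at *; nlinarith
    have h1 : ackB (k + 1) 4 ≤ ackB (k + 1 + 1) 3 := by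
      rw [ackB_succ (k + 1) 2]; exact hm (sq_le_ackB (k + 1) 2).2
    have h2 : (ackB (k + 1) 3) ^ 2 ≤ ackB (k + 1) 4 := by
      rw [ackB_succ k 3]; exact (sq_le_ackB k (ackB (k + 1) 3)).1
    nlinarith

theorem alpha_le_pred (k n : ℕ) : alpha (k + 2) n ≤ n - 1 := by
  have hk : (k + 2) / 2 = k / 2 + 1 := by omega
  unfold alpha
  rw [hk]
  split
  · refine Nat.sInf_le ?_
    have := (two_mul_le_ackA (k / 2) (n - 1)).2
    simp only [Set.mem_ofPred_eq]; omega
  · refine Nat.sInf_le ?_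
    have := (sq_le_ackB (k / 2) (n - 1)).2
    simp only [Set.mem_ofPred_eq]; omega

theorem alpha_le_three (k n : ℕ) (h : n ≤ k + 3) : alpha (k + 2) n ≤ 3 := by
  have hk : (k + 2) / 2 = k / 2 + 1 := by omega
  unfold alpha
  rw [hk]
  split
  · refine Nat.sInf_le ?_
    have := ackA_three (k / 2)
    simp only [Set.mem_ofPred_eq]; omega
  · refine Nat.sInf_le ?_
    have := ackB_three (k / 2)
    simp only [Set.mem_ofPred_eq]; omega

theorem alpha_zero_le (n s : ℕ) (h : n ≤ 2 * s) : alpha 0 n ≤ s := by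
  simp only [alpha]
  exact Nat.sInf_le (by simpa [ackA] using h)

theorem alpha_one_le (n s : ℕ) (h : n ≤ s ^ 2) : alpha 1 n ≤ s := by
  simp only [alpha]
  exact Nat.sInf_le (by simpa [ackB] using h)

theorem alphaPrime_zero (n : ℕ) : alphaPrime 0 n = alpha 0 n := by
  rw [alphaPrime]

theorem alphaPrime_one (n : ℕ) : alphaPrime 1 n = alpha 1 n := by
  rw [alphaPrime]

theorem alphaPrime_small (k n : ℕ) (h : n ≤ k + 3) :
    alphaPrime (k + 2) n = alpha (k + 2) n := by
  rw [alphaPrime, if_neg (by omega)]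

theorem alphaPrime_rec_of_lt (k n : ℕ) (h : k + 4 ≤ n) (hlt : alphaPrime k n < n) :
    alphaPrime (k + 2) n = 2 + alphaPrime (k + 2) (alphaPrime k n) := by
  rw [alphaPrime, if_pos h, min_eq_left (by omega)]

theorem alphaPrime_le_sub_two (k : ℕ) : ∀ n, k + 4 ≤ n → alphaPrime k n ≤ n - 2 := by
  induction k using Nat.twoStepInduction with
  | zero =>
      intro n hn
      rw [alphaPrime_zero]; exact alpha_zero_le _ _ (by omega)
  | one =>
      intro n hn
      rw [alphaPrime_one]
      obtain ⟨m, rfl⟩ := Nat.exists_eq_add_of_le hn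
      exact alpha_one_le _ _ (by
        have : 1 + 4 + m - 2 = m + 3 := by omega
        rw [this]; nlinarith)
  | more k ihk _ =>
    have hrec : ∀ n, k + 4 ≤ n →
        alphaPrime (k + 2) n = 2 + alphaPrime (k + 2) (alphaPrime k n) := fun n hn =>
      alphaPrime_rec_of_lt k n hn (by have := ihk n hn; omega)
    intro n
    induction n using Nat.strong_induction_on with
    | _ n ih =>
      intro hn
      have hm := ihk n (by omega)
      rw [hrec n (by omega)]
      by_cases h1 : k + 6 ≤ alphaPrime k n
      · have := ih (alphaPrime k n) (by omega) (by omega)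
        omega
      by_cases h2 : k + 4 ≤ alphaPrime k n
      · have h3 := ihk _ h2
        rw [hrec _ h2, alphaPrime_small k _ (by omega)]
        have h4 := alpha_le_three k (alphaPrime k (alphaPrime k n)) (by omega)
        have h5 := alpha_le_pred k (alphaPrime k (alphaPrime k n))
        by_cases h6 : 9 ≤ n
        · omega
        have h7 : alphaPrime k n ≤ n - 3 := by
          have : k = 0 ∨ k = 1 ∨ k = 2 := by omega
          rcases this with rfl | rfl | rfl
          · rw [alphaPrime_zero]; exact alpha_zero_le _ _ (by omega)
          · rw [alphaPrime_one]
            exact (alpha_one_le _ 3 (by omega)).trans (by omega)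
          · have h8 : alphaPrime 0 n ≤ 4 := by
              rw [alphaPrime_zero]; exact alpha_zero_le _ _ (by omega)
            obtain rfl : n = 8 := by omega
            have h9 : alphaPrime 2 8 = 2 + alphaPrime 2 (alphaPrime 0 8) :=
              alphaPrime_rec_of_lt 0 8 (by omega) (by omega)
            by_cases h10 : 4 ≤ alphaPrime 0 8
            · have h11 : alphaPrime 0 8 = 4 := by omega
              have h12 : alphaPrime 0 4 ≤ 2 := by
                rw [alphaPrime_zero]; exact alpha_zero_le _ _ (by omega)
              have h13 : alphaPrime 2 4 = 2 + alphaPrime 2 (alphaPrime 0 4) :=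
                alphaPrime_rec_of_lt 0 4 (by omega) (by omega)
              have h14 := alphaPrime_small 0 (alphaPrime 0 4) (by omega)
              have := alpha_le_pred 0 (alphaPrime 0 4)
              norm_num at *
              rw [h11] at h9
              omega
            · have h14 := alphaPrime_small 0 (alphaPrime 0 8) (by omega)
              have := alpha_le_pred 0 (alphaPrime 0 8)
              norm_num at *
              omega
        omega
      · rw [alphaPrime_small k _ (by omega)]
        have h4 := alpha_le_three k (alphaPrime k n) (by omega)
        have h5 := alpha_le_pred k (alphaPrime k n)
        by_cases h6 : 7 ≤ n
        · omega
        obtain rfl : k = 0 := by omega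
        have : alphaPrime 0 n ≤ 3 := by
          rw [alphaPrime_zero]; exact alpha_zero_le _ _ (by omega)
        omega

/-- The recursion that defines `α'`. -/
theorem alphaPrime_rec (k n : ℕ) (h : k + 4 ≤ n) :
    alphaPrime (k + 2) n = 2 + alphaPrime (k + 2) (alphaPrime k n) := by
  exact alphaPrime_rec_of_lt k n h (by have := alphaPrime_le_sub_two k n h; omega)

/-! ### Rooted trees -/

/-- Finite ordered rooted forests in the first-child / next-sibling representation: `node a c s`
is a tree whose root carries the label `a` and whose root's subtrees form the forest `c`, followed
by the further trees `s`. -/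
inductive Forest (A : Type) : Type where
  | nil : Forest A
  | node (a : A) (children next : Forest A) : Forest A

namespace Forest

variable {A V : Type}

/-- The labels of all vertices. -/
def labels : Forest A → List A
  | nil => []
  | node a c s => a :: (c.labels ++ s.labels)

/-- The labels of the roots of the trees of a forest. -/
def roots : Forest A → List A
  | nil => []
  | node a _ s => a :: s.roots

/-- In a Steiner forest a vertex is labelled by its name and by a flag that says whether it is
required (`true`) or a Steiner vertex (`false`). This is the list of all vertex names. -/
def verts (T : Forest (V × Bool)) : List V := T.labels.map Prod.fst

/-- A Steiner rooted tree: distinct vertices have distinct names, and there is at most one root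
(the empty tree is allowed). -/
def IsSteinerTree (T : Forest (V × Bool)) : Prop := T.verts.Nodup ∧ T.roots.length ≤ 1

/-- `R(T)`. -/
def required (T : Forest (V × Bool)) : Set V := {v | (v, true) ∈ T.labels}

/-- `S(T)`. -/
def steiner (T : Forest (V × Bool)) : Set V := {v | (v, false) ∈ T.labels}

/-- `T.IsChild x y`: the vertex `y` is a child of the vertex `x`. -/
def IsChild : Forest (V × Bool) → V → V → Prop
  | nil, _, _ => False
  | node a c s, x, y => (x = a.1 ∧ y ∈ c.roots.map Prod.fst) ∨ c.IsChild x y ∨ s.IsChild x y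

/-- The underlying undirected graph of `T` (names that do not occur in `T` are isolated). -/
def graph (T : Forest (V × Bool)) : SimpleGraph V := SimpleGraph.fromRel T.IsChild

/-- `x` is an ancestor of `y`; every vertex is an ancestor of itself. -/
def IsAncestor (T : Forest (V × Bool)) : V → V → Prop := Relation.ReflTransGen T.IsChild

/-- `x` is the least common ancestor of `u` and `v`. -/
def IsLCA (T : Forest (V × Bool)) (x u v : V) : Prop :=
  T.IsAncestor x u ∧ T.IsAncestor x v ∧
    ∀ y, T.IsAncestor y u → T.IsAncestor y v → T.IsAncestor y x

/-- Every Steiner vertex is useful, i.e. the LCA of some pair of required vertices. -/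
def IsPruned (T : Forest (V × Bool)) : Prop :=
  ∀ x ∈ T.steiner, ∃ u ∈ T.required, ∃ v ∈ T.required, T.IsLCA x u v

end Forest

/-! ### Spanners -/

section Spanners

open scoped ENNReal NNReal

variable {V : Type}

/-- A path in `H` from `u` to `v` is `T`-monotone if its sequence of vertices is a subsequence
of that of the path in `T` from `u` to `v`. -/
def IsMonotone (T : SimpleGraph V) {H : SimpleGraph V} {u v : V} (q : H.Walk u v) : Prop :=
  ∃ p : T.Walk u v, p.IsPath ∧ q.support.Sublist p.support

/-- The `T`-monotone distance in `H`, `∞` if there is no `T`-monotone path. -/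
noncomputable def monotoneDist (T H : SimpleGraph V) (u v : V) : ℕ∞ :=
  ⨅ (q : H.Walk u v) (_ : IsMonotone T q), (q.length : ℕ∞)

/-- The largest `T`-monotone distance in `H` between two vertices of `R`. -/
noncomputable def monotoneDiam (T H : SimpleGraph V) (R : Set V) : ℕ∞ :=
  ⨆ (u ∈ R) (v ∈ R), monotoneDist T H u v

/-- The shortest-path distance in `G` where the edge `xy` has the weight `w x y`. -/
noncomputable def weightedDist (G : SimpleGraph V) (w : V → V → ℝ≥0∞) (u v : V) : ℝ≥0∞ :=
  ⨅ p : G.Walk u v, (p.darts.map fun d => w d.fst d.snd).sum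

/-- The tree metric `M_T` for the edge weights `w`. -/
noncomputable def treeMetric (T : SimpleGraph V) (w : Sym2 V → ℝ≥0) : V → V → ℝ≥0∞ :=
  weightedDist T fun x y => (w s(x, y) : ℝ≥0∞)

/-- `H`, with every edge weighted by the tree metric, is a 1-spanner for `T` with respect to the
set `R` of required vertices, whatever the edge weights of `T` are. -/
def IsOneSpanner (T H : SimpleGraph V) (R : Set V) : Prop :=
  ∀ w : Sym2 V → ℝ≥0, ∀ u ∈ R, ∀ v ∈ R,
    weightedDist H (treeMetric T w) u v = treeMetric T w u v

/-- The graph with a given list of edges. -/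
def graphOf (E : List (V × V)) : SimpleGraph V :=
  SimpleGraph.fromEdgeSet {e | ∃ p ∈ E, e = s(p.1, p.2)}

end Spanners

/-! ### The algorithm

The computation is carried out by procedures in the monad `Alg`, which maintain a step counter.
Every call of every procedure, recursive calls included, increments the counter by one. Apart from
procedure calls the body of each procedure performs only a bounded number of elementary operations
on machine words and pointers: case distinctions on a forest, list or flag, creation of one node,
list cell or record, comparisons, additions, multiplications, parity and halving of numbers. So the
counter is the running time on a unit-cost machine up to an absolute constant factor. Lists of
results are built up in an accumulator argument, so that no concatenation of lists is ever needed.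

The procedures that recurse on something other than the structure of their input have an additional
argument `d`, a bound on the depth of the recursion; if it is exceeded, then there is no result
(`none`). It is no part of the computation: an execution terminates with a certain result after
a certain number of steps if this is what comes out for all large enough `d`. -/

/-- Computations with a step counter; `none` means that the depth bound was exceeded. -/
abbrev Alg (X : Type) : Type := StateT ℕ Option X

/-- Count one step. -/
def tick : Alg Unit := modify (· + 1)

section Procedures

variable {V : Type}

/-- Search for the least `r ≥ s` with `n ≤ r * r`. -/
def sqrtSearch : ℕ → ℕ → ℕ → Alg ℕ
  | 0, _, _ => failure
  | d + 1, n, s => do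
    tick
    if n ≤ s * s then return s else sqrtSearch d n (s + 1)

/-- The computation of `α'_k(n)`. For `k ≥ 2` and `n ≤ k + 1` it uses that `α_k` takes on these
arguments the values given in the two lists of cases, for even and for odd `k`. -/
def computeAlpha : ℕ → ℕ → ℕ → Alg ℕ
  | 0, _, _ => failure
  | d + 1, k, n => do
    tick
    if k = 0 then return (n + 1) / 2
    else if k = 1 then sqrtSearch d n 0
    else if n ≤ k + 1 then
      if k % 2 = 0 then
        if n ≤ 1 then return 0
        else if n ≤ 2 then return 1
        else if n ≤ 4 then return 2
        else return 3
      else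
        if n ≤ 2 then return 0 else return 1
    else
      let m ← computeAlpha d (k - 2) n
      let r ← computeAlpha d k m
      return 2 + r

/-- Procedure `Prune`, applied to each tree of a forest; trees that become empty disappear. -/
def prune : Forest (V × Bool) → Alg (Forest (V × Bool))
  | .nil => do
    tick
    return .nil
  | .node (v, b) c s => do
    tick
    let c' ← prune c
    let s' ← prune s
    if b then return .node (v, b) c' s'
    else match c' with
      | .nil => return s'
      | .node a d .nil => return .node a d s'
      | .node a d (.node a₂ d₂ s₂) => return .node (v, b) (.node a d (.node a₂ d₂ s₂)) s'

/-- Procedure `Decomp` with parameter `ℓ`. It returns the forest in which each label `(v, b)` is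
extended by a flag that says whether `v` is a cut vertex, together with the sum of the values
`size` of those roots that are not cut vertices (the subtrees of the others are removed). -/
def decomp (ℓ : ℕ) : Forest (V × Bool) → Alg (Forest (V × Bool × Bool) × ℕ)
  | .nil => do
    tick
    return (.nil, 0)
  | .node (v, b) c s => do
    tick
    let (c', x) ← decomp ℓ c
    let (s', y) ← decomp ℓ s
    let size := if b then x + 1 else x
    if ℓ < size then return (.node (v, b, true) c' s', y)
    else return (.node (v, b, false) c' s', size + y)

/-- The cut vertices of a forest as returned by `decomp`, put in front of `acc`. -/
def cutVertices : Forest (V × Bool × Bool) → List V → Alg (List V)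
  | .nil, acc => do
    tick
    return acc
  | .node (v, _, cut) c s, acc => do
    tick
    let acc ← cutVertices c acc
    let acc ← cutVertices s acc
    if cut then return v :: acc else return acc

/-- The copy of the tree in which exactly the cut vertices are required. -/
def recolor : Forest (V × Bool × Bool) → Alg (Forest (V × Bool))
  | .nil => do
    tick
    return .nil
  | .node (v, _, cut) c s => do
    tick
    let c' ← recolor c
    let s' ← recolor s
    return .node (v, cut) c' s'

/-- The length of a list. -/
def count {X : Type} : List X → Alg ℕ
  | [] => do
    tick
    return 0
  | _ :: l => do
    tick
    let m ← count l
    return m + 1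

/-- Put all pairs `(u, v)`, `u` in the list, in front of `acc`. -/
def pairsWith (v : V) : List V → List (V × V) → Alg (List (V × V))
  | [], acc => do
    tick
    return acc
  | u :: l, acc => do
    tick
    pairsWith v l ((u, v) :: acc)

/-- The edges of the complete graph on a list of distinct vertices, put in front of `acc`. -/
def completeEdges : List V → List (V × V) → Alg (List (V × V))
  | [], acc => do
    tick
    return acc
  | v :: l, acc => do
    tick
    let acc ← pairsWith v l acc
    completeEdges l acc

/-- The edges of a forest, put in front of `acc`; if a parent is given, then the edges from it to
the roots are included. -/
def treeEdges : Option V → Forest (V × Bool) → List (V × V) → Alg (List (V × V))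
  | _, .nil, acc => do
    tick
    return acc
  | parent, .node (v, _) c s, acc => do
    tick
    let acc ← treeEdges (some v) c acc
    let acc ← treeEdges parent s acc
    match parent with
      | none => return acc
      | some p => return (p, v) :: acc

/-- The required vertices of a forest, put in front of `acc`. -/
def requiredList : Forest (V × Bool) → List V → Alg (List V)
  | .nil, acc => do
    tick
    return acc
  | .node (v, b) c s, acc => do
    tick
    let acc ← requiredList c acc
    let acc ← requiredList s acc
    if b then return v :: acc else return acc

/-- A subtree `T_i` of `T \ CV`, with its border. -/
structure Component (V : Type) where
  tree : Forest (V × Bool)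
  border : List V

/-- The position of a forest during the removal of the cut vertices: its trees hang below a vertex
that is not a cut vertex (`inside`), or they hang below the cut vertex `u` (`below (some u)`), or
they are not below any vertex (`below none`). -/
inductive Position (V : Type) where
  | inside
  | below (u : Option V)

/-- Removal of the cut vertices from a forest. The result consists of
* the part of the forest that is attached to the current subtree (relevant for `inside`),
* the cut vertices that are adjacent to it from below, put in front of `border`,
* the subtrees completed on the way, put in front of `done`. -/
def split : Position V → Forest (V × Bool × Bool) → List V → List (Component V) →
    Alg (Forest (V × Bool) × List V × List (Component V))
  | _, .nil, border, done => do
    tick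
    return (.nil, border, done)
  | pos, .node (v, _, true) c s, border, done => do
    tick
    let (_, _, done) ← split (.below (some v)) c [] done
    split pos s (v :: border) done
  | .inside, .node (v, b, false) c s, border, done => do
    tick
    let (c', border, done) ← split .inside c border done
    let (s', border, done) ← split .inside s border done
    return (.node (v, b) c' s', border, done)
  | .below u, .node (v, b, false) c s, border, done => do
    tick
    let (c', down, done) ← split .inside c [] done
    let bd := match u with
      | none => down
      | some u => u :: down
    split (.below u) s border (⟨.node (v, b) c' .nil, bd⟩ :: done)

/-- All pairs of a vertex of `border` and a vertex of the second list, put in front of `acc`. -/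
def connectAll (border : List V) : List V → List (V × V) → Alg (List (V × V))
  | [], acc => do
    tick
    return acc
  | v :: l, acc => do
    tick
    let acc ← pairsWith v border acc
    connectAll border l acc

/-- The edges between the required vertices of the subtrees and the border vertices of these
subtrees, put in front of `acc`. -/
def borderEdges : List (Component V) → List (V × V) → Alg (List (V × V))
  | [], acc => do
    tick
    return acc
  | t :: l, acc => do
    tick
    let r ← requiredList t.tree []
    let acc ← connectAll t.border r acc
    borderEdges l acc

/-- The recursive calls for the prunings of the subtrees; `call T m acc` stands for the recursive
call of the algorithm on the tree `T` of required-size `m`. -/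
def spanComponents (call : Forest (V × Bool) → ℕ → List (V × V) → Alg (List (V × V))) :
    List (Component V) → List (V × V) → Alg (List (V × V))
  | [], acc => do
    tick
    return acc
  | t :: l, acc => do
    tick
    let T' ← prune t.tree
    let r ← requiredList t.tree []
    let m ← count r
    let acc ← call T' m acc
    spanComponents call l acc

/-- Algorithm `Tree1Spanner((T, rt), n, k)` with depth bound `d`; the edges found are put in front
of `acc`. -/
def tree1Spanner : ℕ → Forest (V × Bool) → ℕ → ℕ → List (V × V) → Alg (List (V × V))
  | 0, _, _, _, _ => failure
  | d + 1, T, n, k, acc => do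
    tick
    if n ≤ k then treeEdges none T acc
    else if n = k + 1 then
      match T with
      | .node _ (.node c₁ _ (.node c₂ _ .nil)) .nil => treeEdges none T ((c₁.1, c₂.1) :: acc)
      | _ => treeEdges none T acc
    else
      let ℓ ← computeAlpha d (k - 2) n
      let (M, _) ← decomp ℓ T
      let acc ←
        if k = 2 then pure acc
        else if k = 3 then do
          let cv ← cutVertices M []
          completeEdges cv acc
        else do
          let τ ← recolor M
          let τ' ← prune τ
          let cv ← cutVertices M []
          let m ← count cv
          tree1Spanner d τ' m (k - 2) acc
      let (_, _, comps) ← split (.below none) M [] []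
      let acc ← borderEdges comps acc
      spanComponents (fun T' m acc => tree1Spanner d T' m k acc) comps acc

end Procedures

end TreeSpanner

/-!
Double induction: on `k` in steps of two, and for fixed `k` on the required-size `n`. With
`ℓ = α'_{k-2}(n)`, more than `ℓ` required vertices are removed with every cut vertex, so there are
at most `n / (ℓ + 1)` cut vertices, and every remaining subtree has at most `ℓ` required vertices.

*Monotone paths.* If the path in `T` between two required vertices avoids the cut vertices, it lies
in one subtree `Tᵢ`, and the recursive call for `Tᵢ` takes care of it. Otherwise let `x` and `y` be
its first and last cut vertices: an edge of `E''` leads to `x`, at most `k - 2` edges of `E'` lead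
on to `y`, and a further edge of `E''` leads to the end. All of these vertices lie on the path in
`T` in this order, so the tree metric makes such a path exactly as long as the path in `T`. For
`n ≤ k + 1`, the edges of `T` suffice because a pruned tree has no long paths between required
vertices; the only exception is a path through a Steiner root with two children, which the edge
`c₁c₂` shortens.

*Number of edges.* The incidences between cut vertices and subtrees form a forest, so `E''` has at
most `n + ℓ |CV_ℓ| ≤ 2n` edges. By induction `E'` has at most `2n` edges for even `k` and at most
about `3n` for odd `k`, since `α'_{k-2}(|CV_ℓ|) ≤ ℓ`; hence the recursion
`α'_k(n) = 2 + α'_k(α'_{k-2}(n))` matches the recursion for the number of edges. The steps are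
counted in the same way, and `α'_k ≤ 2 α_k + 10`.
-/

namespace TreeSpanner

/-! ### The slowly growing functions -/

/-- The rapidly growing function whose inverse is `α_k`: the paper's `A_{k/2}` for even `k` and
`B_{(k-1)/2}` for odd `k`. -/
def growth (k : ℕ) : ℕ → ℕ := if k % 2 = 0 then ackA (k / 2) else ackB (k / 2)

theorem growth_two_mul (j : ℕ) : growth (2 * j) = ackA j := by
  rw [growth, if_pos (by omega), Nat.mul_div_cancel_left j two_pos]

theorem growth_two_mul_add_one (j : ℕ) : growth (2 * j + 1) = ackB j := by
  rw [growth, if_neg (by omega), show (2 * j + 1) / 2 = j by omega]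

theorem growth_zero (s : ℕ) : growth 0 s = 2 * s := by
  rw [← mul_zero 2, growth_two_mul, ackA]

theorem growth_one (s : ℕ) : growth 1 s = s ^ 2 := by
  rw [← zero_add 1, ← mul_zero 2, growth_two_mul_add_one, ackB]

theorem growth_succ (k s : ℕ) : growth (k + 2) (s + 1) = growth k (growth (k + 2) s) := by
  obtain ⟨j, rfl | rfl⟩ := Nat.even_or_odd' k
  · rw [← mul_add_one, growth_two_mul, growth_two_mul, ackA_succ]
  · rw [add_right_comm, ← mul_add_one, growth_two_mul_add_one, growth_two_mul_add_one, ackB_succ]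

theorem growth_even_values (j : ℕ) :
    growth (2 * j + 2) 0 = 1 ∧ growth (2 * j + 2) 1 = 2 ∧ growth (2 * j + 2) 2 = 4 := by
  induction j with
  | zero => simp only [growth_succ, mul_zero, growth_zero, growth_two_mul 1, ackA, and_self]
  | succ j ih =>
    have h0 : growth (2 * (j + 1) + 2) 0 = 1 := by
      rw [← mul_add_one, growth_two_mul, ackA.eq_def]
    have h1 : growth (2 * (j + 1) + 2) 1 = 2 := by rw [growth_succ, h0]; exact ih.2.1
    exact ⟨h0, h1, by rw [growth_succ, h1]; exact ih.2.2⟩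

theorem le_growth_even_three (j : ℕ) : 2 * j + 3 ≤ growth (2 * j + 2) 3 := by
  rw [← mul_add_one, growth_two_mul]
  exact ackA_three j

theorem growth_odd_zero (j : ℕ) : growth (2 * j + 3) 0 = 2 := by
  rw [show 2 * j + 3 = 2 * (j + 1) + 1 by ring, growth_two_mul_add_one, ackB]

theorem one_le_growth_zero (k : ℕ) : 1 ≤ growth (k + 2) 0 := by
  obtain ⟨j, rfl | rfl⟩ := Nat.even_or_odd' k
  · exact (growth_even_values j).1.ge
  · rw [growth_odd_zero]
    exact one_le_two

theorem growth_zero_le_two (k : ℕ) : growth (k + 2) 0 ≤ 2 := by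
  obtain ⟨j, rfl | rfl⟩ := Nat.even_or_odd' k
  · rw [(growth_even_values j).1]
    exact one_le_two
  · exact (growth_odd_zero j).le

theorem two_mul_growth_le (k s : ℕ) : 2 * growth (k + 2) s ≤ growth (k + 2) (s + 1) := by
  rw [growth_succ]
  obtain ⟨j, rfl | rfl⟩ := Nat.even_or_odd' k
  · rw [growth_two_mul j]
    exact (two_mul_le_ackA j _).1
  · rw [growth_two_mul_add_one j, add_right_comm, ← mul_add_one, growth_two_mul_add_one]
    have hsq := (sq_le_ackB j (ackB (j + 1) s)).1
    have htwo := (sq_le_ackB j s).2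
    nlinarith

theorem two_pow_le_growth (k s : ℕ) : 2 ^ s ≤ growth (k + 2) s := by
  induction s with
  | zero => exact one_le_growth_zero k
  | succ s ih =>
    have := two_mul_growth_le k s
    rw [pow_succ]
    omega

theorem le_growth_odd_one (j : ℕ) : 2 * j + 4 ≤ growth (2 * j + 3) 1 := by
  induction j with
  | zero =>
    rw [growth_succ, growth_odd_zero 0]
    norm_num [growth_one]
  | succ j ih =>
    have hdouble : 2 * growth (2 * j + 3) 1 ≤ growth (2 * j + 3) 2 :=
      two_mul_growth_le (2 * j + 1) 1
    rw [growth_succ, growth_odd_zero (j + 1)]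
    change _ ≤ growth (2 * j + 3) 2
    omega

theorem growth_mono (k : ℕ) : Monotone (growth k) := by
  match k with
  | 0 => exact fun m n h => by rw [growth_zero, growth_zero]; omega
  | 1 => exact fun m n h => by rw [growth_one, growth_one]; exact Nat.pow_le_pow_left h 2
  | k + 2 => exact monotone_nat_of_le_succ fun s => by have := two_mul_growth_le k s; omega

theorem le_growth_self (k s : ℕ) : s ≤ growth k s := by
  match k with
  | 0 => rw [growth_zero]; omega
  | 1 => rw [growth_one]; exact Nat.le_self_pow two_ne_zero s
  | k + 2 => exact s.lt_two_pow_self.le.trans (two_pow_le_growth k s)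

theorem gc_alpha_growth (k : ℕ) : GaloisConnection (alpha k) (growth k) := by
  have halpha (n : ℕ) : alpha k n = sInf {s | n ≤ growth k s} := by
    unfold alpha growth
    split <;> rfl
  intro n s
  rw [halpha]
  refine ⟨fun h => ?_, fun h => Nat.sInf_le h⟩
  exact (Nat.sInf_mem (s := {s | n ≤ growth k s}) ⟨n, le_growth_self k n⟩).trans (growth_mono k h)

theorem alpha_zero_eq (n : ℕ) : alpha 0 n = (n + 1) / 2 :=
  eq_of_forall_ge_iff fun s => by rw [gc_alpha_growth 0 n s, growth_zero]; omega

theorem le_alpha_one_sq (n : ℕ) : n ≤ alpha 1 n ^ 2 :=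
  ((gc_alpha_growth 1).le_u_l n).trans_eq (growth_one _)

theorem alpha_even_small {j n : ℕ} (hn : n ≤ 2 * j + 3) :
    alpha (2 * j + 2) n =
      if n ≤ 1 then 0 else if n ≤ 2 then 1 else if n ≤ 4 then 2 else 3 := by
  obtain ⟨h0, h1, h2⟩ := growth_even_values j
  have h3 := le_growth_even_three j
  refine eq_of_forall_ge_iff fun s => ?_
  rw [gc_alpha_growth (2 * j + 2) n s]
  match s with
  | 0 => rw [h0]; split_ifs <;> omega
  | 1 => rw [h1]; split_ifs <;> omega
  | 2 => rw [h2]; split_ifs <;> omega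
  | s + 3 =>
    have := growth_mono (2 * j + 2) (show 3 ≤ s + 3 by omega)
    split_ifs <;> omega

theorem alpha_odd_small {j n : ℕ} (hn : n ≤ 2 * j + 4) :
    alpha (2 * j + 3) n = if n ≤ 2 then 0 else 1 := by
  have h0 := growth_odd_zero j
  have h1 := le_growth_odd_one j
  refine eq_of_forall_ge_iff fun s => ?_
  rw [gc_alpha_growth (2 * j + 3) n s]
  match s with
  | 0 => rw [h0]; split_ifs <;> omega
  | s + 1 =>
    have := growth_mono (2 * j + 3) (show 1 ≤ s + 1 by omega)
    split_ifs <;> omega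

theorem alpha_le_alpha_two_add_two {k n : ℕ} (hn : n ≤ k + 3) :
    alpha (k + 2) n ≤ alpha (k + 2) 2 + 2 := by
  obtain ⟨j, rfl | rfl⟩ := Nat.even_or_odd' k
  · rw [alpha_even_small (j := j) hn, alpha_even_small (j := j) (by omega)]
    split_ifs <;> omega
  · rw [alpha_odd_small (j := j) hn]
    split_ifs <;> omega

theorem alpha_pos (k : ℕ) {n : ℕ} (hn : 3 ≤ n) : 1 ≤ alpha (k + 2) n := by
  by_contra! h
  have := (gc_alpha_growth (k + 2)).le_u (show alpha (k + 2) n ≤ 0 by omega)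
  have := growth_zero_le_two k
  omega

theorem two_le_alphaPrime {k n : ℕ} (h : k + 4 ≤ n) : 2 ≤ alphaPrime k n := by
  match k with
  | 0 => rw [alphaPrime_zero, alpha_zero_eq]; omega
  | 1 =>
    rw [alphaPrime_one]
    have := le_alpha_one_sq n
    by_contra! hlt
    have := Nat.pow_le_pow_left (show alpha 1 n ≤ 1 by omega) 2
    omega
  | k + 2 => rw [alphaPrime_rec k n (by omega)]; omega

theorem alphaPrime_lt {k n : ℕ} (h : k + 4 ≤ n) : alphaPrime k n < n := by
  have := alphaPrime_le_sub_two k n h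
  omega

theorem alphaPrime_mono (k : ℕ) : Monotone (alphaPrime k) := by
  induction k using Nat.twoStepInduction with
  | zero =>
    exact fun m n h => by simpa only [alphaPrime_zero] using (gc_alpha_growth 0).monotone_l h
  | one =>
    exact fun m n h => by simpa only [alphaPrime_one] using (gc_alpha_growth 1).monotone_l h
  | more k ih _ =>
    intro m n
    induction n using Nat.strong_induction_on generalizing m with
    | _ n IH =>
      intro hmn
      by_cases hn : n ≤ k + 3
      · rw [alphaPrime_small k n hn, alphaPrime_small k m (hmn.trans hn)]
        exact (gc_alpha_growth (k + 2)).monotone_l hmn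
      have hlt : alphaPrime k n < n := alphaPrime_lt (by omega)
      rw [alphaPrime_rec k n (by omega)]
      by_cases hm : m ≤ k + 3
      · have htwo := IH _ hlt (two_le_alphaPrime (by omega))
        rw [alphaPrime_small k 2 (by omega)] at htwo
        rw [alphaPrime_small k m hm]
        have := alpha_le_alpha_two_add_two hm
        omega
      · rw [alphaPrime_rec k m (by omega)]
        exact Nat.add_le_add_left (IH _ hlt (ih hmn)) 2

/-! ### Comparison of `α'` with `α` -/

theorem alphaPrime_add_two_le (k n : ℕ) : alphaPrime (k + 2) n ≤ max (alphaPrime k n) 7 := by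
  have hsmall (m : ℕ) (hm : m ≤ k + 3) : alphaPrime (k + 2) m ≤ 3 :=
    (alphaPrime_small k m hm).trans_le (alpha_le_three k m hm)
  by_cases hn : n ≤ k + 3
  · have := hsmall n hn
    omega
  rw [alphaPrime_rec k n (by omega)]
  set m := alphaPrime k n
  rcases le_or_gt m (k + 3) with hm | hm
  · have := hsmall m hm
    omega
  rcases le_or_gt m (k + 5) with hm' | hm'
  · have hle := alphaPrime_le_sub_two k m (by omega)
    have := hsmall (alphaPrime k m) (by omega)
    rw [alphaPrime_rec k m (by omega)]
    omega
  · have := alphaPrime_le_sub_two (k + 2) m (by omega)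
    omega

theorem alphaPrime_eq_alpha_of_lt_two {k : ℕ} (hk : k < 2) (n : ℕ) :
    alphaPrime k n = alpha k n := by
  interval_cases k
  · exact alphaPrime_zero n
  · exact alphaPrime_one n

theorem alphaPrime_le_two_mul_of_lt_two {k n s : ℕ} (hk : k < 2) (h : n ≤ growth (k + 2) s) :
    alphaPrime (k + 2) n ≤ 2 * s := by
  induction s generalizing n with
  | zero =>
    have := growth_zero_le_two k
    rw [alphaPrime_small k n (by omega)]
    exact (gc_alpha_growth (k + 2)).l_le h
  | succ s ih =>
    by_cases hn : n ≤ k + 3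
    · rw [alphaPrime_small k n hn]
      exact ((gc_alpha_growth (k + 2)).l_le h).trans (by omega)
    rw [growth_succ] at h
    rw [alphaPrime_rec k n (by omega), alphaPrime_eq_alpha_of_lt_two hk]
    have := ih ((gc_alpha_growth k).l_le h)
    omega

theorem alphaPrime_le_of_le_two_pow (k : ℕ) {n s : ℕ} (h : n ≤ 2 ^ s) :
    alphaPrime (k + 2) n ≤ max (2 * s) 7 := by
  have hbase (k : ℕ) (hk : k < 2) : alphaPrime (k + 2) n ≤ max (2 * s) 7 :=
    (alphaPrime_le_two_mul_of_lt_two hk (h.trans (two_pow_le_growth k s))).trans (le_max_left _ _)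
  induction k using Nat.twoStepInduction with
  | zero => exact hbase 0 two_pos
  | one => exact hbase 1 one_lt_two
  | more k ih _ => exact (alphaPrime_add_two_le (k + 2) n).trans (max_le ih (le_max_right _ _))

/-- The slack `4 * growth + 16` absorbs the additive constant in the bound for `k`. -/
theorem alphaPrime_le_of_le_growth {k : ℕ}
    (ih : ∀ n, alphaPrime (k + 2) n ≤ 2 * alpha (k + 2) n + 10) {n s : ℕ}
    (h : n ≤ 4 * growth (k + 2 + 2) s + 16) : alphaPrime (k + 2 + 2) n ≤ 2 * s + 10 := by
  induction s generalizing n with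
  | zero =>
    have := growth_zero_le_two (k + 2)
    exact alphaPrime_le_of_le_two_pow (k + 2) (s := 5) (by omega)
  | succ s ihs =>
    by_cases hn : n ≤ 32
    · exact (alphaPrime_le_of_le_two_pow (k + 2) (s := 5) hn).trans (by omega)
    by_cases hnk : n ≤ k + 5
    · rw [alphaPrime_small (k + 2) n hnk]
      exact (alpha_le_three (k + 2) n hnk).trans (by omega)
    rw [growth_succ] at h
    rw [alphaPrime_rec (k + 2) n (by omega)]
    set x := growth (k + 2 + 2) s
    have halpha : alpha (k + 2) n ≤ x + 3 := (gc_alpha_growth (k + 2)).l_le <| by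
      have h1 := two_mul_growth_le k x
      have h2 := two_mul_growth_le k (x + 1)
      have h3 := two_mul_growth_le k (x + 1 + 1)
      change n ≤ growth (k + 2) (x + 1 + 1 + 1)
      omega
    have hx := ih n
    have := ihs (n := alphaPrime (k + 2) n) (by omega)
    omega

theorem alphaPrime_le_two_mul_alpha (k n : ℕ) :
    alphaPrime (k + 2) n ≤ 2 * alpha (k + 2) n + 10 := by
  have hle (k n : ℕ) : n ≤ growth k (alpha k n) := (gc_alpha_growth k).le_u_l n
  induction k using Nat.twoStepInduction generalizing n with
  | zero => exact le_add_right (alphaPrime_le_two_mul_of_lt_two two_pos (hle 2 n))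
  | one => exact le_add_right (alphaPrime_le_two_mul_of_lt_two one_lt_two (hle 3 n))
  | more k ih _ =>
    have := hle (k + 2 + 2) n
    exact alphaPrime_le_of_le_growth ih (by omega)

end TreeSpanner

namespace TreeSpanner

/-! ### The cost of computing `α'` -/

/-- The number of steps of `computeAlpha` on the arguments `k` and `n`. As in `alphaPrime`, the cap
at `n - 1` is never active. -/
noncomputable def alphaCost : ℕ → ℕ → ℕ
  | 0, _ => 1
  | 1, n => alpha 1 n + 2
  | k + 2, n =>
    if k + 4 ≤ n then 1 + alphaCost k n + alphaCost (k + 2) (min (alphaPrime k n) (n - 1)) else 1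
termination_by k n => (k, n)
decreasing_by
  · exact Prod.Lex.left _ _ (by omega)
  · exact Prod.Lex.right _ (by omega)

theorem alphaCost_small {k n : ℕ} (h : n ≤ k + 3) : alphaCost (k + 2) n = 1 := by
  rw [alphaCost, if_neg (by omega)]

theorem alphaCost_rec {k n : ℕ} (h : k + 4 ≤ n) :
    alphaCost (k + 2) n = 1 + alphaCost k n + alphaCost (k + 2) (alphaPrime k n) := by
  have := alphaPrime_lt h
  rw [alphaCost, if_pos h, min_eq_left (by omega)]

theorem alphaCost_le_of_lt_two {k : ℕ} (hk : k < 2) (n : ℕ) : alphaCost k n ≤ n + 2 := by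
  interval_cases k
  · rw [alphaCost]; omega
  · rw [alphaCost]
    exact Nat.add_le_add_right (alpha_one_le n n (Nat.le_self_pow two_ne_zero n)) 2

theorem alphaPrime_le_half {k n : ℕ} (hk : k < 2) (hn : k + 4 ≤ n) :
    alphaPrime k n ≤ (n + 1) / 2 := by
  interval_cases k
  · rw [alphaPrime_zero, alpha_zero_eq]
  · rw [alphaPrime_one]
    have hhalf : n ≤ 2 * ((n + 1) / 2) := by omega
    have hthree : 3 ≤ (n + 1) / 2 := by omega
    exact alpha_one_le _ _ (by nlinarith)

/-- Unfolding the recursion in `j` costs at most two steps per level, except on the at most `M`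
levels `i` with `i < α'_i(n)`, where there is a call of cost at most `c * M`. -/
theorem alphaCost_le_of_forall_lt {c n M : ℕ} (hc : 1 ≤ c) (hM : ∀ k, alphaPrime (k + 2) n ≤ M)
    (ih : ∀ m < n, ∀ k, k + 4 ≤ m → alphaCost (k + 2) m ≤ c * m) {j : ℕ} (hj : j + 4 ≤ n) :
    alphaCost (j + 2) n ≤ n + 3 + c * ((n + 1) / 2) + 2 * j + c * M * min j M := by
  induction j using Nat.strong_induction_on with
  | _ j IH =>
    rw [alphaCost_rec hj]
    rcases lt_or_ge j 2 with hj2 | hj2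
    · have hfirst := alphaCost_le_of_lt_two hj2 n
      have hsecond : alphaCost (j + 2) (alphaPrime j n) ≤ c * ((n + 1) / 2) := by
        rcases le_or_gt (j + 4) (alphaPrime j n) with h | h
        · exact (ih _ (alphaPrime_lt hj) j h).trans
            (Nat.mul_le_mul_left c (alphaPrime_le_half hj2 hj))
        · rw [alphaCost_small (by omega)]
          exact Nat.mul_pos hc (by omega)
      omega
    · obtain ⟨i, rfl⟩ := Nat.exists_eq_add_of_le' hj2
      have hfirst := IH i (by omega) (by omega)
      rcases le_or_gt (i + 2 + 4) (alphaPrime (i + 2) n) with h | h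
      · have hsecond : alphaCost (i + 2 + 2) (alphaPrime (i + 2) n) ≤ c * M :=
          (ih _ (alphaPrime_lt hj) (i + 2) h).trans (Nat.mul_le_mul_left c (hM i))
        have hmin : c * M * (min i M + 1) ≤ c * M * min (i + 2) M :=
          Nat.mul_le_mul_left _ (by have := hM i; omega)
        rw [mul_add_one] at hmin
        omega
      · have hmin : c * M * min i M ≤ c * M * min (i + 2) M := Nat.mul_le_mul_left _ (by omega)
        have hsecond := alphaCost_small (k := i + 2) (n := alphaPrime (i + 2) n) (by omega)
        omega

theorem sixteen_mul_sq_add_two_le_two_pow {s : ℕ} (hs : 12 ≤ s) :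
    16 * (s + 1) ^ 2 + 2 ≤ 2 ^ s := by
  induction s, hs using Nat.le_induction with
  | base => norm_num
  | succ s hs ih =>
    rw [pow_succ 2 s]
    nlinarith

theorem exists_alphaPrime_le_sqrt {n : ℕ} (hn : 2 ^ 13 ≤ n) :
    ∃ M, (∀ k, alphaPrime (k + 2) n ≤ M) ∧ 4 * M ^ 2 + 2 ≤ n := by
  have hclog : n ≤ 2 ^ Nat.clog 2 n := Nat.le_pow_clog one_lt_two n
  have hlt : 2 ^ (Nat.clog 2 n - 1) < n := Nat.pow_pred_clog_lt_self one_lt_two (by omega)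
  have hlarge : 13 ≤ Nat.clog 2 n := (Nat.pow_le_pow_iff_right one_lt_two).1 (hn.trans hclog)
  obtain ⟨s, hs⟩ := Nat.exists_eq_add_of_le' (show 1 ≤ Nat.clog 2 n by omega)
  rw [hs] at hclog hlt hlarge
  refine ⟨2 * (s + 1), fun k => ?_, ?_⟩
  · exact (alphaPrime_le_of_le_two_pow k hclog).trans (by omega)
  · have := sixteen_mul_sq_add_two_le_two_pow (s := s) (by omega)
    rw [Nat.add_sub_cancel] at hlt
    nlinarith

theorem exists_alphaCost_le : ∃ c, ∀ k n, k + 2 ≤ n → alphaCost k n ≤ c * n := by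
  obtain ⟨c₀, hc₀⟩ := ((Finset.range (2 ^ 13) ×ˢ Finset.range (2 ^ 13)).image
    fun p => alphaCost p.1 p.2).exists_le
  simp only [Finset.forall_mem_image, Finset.mem_product, Finset.mem_range] at hc₀
  refine ⟨c₀ + 24, fun k n => ?_⟩
  induction n using Nat.strong_induction_on generalizing k with
  | _ n ih =>
    intro hkn
    rcases lt_or_ge k 2 with hk | hk
    · have := alphaCost_le_of_lt_two hk n
      nlinarith
    obtain ⟨j, rfl⟩ := Nat.exists_eq_add_of_le' hk
    rcases lt_or_ge n (2 ^ 13) with hn | hn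
    · have := @hc₀ (j + 2, n) ⟨by omega, hn⟩
      nlinarith
    obtain ⟨M, hM, hMn⟩ := exists_alphaPrime_le_sqrt hn
    have hcost := alphaCost_le_of_forall_lt (c := c₀ + 24) (by omega) hM
      (fun m hm k hk => ih m hm (k + 2) (by omega)) (j := j) (by omega)
    have hmin : (c₀ + 24) * M * min j M ≤ (c₀ + 24) * M ^ 2 := by
      rw [mul_assoc, sq]
      exact Nat.mul_le_mul_left _ (Nat.mul_le_mul_left _ (min_le_right _ _))
    have hlinear : (c₀ + 24) * (4 * M ^ 2 + 2 + 4 * ((n + 1) / 2)) ≤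
        (c₀ + 24) * (n + 2 * (n + 1)) := Nat.mul_le_mul_left _ (by omega)
    nlinarith

end TreeSpanner

namespace TreeSpanner

/-! ### Results and costs of the procedures -/

section Returns

open Filter

variable {X Y : Type} {x : X} {y : Y} {m c : ℕ}

/-- The computation `p` returns `x` after exactly `c` steps, whatever has been counted before. -/
def Returns (p : Alg X) (x : X) (c : ℕ) : Prop := ∀ t, p.run t = some (x, t + c)

theorem Returns.pure (x : X) : Returns (Pure.pure x) x 0 := fun _ => rfl

theorem Returns.congr {p : Alg X} {x' : X} (h : Returns p x m) (hx : x = x') (hc : m = c) :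
    Returns p x' c := hx ▸ hc ▸ h

theorem Returns.bind {p : Alg X} {f : X → Alg Y} (hp : Returns p x m) (hf : Returns (f x) y c) :
    Returns (p >>= f) y (m + c) := fun t => by
  rw [StateT.run_bind, hp t, ← add_assoc]
  exact hf (t + m)

theorem Returns.tick_bind {p : Alg X} (h : Returns p x c) :
    Returns (tick >>= fun _ => p) x (c + 1) := fun t => by
  rw [add_comm c, ← add_assoc]
  exact h (t + 1)

/-- The computation `p` with depth bound `d` returns `x` after exactly `c` steps, provided that `d`
is large enough: this is termination in the sense of the step-counting model. -/
def EventuallyReturns (p : ℕ → Alg X) (x : X) (c : ℕ) : Prop := ∀ᶠ d in atTop, Returns (p d) x c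

theorem EventuallyReturns.of_succ {p : ℕ → Alg X}
    (h : ∀ᶠ d in atTop, Returns (p (d + 1)) x c) : EventuallyReturns p x c := by
  rwa [EventuallyReturns, ← map_add_atTop_eq_nat 1, eventually_map]

end Returns

theorem returns_sqrtSearch {n r : ℕ} (hr : n ≤ r * r) (hlt : ∀ i < r, i * i < n) {d j : ℕ}
    (hj : j ≤ r) (hd : r < d + j) : Returns (sqrtSearch d n j) r (r - j + 1) := by
  induction d generalizing j with
  | zero => omega
  | succ d ih =>
    rw [sqrtSearch]
    refine .tick_bind ?_
    rcases hj.eq_or_lt with rfl | hj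
    · rw [if_pos hr, Nat.sub_self]
      exact .pure _
    · rw [if_neg (hlt j hj).not_ge]
      exact (ih hj (by omega)).congr rfl (by omega)

theorem eventuallyReturns_computeAlpha_one (n : ℕ) :
    EventuallyReturns (fun d => computeAlpha d 1 n) (alphaPrime 1 n) (alphaCost 1 n) := by
  have hmin : ∀ i < alpha 1 n, i * i < n := fun i hi => by
    contrapose! hi
    exact alpha_one_le n i (by rwa [sq])
  refine .of_succ ((Filter.eventually_gt_atTop (alpha 1 n)).mono fun d hd => ?_)
  rw [computeAlpha, if_neg one_ne_zero, if_pos rfl, alphaPrime_one, alphaCost]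
  refine .tick_bind (returns_sqrtSearch ?_ hmin (Nat.zero_le _) hd)
  rw [← sq]
  exact le_alpha_one_sq n

theorem returns_computeAlpha_of_le (d : ℕ) {k n : ℕ} (h : n ≤ k + 3) :
    Returns (computeAlpha (d + 1) (k + 2) n) (alphaPrime (k + 2) n) (alphaCost (k + 2) n) := by
  rw [computeAlpha, if_neg (by omega), if_neg (by omega), if_pos (by omega), alphaPrime_small k n h,
    alphaCost_small h]
  refine .tick_bind ?_
  obtain ⟨j, rfl | rfl⟩ := Nat.even_or_odd' k
  · rw [if_pos (by omega), alpha_even_small h]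
    split_ifs <;> exact .pure _
  · rw [if_neg (by omega), alpha_odd_small h]
    split_ifs <;> exact .pure _

theorem eventuallyReturns_computeAlpha (k n : ℕ) :
    EventuallyReturns (fun d => computeAlpha d k n) (alphaPrime k n) (alphaCost k n) := by
  induction k using Nat.twoStepInduction generalizing n with
  | zero =>
    refine .of_succ (.of_forall fun d => ?_)
    rw [computeAlpha, if_pos rfl, alphaPrime_zero, alpha_zero_eq, alphaCost]
    exact .tick_bind (.pure _)
  | one => exact eventuallyReturns_computeAlpha_one n
  | more k ih _ =>
    induction n using Nat.strong_induction_on with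
    | _ n IH =>
      rcases le_or_gt n (k + 3) with h | h
      · exact .of_succ (.of_forall fun d => returns_computeAlpha_of_le d h)
      refine .of_succ ?_
      filter_upwards [ih n, IH _ (alphaPrime_lt h)] with d hfirst hsecond
      rw [computeAlpha, if_neg (by omega), if_neg (by omega), if_neg (by omega),
        alphaPrime_rec k n h, alphaCost_rec h]
      exact .congr (.tick_bind (hfirst.bind (hsecond.bind (.pure (2 + _))))) rfl (by omega)

namespace Forest

variable {A B V : Type}

/-- The number of vertices of a forest. -/
def size : Forest A → ℕ
  | nil => 0
  | node _ c s => c.size + s.size + 1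

theorem length_labels (T : Forest A) : T.labels.length = T.size := by
  induction T with
  | nil => rfl
  | node a c s hc hs => rw [labels, size, List.length_cons, List.length_append, hc, hs]

/-- The vertex-wise image of a forest. -/
def map (f : A → B) : Forest A → Forest B
  | nil => nil
  | node a c s => node (f a) (c.map f) (s.map f)

/-- The result of `prune`. -/
def pruned : Forest (V × Bool) → Forest (V × Bool)
  | nil => nil
  | node (v, true) c s => node (v, true) c.pruned s.pruned
  | node (v, false) c s =>
    match c.pruned with
    | nil => s.pruned
    | node a d nil => node a d s.pruned
    | node a d (node a₂ d₂ s₂) => node (v, false) (node a d (node a₂ d₂ s₂)) s.pruned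

theorem returns_prune (T : Forest (V × Bool)) : Returns (prune T) T.pruned (2 * T.size + 1) := by
  induction T with
  | nil => exact .tick_bind (.pure _)
  | node a c s hc hs =>
    obtain ⟨v, b⟩ := a
    rw [prune]
    refine .congr (.tick_bind (hc.bind (hs.bind (c := 0) ?_))) rfl (by rw [size]; omega)
    cases b with
    | true => exact .pure _
    | false =>
      rw [pruned]
      match c.pruned with
      | nil | node a d nil | node a d (node a₂ d₂ s₂) => exact .pure _

/-- The result of `decomp`: the forest with the cut vertices marked in the second flag, and the
number of required vertices that are left. -/
def decomposed (ℓ : ℕ) : Forest (V × Bool) → Forest (V × Bool × Bool) × ℕ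
  | nil => (nil, 0)
  | node (v, b) c s =>
    let size := if b then (c.decomposed ℓ).2 + 1 else (c.decomposed ℓ).2
    if ℓ < size then (node (v, b, true) (c.decomposed ℓ).1 (s.decomposed ℓ).1, (s.decomposed ℓ).2)
    else (node (v, b, false) (c.decomposed ℓ).1 (s.decomposed ℓ).1, size + (s.decomposed ℓ).2)

theorem returns_decomp (ℓ : ℕ) (T : Forest (V × Bool)) :
    Returns (decomp ℓ T) (T.decomposed ℓ) (2 * T.size + 1) := by
  induction T with
  | nil => exact .tick_bind (.pure _)
  | node a c s hc hs =>
    obtain ⟨v, b⟩ := a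
    rw [decomp]
    refine .congr (.tick_bind (hc.bind (hs.bind (c := 0) ?_))) rfl (by rw [size]; omega)
    rw [decomposed]
    dsimp only
    split_ifs <;> exact .pure _

/-- The result of `requiredList`. -/
def requiredVerts : Forest (V × Bool) → List V
  | nil => []
  | node (v, true) c s => v :: (s.requiredVerts ++ c.requiredVerts)
  | node (_, false) c s => s.requiredVerts ++ c.requiredVerts

theorem returns_requiredList (T : Forest (V × Bool)) (acc : List V) :
    Returns (requiredList T acc) (T.requiredVerts ++ acc) (2 * T.size + 1) := by
  induction T generalizing acc with
  | nil => exact .tick_bind (.pure _)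
  | node a c s hc hs =>
    obtain ⟨v, b⟩ := a
    rw [requiredList]
    refine .congr (.tick_bind ((hc _).bind ((hs _).bind (c := 0) ?_))) rfl (by rw [size]; omega)
    cases b <;> exact (Returns.pure _).congr (by simp [requiredVerts]) rfl

/-- The result of `recolor`: the forest in which exactly the marked vertices are required. -/
def recolored (M : Forest (V × Bool × Bool)) : Forest (V × Bool) := M.map fun a => (a.1, a.2.2)

theorem returns_recolor (M : Forest (V × Bool × Bool)) :
    Returns (recolor M) M.recolored (2 * M.size + 1) := by
  induction M with
  | nil => exact .tick_bind (.pure _)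
  | node a c s hc hs =>
    rw [recolor]
    exact .congr (.tick_bind (hc.bind (hs.bind (.pure _)))) rfl (by rw [size]; omega)

theorem returns_cutVertices (M : Forest (V × Bool × Bool)) (acc : List V) :
    Returns (cutVertices M acc) (M.recolored.requiredVerts ++ acc) (2 * M.size + 1) := by
  induction M generalizing acc with
  | nil => exact .tick_bind (.pure _)
  | node a c s hc hs =>
    obtain ⟨v, b, cut⟩ := a
    rw [cutVertices]
    refine .congr (.tick_bind ((hc _).bind ((hs _).bind (c := 0) ?_))) rfl (by rw [size]; omega)
    cases cut <;> exact (Returns.pure _).congr (by simp [recolored, map, requiredVerts]) rfl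

/-- The result of `treeEdges`: the edges of a forest, including those from a given parent to the
roots. -/
def parentEdges : Option V → Forest (V × Bool) → List (V × V)
  | _, nil => []
  | parent, node (v, _) c s =>
    (parent.toList.map fun p => (p, v)) ++ (s.parentEdges parent ++ c.parentEdges (some v))

theorem returns_treeEdges (p : Option V) (T : Forest (V × Bool)) (acc : List (V × V)) :
    Returns (treeEdges p T acc) (T.parentEdges p ++ acc) (2 * T.size + 1) := by
  induction T generalizing p acc with
  | nil => exact .tick_bind (.pure _)
  | node a c s hc hs =>
    rw [treeEdges]
    refine .congr (.tick_bind ((hc _ _).bind ((hs _ _).bind (c := 0) ?_))) rfl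
      (by rw [size]; omega)
    cases p <;> exact (Returns.pure _).congr (by simp [parentEdges]) rfl

/-- The result of `split`, started with empty accumulators. -/
def splitted : Position V → Forest (V × Bool × Bool) →
    Forest (V × Bool) × List V × List (Component V)
  | _, nil => (nil, [], [])
  | pos, node (v, _, true) c s =>
    ((s.splitted pos).1, (s.splitted pos).2.1 ++ [v],
      (s.splitted pos).2.2 ++ (c.splitted (.below (some v))).2.2)
  | .inside, node (v, b, false) c s =>
    (node (v, b) (c.splitted .inside).1 (s.splitted .inside).1,
      (s.splitted .inside).2.1 ++ (c.splitted .inside).2.1,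
      (s.splitted .inside).2.2 ++ (c.splitted .inside).2.2)
  | .below u, node (v, b, false) c s =>
    ((s.splitted (.below u)).1, (s.splitted (.below u)).2.1,
      (s.splitted (.below u)).2.2 ++
        ⟨node (v, b) (c.splitted .inside).1 nil, u.toList ++ (c.splitted .inside).2.1⟩ ::
        (c.splitted .inside).2.2)

theorem returns_split (pos : Position V) (M : Forest (V × Bool × Bool)) (border : List V)
    (done : List (Component V)) :
    Returns (split pos M border done)
      ((M.splitted pos).1, (M.splitted pos).2.1 ++ border, (M.splitted pos).2.2 ++ done)
      (2 * M.size + 1) := by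
  induction M generalizing pos border done with
  | nil => cases pos <;> exact .tick_bind (.pure _)
  | node a c s hc hs =>
    have hsize : 2 * c.size + 1 + (2 * s.size + 1) + 1 = 2 * (node a c s).size + 1 := by
      rw [size]; omega
    match a, pos with
    | (v, b, true), pos =>
      rw [split]
      refine .congr (.tick_bind ((hc _ _ _).bind (hs _ _ _))) ?_ hsize
      simp [splitted]
    | (v, b, false), .inside =>
      rw [split]
      refine .congr (.tick_bind ((hc _ _ _).bind ((hs _ _ _).bind (.pure _)))) ?_ hsize
      simp [splitted]
    | (v, b, false), .below u =>
      rw [split]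
      refine .congr (.tick_bind ((hc _ _ _).bind (hs _ _ _))) ?_ hsize
      cases u <;> simp [splitted]

end Forest

section Lists

variable {V X : Type}

theorem returns_count (l : List X) : Returns (count l) l.length (l.length + 1) := by
  induction l with
  | nil => exact .tick_bind (.pure _)
  | cons x l ih =>
    rw [count]
    refine .tick_bind (ih.bind (c := 0) ?_)
    exact .pure _

theorem returns_pairsWith (v : V) (l : List V) (acc : List (V × V)) :
    Returns (pairsWith v l acc) ((l.map fun u => (u, v)).reverse ++ acc) (l.length + 1) := by
  induction l generalizing acc with
  | nil => exact .tick_bind (.pure _)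
  | cons u l ih =>
    rw [pairsWith]
    exact .congr (.tick_bind (ih _)) (by simp) rfl

/-- The edges of the complete graph on a list of distinct vertices, as listed by
`completeEdges`. -/
def completePairs : List V → List (V × V)
  | [] => []
  | v :: l => completePairs l ++ (l.map fun u => (u, v)).reverse

theorem exists_returns_completeEdges (l : List V) :
    ∃ c ≤ (l.length + 1) * (l.length + 1), ∀ acc,
      Returns (completeEdges l acc) (completePairs l ++ acc) c := by
  induction l with
  | nil => exact ⟨1, by simp, fun acc => .tick_bind (.pure _)⟩
  | cons v l ih =>
    obtain ⟨c, hc, h⟩ := ih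
    refine ⟨l.length + 1 + c + 1, by rw [List.length_cons]; nlinarith, fun acc => ?_⟩
    rw [completeEdges]
    exact .congr (.tick_bind ((returns_pairsWith _ _ _).bind (h _))) (by simp [completePairs]) rfl

/-- The pairs of a vertex of the first list and a vertex of the second list, as listed by
`connectAll`. -/
def crossPairs (border l : List V) : List (V × V) :=
  l.reverse.flatMap fun v => (border.map fun u => (u, v)).reverse

theorem returns_connectAll (border l : List V) (acc : List (V × V)) :
    Returns (connectAll border l acc) (crossPairs border l ++ acc)
      (l.length * (border.length + 2) + 1) := by
  induction l generalizing acc with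
  | nil => exact .tick_bind (.congr (.pure _) rfl (by simp))
  | cons v l ih =>
    rw [connectAll]
    refine .congr (.tick_bind ((returns_pairsWith _ _ _).bind (ih _))) (by simp [crossPairs]) ?_
    rw [List.length_cons]
    ring

/-- The edges between the required vertices of the components and their borders, as listed by
`borderEdges`. -/
def borderPairs (comps : List (Component V)) : List (V × V) :=
  comps.reverse.flatMap fun t => crossPairs t.border t.tree.requiredVerts

theorem returns_borderEdges (comps : List (Component V)) (acc : List (V × V)) :
    Returns (borderEdges comps acc) (borderPairs comps ++ acc)
      ((comps.map fun t => 3 + 2 * t.tree.size +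
        t.tree.requiredVerts.length * (t.border.length + 2)).sum + 1) := by
  induction comps generalizing acc with
  | nil => exact .tick_bind (.pure _)
  | cons t l ih =>
    rw [borderEdges]
    refine .congr (.tick_bind ((t.tree.returns_requiredList []).bind
      ((returns_connectAll _ _ _).bind (ih _)))) (by simp [borderPairs]) ?_
    rw [List.map_cons, List.sum_cons, List.append_nil]
    ring

theorem returns_spanComponents
    {call : Forest (V × Bool) → ℕ → List (V × V) → Alg (List (V × V))}
    {E : Component V → List (V × V)} {cost : Component V → ℕ} {comps : List (Component V)}
    (h : ∀ t ∈ comps, ∀ acc,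
      Returns (call t.tree.pruned t.tree.requiredVerts.length acc) (E t ++ acc) (cost t))
    (acc : List (V × V)) :
    Returns (spanComponents call comps acc) (comps.reverse.flatMap E ++ acc)
      ((comps.map fun t =>
        cost t + 4 * t.tree.size + t.tree.requiredVerts.length + 4).sum + 1) := by
  induction comps generalizing acc with
  | nil => exact .tick_bind (.pure _)
  | cons t l ih =>
    rw [List.forall_mem_cons] at h
    have hreq := t.tree.returns_requiredList []
    rw [List.append_nil] at hreq
    rw [spanComponents]
    refine .congr (.tick_bind (t.tree.returns_prune.bind (hreq.bind
      ((returns_count _).bind ((h.1 _).bind (ih h.2 _)))))) (by simp) ?_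
    rw [List.map_cons, List.sum_cons]
    ring

end Lists

end TreeSpanner

namespace TreeSpanner.Forest

variable {A V : Type}

/-! ### Reduced forests -/

@[simp] theorem verts_nil : (nil : Forest (V × Bool)).verts = [] := rfl

@[simp] theorem verts_node (a : V × Bool) (c s : Forest (V × Bool)) :
    (node a c s).verts = a.1 :: (c.verts ++ s.verts) := by
  rw [verts, labels, List.map_cons, List.map_append, verts, verts]

theorem nodup_verts_node {a : V × Bool} {c s : Forest (V × Bool)} :
    (node a c s).verts.Nodup ↔ a.1 ∉ c.verts ∧ a.1 ∉ s.verts ∧ c.verts.Nodup ∧ s.verts.Nodup ∧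
      ∀ x ∈ c.verts, x ∉ s.verts := by
  rw [verts_node, List.nodup_cons, List.nodup_append', List.mem_append, not_or]
  simp only [List.disjoint_left]
  tauto

theorem mem_verts_of_mem_roots {T : Forest (V × Bool)} {x : V} (h : x ∈ T.roots.map Prod.fst) :
    x ∈ T.verts := by
  induction T with
  | nil => exact h
  | node a c s _ hs =>
    rw [roots, List.map_cons, List.mem_cons] at h
    rw [verts_node, List.mem_cons, List.mem_append]
    exact h.imp_right fun h => .inr (hs h)

theorem IsChild.mem {T : Forest (V × Bool)} {x y : V} (h : T.IsChild x y) :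
    x ∈ T.verts ∧ y ∈ T.verts := by
  induction T with
  | nil => exact h.elim
  | node a c s hc hs =>
    simp only [verts_node, List.mem_cons, List.mem_append]
    rcases h with ⟨rfl, h⟩ | h | h
    · exact ⟨.inl rfl, .inr (.inl (mem_verts_of_mem_roots h))⟩
    · exact (hc h).imp (.inr ∘ .inl) (.inr ∘ .inl)
    · exact (hs h).imp (.inr ∘ .inr) (.inr ∘ .inr)

theorem IsChild.ne {T : Forest (V × Bool)} (hT : T.verts.Nodup) {x y : V} (h : T.IsChild x y) :
    x ≠ y := by
  induction T with
  | nil => exact h.elim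
  | node a c s hc hs =>
    obtain ⟨ha, -, hTc, hTs, -⟩ := nodup_verts_node.1 hT
    rcases h with ⟨rfl, h⟩ | h | h
    · exact fun hxy => ha (hxy ▸ mem_verts_of_mem_roots h)
    · exact hc hTc h
    · exact hs hTs h

theorem mem_requiredVerts {T : Forest (V × Bool)} {x : V} :
    x ∈ T.requiredVerts ↔ x ∈ T.required := by
  rw [required, Set.mem_ofPred_eq]
  induction T with
  | nil => simp [requiredVerts, labels]
  | node a c s hc hs =>
    obtain ⟨v, b⟩ := a
    cases b <;> simp [requiredVerts, labels, hc, hs, or_comm]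

theorem mem_verts_of_mem_requiredVerts {T : Forest (V × Bool)} {x : V}
    (h : x ∈ T.requiredVerts) : x ∈ T.verts :=
  List.mem_map.2 ⟨_, mem_requiredVerts.1 h, rfl⟩

theorem nodup_requiredVerts {T : Forest (V × Bool)} (hT : T.verts.Nodup) :
    T.requiredVerts.Nodup := by
  induction T with
  | nil => exact List.nodup_nil
  | node a c s hc hs =>
    obtain ⟨hac, has, hTc, hTs, hdisj⟩ := nodup_verts_node.1 hT
    have happend : (s.requiredVerts ++ c.requiredVerts).Nodup :=
      List.nodup_append'.2 ⟨hs hTs, hc hTc, fun x hxs hxc =>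
        hdisj x (mem_verts_of_mem_requiredVerts hxc) (mem_verts_of_mem_requiredVerts hxs)⟩
    match a with
    | (_, false) => exact happend
    | (v, true) =>
      refine List.nodup_cons.2 ⟨fun h => ?_, happend⟩
      rcases List.mem_append.1 h with h | h
      · exact has (mem_verts_of_mem_requiredVerts h)
      · exact hac (mem_verts_of_mem_requiredVerts h)

theorem length_requiredVerts_node (a : V × Bool) (c s : Forest (V × Bool)) :
    (node a c s).requiredVerts.length =
      (if a.2 then 1 else 0) + c.requiredVerts.length + s.requiredVerts.length := by
  obtain ⟨v, b⟩ := a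
  cases b <;> simp [requiredVerts] <;> omega

/-- Every Steiner vertex has at least two children: the structural form of being pruned, which is
easy to maintain in inductions on the forest. -/
def IsReduced : Forest (V × Bool) → Prop
  | nil => True
  | node a c s => (a.2 = true ∨ 2 ≤ c.roots.length) ∧ c.IsReduced ∧ s.IsReduced

theorem length_roots_le_size (T : Forest A) : T.roots.length ≤ T.size := by
  induction T with
  | nil => exact le_rfl
  | node a c s _ hs => rw [roots, List.length_cons, size]; omega

theorem IsReduced.size_add_roots_le {T : Forest (V × Bool)} (h : T.IsReduced) :
    T.size + T.roots.length ≤ 2 * T.requiredVerts.length := by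
  induction T with
  | nil => exact le_rfl
  | node a c s hc hs =>
    obtain ⟨hroot, hredc, hreds⟩ := h
    have := hc hredc
    have := hs hreds
    rw [length_requiredVerts_node, roots, List.length_cons, size]
    split_ifs with hb
    · omega
    · have := hroot.resolve_left hb
      omega

theorem IsReduced.roots_le {T : Forest (V × Bool)} (h : T.IsReduced) :
    T.roots.length ≤ T.requiredVerts.length := by
  have := h.size_add_roots_le
  have := T.length_roots_le_size
  omega

theorem eq_nil_of_length_roots_eq_zero {T : Forest A} (h : T.roots.length = 0) : T = nil := by
  cases T with
  | nil => rfl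
  | node a c s => rw [roots, List.length_cons] at h; omega

/-- The concatenation of two forests. -/
def append : Forest A → Forest A → Forest A
  | nil, G => G
  | node a c s, G => node a c (s.append G)

theorem labels_append (F G : Forest A) : (F.append G).labels = F.labels ++ G.labels := by
  induction F with
  | nil => rfl
  | node a c s _ hs => rw [append, labels, labels, hs, List.cons_append, List.append_assoc]

theorem IsReduced.append {F G : Forest (V × Bool)} (hF : F.IsReduced) (hG : G.IsReduced) :
    (F.append G).IsReduced := by
  induction F with
  | nil => exact hG
  | node a c s _ hs => exact ⟨hF.1, hF.2.1, hs hF.2.2⟩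

theorem perm_requiredVerts_append (F G : Forest (V × Bool)) :
    (F.append G).requiredVerts.Perm (F.requiredVerts ++ G.requiredVerts) := by
  induction F with
  | nil => exact .refl _
  | node a c s _ hs =>
    have happend : ((s.append G).requiredVerts ++ c.requiredVerts).Perm
        (s.requiredVerts ++ c.requiredVerts ++ G.requiredVerts) := by
      refine (hs.append_right _).trans ?_
      rw [List.append_assoc, List.append_assoc]
      exact List.perm_append_comm.append_left _
    match a with
    | (v, true) => exact happend.cons v
    | (_, false) => exact happend

theorem pruned_false (v : V) (c s : Forest (V × Bool)) :
    (node (v, false) c s).pruned = if 2 ≤ c.pruned.roots.length then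
      node (v, false) c.pruned s.pruned else c.pruned.append s.pruned := by
  rw [pruned]
  rcases c.pruned with _ | ⟨a, d, _ | ⟨a₂, d₂, s₂⟩⟩ <;> simp [roots, append]

theorem isReduced_pruned (T : Forest (V × Bool)) : T.pruned.IsReduced := by
  induction T with
  | nil => trivial
  | node a c s hc hs =>
    match a with
    | (v, true) => exact ⟨.inl rfl, hc, hs⟩
    | (v, false) =>
      rw [pruned_false]
      split_ifs with h
      · exact ⟨.inr h, hc, hs⟩
      · exact hc.append hs

theorem labels_pruned_sublist (T : Forest (V × Bool)) : T.pruned.labels.Sublist T.labels := by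
  induction T with
  | nil => exact .refl _
  | node a c s hc hs =>
    match a with
    | (v, true) => exact (hc.append hs).cons_cons _
    | (v, false) =>
      rw [pruned_false]
      split_ifs
      · exact (hc.append hs).cons_cons _
      · rw [labels_append]
        exact (hc.append hs).cons _

theorem verts_pruned_sublist (T : Forest (V × Bool)) : T.pruned.verts.Sublist T.verts :=
  T.labels_pruned_sublist.map _

theorem perm_requiredVerts_pruned (T : Forest (V × Bool)) :
    T.pruned.requiredVerts.Perm T.requiredVerts := by
  induction T with
  | nil => exact .refl _
  | node a c s hc hs =>
    match a with
    | (v, true) => exact (hs.append hc).cons v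
    | (v, false) =>
      rw [pruned_false]
      split_ifs
      · exact hs.append hc
      · exact ((perm_requiredVerts_append _ _).trans List.perm_append_comm).trans (hs.append hc)

end TreeSpanner.Forest

namespace TreeSpanner.Forest

variable {V : Type} {T F G : Forest (V × Bool)}

/-! ### Paths in forests -/

/-- Adjacency in the underlying graph of a forest, stated without the condition `x ≠ y`, which is
automatic if the vertices have distinct names. -/
def Linked (T : Forest (V × Bool)) (x y : V) : Prop := T.IsChild x y ∨ T.IsChild y x

theorem Linked.symm {x y : V} (h : T.Linked x y) : T.Linked y x := Or.symm h

theorem Linked.mem {x y : V} (h : T.Linked x y) : x ∈ T.verts ∧ y ∈ T.verts :=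
  h.elim (fun h => h.mem) (fun h => h.mem.symm)

/-- A list of vertices that is empty or the vertex sequence of a path. -/
structure IsPathList (T : Forest (V × Bool)) (p : List V) : Prop where
  nodup : p.Nodup
  mem : ∀ x ∈ p, x ∈ T.verts
  chain : p.IsChain T.Linked

/-- A list of vertices that is empty or leads downwards from a root. -/
def IsDown : Forest (V × Bool) → List V → Prop
  | nil, l => l = []
  | node a c s, l => (∃ l', l = a.1 :: l' ∧ c.IsDown l') ∨ s.IsDown l

/-- Two lists that lead downwards in different trees of a forest. -/
def IsFork : Forest (V × Bool) → List V → List V → Prop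
  | nil, l₁, l₂ => l₁ = [] ∧ l₂ = []
  | node a c s, l₁, l₂ => (∃ l', l₁ = a.1 :: l' ∧ c.IsDown l' ∧ s.IsDown l₂) ∨
      (∃ l', l₂ = a.1 :: l' ∧ c.IsDown l' ∧ s.IsDown l₁) ∨ s.IsFork l₁ l₂

/-- A list of vertices that is empty or the vertex sequence of a path, described recursively:
at its topmost vertex a path splits into two branches. -/
def IsBend : Forest (V × Bool) → List V → Prop
  | nil, p => p = []
  | node a c s, p => (∃ l₁ l₂, c.IsFork l₁ l₂ ∧ p = l₁.reverse ++ a.1 :: l₂) ∨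
      c.IsBend p ∨ s.IsBend p

theorem isDown_nil (T : Forest (V × Bool)) : T.IsDown [] := by
  induction T with
  | nil => rfl
  | node a c s _ hs => exact .inr hs

theorem isBend_nil (T : Forest (V × Bool)) : T.IsBend [] := by
  induction T with
  | nil => rfl
  | node a c s _ hs => exact .inr (.inr hs)

theorem IsFork.symm {l₁ l₂ : List V} (h : T.IsFork l₁ l₂) : T.IsFork l₂ l₁ := by
  induction T with
  | nil => exact And.symm h
  | node a c s _ hs =>
    rcases h with h | h | h
    · exact .inr (.inl h)
    · exact .inl h
    · exact .inr (.inr (hs h))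

theorem IsDown.isFork {l : List V} (h : T.IsDown l) : T.IsFork l [] := by
  induction T with
  | nil => exact ⟨h, rfl⟩
  | node a c s _ hs =>
    rcases h with ⟨l', hl, h⟩ | h
    · exact .inl ⟨l', hl, h, s.isDown_nil⟩
    · exact .inr (.inr (hs h))

theorem IsFork.left {l₁ l₂ : List V} (h : T.IsFork l₁ l₂) : T.IsDown l₁ := by
  induction T with
  | nil => exact h.1
  | node a c s _ hs =>
    rcases h with ⟨l', hl, h, -⟩ | ⟨-, -, -, h⟩ | h
    · exact .inl ⟨l', hl, h⟩
    · exact .inr h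
    · exact .inr (hs h)

theorem IsFork.right {l₁ l₂ : List V} (h : T.IsFork l₁ l₂) : T.IsDown l₂ := h.symm.left

theorem IsDown.isBend {l : List V} (h : T.IsDown l) : T.IsBend l := by
  induction T with
  | nil => exact h
  | node a c s _ hs =>
    rcases h with ⟨l', rfl, h⟩ | h
    · exact .inl ⟨[], l', h.isFork.symm, rfl⟩
    · exact .inr (.inr (hs h))

theorem IsDown.isBend_reverse {l : List V} (h : T.IsDown l) : T.IsBend l.reverse := by
  induction T with
  | nil => exact List.reverse_eq_nil_iff.2 h
  | node a c s _ hs =>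
    rcases h with ⟨l', rfl, h⟩ | h
    · exact .inl ⟨l', [], h.isFork, List.reverse_cons⟩
    · exact .inr (.inr (hs h))

theorem IsFork.eq_nil_or_eq_nil {l₁ l₂ : List V} (h : T.IsFork l₁ l₂)
    (hT : ¬ 2 ≤ T.roots.length) : l₁ = [] ∨ l₂ = [] := by
  match T with
  | nil => exact .inl h.1
  | node a c nil =>
    rcases h with ⟨-, -, -, h⟩ | ⟨-, -, -, h⟩ | h
    · exact .inr h
    · exact .inl h
    · exact .inl h.1
  | node a c (node a₂ c₂ s) => simp [roots] at hT

theorem IsDown.append_left {l : List V} (h : F.IsDown l) : (F.append G).IsDown l := by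
  induction F with
  | nil =>
    obtain rfl : l = [] := h
    exact isDown_nil _
  | node a c s _ hs => exact h.imp_right hs

theorem IsDown.append_right {l : List V} (h : G.IsDown l) : (F.append G).IsDown l := by
  induction F with
  | nil => exact h
  | node a c s _ hs => exact .inr hs

theorem IsFork.append_right {l₁ l₂ : List V} (h : G.IsFork l₁ l₂) :
    (F.append G).IsFork l₁ l₂ := by
  induction F with
  | nil => exact h
  | node a c s _ hs => exact .inr (.inr hs)

theorem IsDown.isFork_append {l₁ l₂ : List V} (h₁ : F.IsDown l₁) (h₂ : G.IsDown l₂) :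
    (F.append G).IsFork l₁ l₂ := by
  induction F with
  | nil =>
    obtain rfl : l₁ = [] := h₁
    exact h₂.isFork.symm
  | node a c s _ hs =>
    rcases h₁ with ⟨l', hl, h₁⟩ | h₁
    · exact .inl ⟨l', hl, h₁, h₂.append_right⟩
    · exact .inr (.inr (hs h₁))

theorem IsBend.append_left {p : List V} (h : F.IsBend p) : (F.append G).IsBend p := by
  induction F with
  | nil =>
    obtain rfl : p = [] := h
    exact isBend_nil _
  | node a c s _ hs => exact h.imp_right (Or.imp_right hs)

theorem IsBend.append_right {p : List V} (h : G.IsBend p) : (F.append G).IsBend p := by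
  induction F with
  | nil => exact h
  | node a c s _ hs => exact .inr (.inr hs)

theorem IsDown.mem {l : List V} (h : T.IsDown l) : ∀ x ∈ l, x ∈ T.verts := by
  induction T generalizing l with
  | nil =>
    obtain rfl : l = [] := h
    exact fun _ => id
  | node a c s hc hs =>
    intro x hx
    rw [verts_node, List.mem_cons, List.mem_append]
    rcases h with ⟨l', rfl, h⟩ | h
    · exact (List.mem_cons.1 hx).imp_right fun hx => .inl (hc h x hx)
    · exact .inr (.inr (hs h x hx))

theorem IsBend.mem {p : List V} (h : T.IsBend p) : ∀ x ∈ p, x ∈ T.verts := by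
  induction T with
  | nil =>
    obtain rfl : p = [] := h
    exact fun _ => id
  | node a c s hc hs =>
    intro x hx
    rw [verts_node, List.mem_cons, List.mem_append]
    rcases h with ⟨l₁, l₂, h, rfl⟩ | h | h
    · rw [List.mem_append, List.mem_reverse, List.mem_cons] at hx
      rcases hx with hx | hx | hx
      · exact .inr (.inl (h.left.mem x hx))
      · exact .inl hx
      · exact .inr (.inl (h.right.mem x hx))
    · exact .inr (.inl (hc h x hx))
    · exact .inr (.inr (hs h x hx))

section Node

variable {a : V × Bool} {c s : Forest (V × Bool)} {x y : V}

theorem Linked.node_left (h : c.Linked x y) : (node a c s).Linked x y :=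
  h.imp (fun h => .inr (.inl h)) (fun h => .inr (.inl h))

theorem Linked.node_right (h : s.Linked x y) : (node a c s).Linked x y :=
  h.imp (fun h => .inr (.inr h)) (fun h => .inr (.inr h))

theorem Linked.mem_roots (hT : (node a c s).verts.Nodup) (h : (node a c s).Linked a.1 y) :
    y ∈ c.roots.map Prod.fst := by
  obtain ⟨hac, has, -⟩ := nodup_verts_node.1 hT
  rcases h with (⟨-, h⟩ | h | h) | (⟨-, h⟩ | h | h)
  · exact h
  · exact (hac h.mem.1).elim
  · exact (has h.mem.1).elim
  · exact (hac (mem_verts_of_mem_roots h)).elim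
  · exact (hac h.mem.2).elim
  · exact (has h.mem.2).elim

theorem Linked.of_mem_left (hT : (node a c s).verts.Nodup) (h : (node a c s).Linked x y)
    (hy : y ≠ a.1) (hx : x ∈ c.verts) : y ∈ c.verts ∧ c.Linked x y := by
  obtain ⟨hac, -, -, -, hdisj⟩ := nodup_verts_node.1 hT
  rcases h with (⟨h, -⟩ | h | h) | (⟨h, -⟩ | h | h)
  · exact (hac (h ▸ hx)).elim
  · exact ⟨h.mem.2, .inl h⟩
  · exact (hdisj x hx h.mem.1).elim
  · exact (hy h).elim
  · exact ⟨h.mem.1, .inr h⟩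
  · exact (hdisj x hx h.mem.2).elim

theorem Linked.of_mem_right (hT : (node a c s).verts.Nodup) (h : (node a c s).Linked x y)
    (hx : x ∈ s.verts) : y ∈ s.verts ∧ s.Linked x y := by
  obtain ⟨-, has, -, -, hdisj⟩ := nodup_verts_node.1 hT
  rcases h with (⟨h, -⟩ | h | h) | (⟨-, h⟩ | h | h)
  · exact (has (h ▸ hx)).elim
  · exact (hdisj x h.mem.1 hx).elim
  · exact ⟨h.mem.2, .inl h⟩
  · exact (hdisj x (mem_verts_of_mem_roots h) hx).elim
  · exact (hdisj x h.mem.2 hx).elim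
  · exact ⟨h.mem.1, .inr h⟩

end Node

theorem IsDown.head_mem_roots {x : V} {l : List V} (h : T.IsDown (x :: l)) :
    x ∈ T.roots.map Prod.fst := by
  induction T with
  | nil => cases h
  | node a c s _ hs =>
    rw [roots, List.map_cons, List.mem_cons]
    rcases h with ⟨l', hl, -⟩ | h
    · exact .inl (List.cons.inj hl).1
    · exact .inr (hs h)

theorem IsDown.isChain {l : List V} (h : T.IsDown l) : l.IsChain T.Linked := by
  induction T generalizing l with
  | nil =>
    obtain rfl : l = [] := h
    exact .nil
  | node a c s hc hs =>
    rcases h with ⟨l', rfl, h⟩ | h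
    · refine ((hc h).imp fun _ _ h => h.node_left).cons fun y hy => .inl (.inl ⟨rfl, ?_⟩)
      obtain ⟨l, rfl⟩ := List.head?_eq_some_iff.1 hy
      exact h.head_mem_roots
    · exact (hs h).imp fun _ _ h => h.node_right

theorem isChain_reverse_linked {l : List V} : l.reverse.IsChain T.Linked ↔ l.IsChain T.Linked := by
  rw [List.isChain_reverse]
  exact List.IsChain.iff fun _ _ => ⟨Linked.symm, Linked.symm⟩

theorem IsBend.isChain {p : List V} (h : T.IsBend p) : p.IsChain T.Linked := by
  induction T with
  | nil =>
    obtain rfl : p = [] := h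
    exact .nil
  | node a c s hc hs =>
    rcases h with ⟨l₁, l₂, h, rfl⟩ | h | h
    · have hbranch : ∀ l, c.IsDown l → (a.1 :: l).IsChain (node a c s).Linked := fun l hl =>
        IsDown.isChain (.inl ⟨l, rfl, hl⟩)
      rw [List.isChain_split, ← List.reverse_cons, isChain_reverse_linked]
      exact ⟨hbranch _ h.left, hbranch _ h.right⟩
    · exact (hc h).imp fun _ _ h => h.node_left
    · exact (hs h).imp fun _ _ h => h.node_right

theorem IsDown.isFork_of_disjoint {l₁ l₂ : List V} (h₁ : T.IsDown l₁) (h₂ : T.IsDown l₂)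
    (hdisj : l₁.Disjoint l₂) : T.IsFork l₁ l₂ := by
  induction T with
  | nil => exact ⟨h₁, h₂⟩
  | node a c s _ hs =>
    rcases h₁ with ⟨l₁, rfl, h₁⟩ | h₁ <;> rcases h₂ with ⟨l₂, rfl, h₂⟩ | h₂
    · exact (hdisj List.mem_cons_self List.mem_cons_self).elim
    · exact .inl ⟨_, rfl, h₁, h₂⟩
    · exact .inr (.inl ⟨_, rfl, h₂, h₁⟩)
    · exact .inr (.inr (hs h₁ h₂))

theorem isChain_of_invariant {R S : V → V → Prop} {P Q : V → Prop}
    (h : ∀ x y, R x y → Q y → P x → P y ∧ S x y) {x : V} {l : List V}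
    (hl : (x :: l).IsChain R) (hQ : ∀ y ∈ l, Q y) (hx : P x) :
    (∀ y ∈ x :: l, P y) ∧ (x :: l).IsChain S := by
  induction l generalizing x with
  | nil => exact ⟨List.forall_mem_singleton.2 hx, .singleton x⟩
  | cons y l ih =>
    rw [List.isChain_cons_cons] at hl
    rw [List.forall_mem_cons] at hQ
    obtain ⟨hy, hxy⟩ := h x y hl.1 hQ.1 hx
    obtain ⟨hP, hS⟩ := ih hl.2 hQ.2 hy
    exact ⟨List.forall_mem_cons.2 ⟨hx, hP⟩, List.isChain_cons_cons.2 ⟨hxy, hS⟩⟩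

theorem isDown_of_isChain (hT : T.verts.Nodup) {r : V} {l : List V}
    (hr : r ∈ T.roots.map Prod.fst) (hl : (r :: l).Nodup) (h : (r :: l).IsChain T.Linked) :
    T.IsDown (r :: l) := by
  induction T generalizing r l with
  | nil => cases hr
  | node a c s hc hs =>
    obtain ⟨-, -, hTc, hTs, -⟩ := nodup_verts_node.1 hT
    rw [roots, List.map_cons, List.mem_cons] at hr
    rcases hr with rfl | hr
    · refine .inl ⟨l, rfl, ?_⟩
      cases l with
      | nil => exact c.isDown_nil
      | cons y l =>
        rw [List.isChain_cons_cons] at h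
        rw [List.nodup_cons] at hl
        have hy := h.1.mem_roots hT
        refine hc hTc hy hl.2 (isChain_of_invariant (Q := (· ≠ a.1))
          (fun _ _ h => h.of_mem_left hT) h.2 ?_ (mem_verts_of_mem_roots hy)).2
        rintro z hz rfl
        exact hl.1 (List.mem_cons_of_mem _ hz)
    · exact .inr (hs hTs hr hl (isChain_of_invariant (Q := fun _ => True)
        (fun _ _ h _ => h.of_mem_right hT) h (fun _ _ => trivial) (mem_verts_of_mem_roots hr)).2)

section Node

variable {a : V × Bool} {c s : Forest (V × Bool)}

theorem isDown_of_isChain_node (hT : (node a c s).verts.Nodup) {l : List V}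
    (hl : (a.1 :: l).Nodup) (h : (a.1 :: l).IsChain (node a c s).Linked) : c.IsDown l := by
  rcases isDown_of_isChain hT List.mem_cons_self hl h with ⟨l', hl', h⟩ | h
  · exact (List.cons.inj hl').2 ▸ h
  · exact ((nodup_verts_node.1 hT).2.1 (h.mem a.1 List.mem_cons_self)).elim

theorem IsPathList.isFork (hT : (node a c s).verts.Nodup) {p₁ p₂ : List V}
    (h : (node a c s).IsPathList (p₁ ++ a.1 :: p₂)) : c.IsFork p₁.reverse p₂ := by
  obtain ⟨hchain₁, hchain₂⟩ := List.isChain_split.1 h.chain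
  obtain ⟨hp₁, hp₂, hdisj⟩ := List.nodup_append'.1 h.nodup
  rw [List.disjoint_cons_right] at hdisj
  refine IsDown.isFork_of_disjoint (isDown_of_isChain_node hT ?_ ?_)
    (isDown_of_isChain_node hT hp₂ hchain₂) (List.disjoint_reverse_left.2 hdisj.2)
  · exact List.nodup_cons.2 ⟨by simpa using hdisj.1, List.nodup_reverse.2 hp₁⟩
  · rwa [← isChain_reverse_linked, List.reverse_cons, List.reverse_reverse]

theorem IsPathList.of_root_notMem (hT : (node a c s).verts.Nodup) {p : List V}
    (h : (node a c s).IsPathList p) (ha : a.1 ∉ p) : c.IsPathList p ∨ s.IsPathList p := by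
  cases p with
  | nil => exact .inl ⟨h.nodup, fun _ hx => absurd hx List.not_mem_nil, .nil⟩
  | cons x l =>
    have hx := h.mem x List.mem_cons_self
    rw [verts_node, List.mem_cons, List.mem_append] at hx
    rcases hx with rfl | hx | hx
    · exact (ha List.mem_cons_self).elim
    · have hne : ∀ y ∈ l, y ≠ a.1 := fun y hy hya => ha (hya ▸ List.mem_cons_of_mem _ hy)
      obtain ⟨hmem, hchain⟩ := isChain_of_invariant (fun _ _ h => h.of_mem_left hT) h.chain hne hx
      exact .inl ⟨h.nodup, hmem, hchain⟩
    · obtain ⟨hmem, hchain⟩ := isChain_of_invariant (Q := fun _ => True)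
        (fun _ _ h _ => h.of_mem_right hT) h.chain (fun _ _ => trivial) hx
      exact .inr ⟨h.nodup, hmem, hchain⟩

end Node

theorem IsPathList.isBend (hT : T.verts.Nodup) {p : List V} (h : T.IsPathList p) :
    T.IsBend p := by
  induction T generalizing p with
  | nil => exact List.eq_nil_iff_forall_not_mem.2 fun x hx => List.not_mem_nil (h.mem x hx)
  | node a c s hc hs =>
    obtain ⟨-, -, hTc, hTs, -⟩ := nodup_verts_node.1 hT
    by_cases ha : a.1 ∈ p
    · obtain ⟨p₁, p₂, rfl⟩ := List.append_of_mem ha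
      exact .inl ⟨p₁.reverse, p₂, h.isFork hT, by rw [List.reverse_reverse]⟩
    · exact .inr ((h.of_root_notMem hT ha).imp (hc hTc) (hs hTs))

theorem IsPathList.infix {p l : List V} (h : T.IsPathList p) (hl : l <:+: p) : T.IsPathList l :=
  ⟨hl.sublist.nodup h.nodup, fun x hx => h.mem x (hl.subset hx), h.chain.infix hl⟩

theorem IsPathList.reverse {p : List V} (h : T.IsPathList p) : T.IsPathList p.reverse :=
  ⟨List.nodup_reverse.2 h.nodup, fun x hx => h.mem x (List.mem_reverse.1 hx),
    isChain_reverse_linked.2 h.chain⟩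

end TreeSpanner.Forest

namespace TreeSpanner.Forest

variable {V : Type} {T : Forest (V × Bool)}

/-! ### Lengths of paths in reduced forests -/

theorem IsDown.length_lt_of_isReduced_node {a : V × Bool} {c s : Forest (V × Bool)}
    (hT : (node a c s).IsReduced) {l : List V} (h : c.IsDown l)
    (hl : l.length + c.roots.length ≤ c.requiredVerts.length + 1) :
    l.length < (if a.2 then 1 else 0) + c.requiredVerts.length := by
  rcases Nat.eq_zero_or_pos c.roots.length with hroots | hroots
  · obtain rfl := eq_nil_of_length_roots_eq_zero hroots
    obtain rfl : l = [] := h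
    rw [if_pos (hT.1.resolve_right (Nat.not_succ_le_zero 1))]
    exact Nat.one_pos
  · split_ifs with ha
    · omega
    · have := hT.1.resolve_left ha
      omega

theorem IsDown.length_add_roots_le (hT : T.IsReduced) {l : List V} (h : T.IsDown l) :
    l.length + T.roots.length ≤ T.requiredVerts.length + 1 := by
  induction T generalizing l with
  | nil =>
    obtain rfl : l = [] := h
    exact Nat.zero_le 1
  | node a c s hc hs =>
    have := hT.2.2.roots_le
    rw [length_requiredVerts_node, roots, List.length_cons]
    rcases h with ⟨l, rfl, h⟩ | h
    · have := h.length_lt_of_isReduced_node hT (hc hT.2.1 h)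
      rw [List.length_cons]
      omega
    · have := c.isDown_nil.length_lt_of_isReduced_node hT (hc hT.2.1 c.isDown_nil)
      have := hs hT.2.2 h
      omega

theorem IsDown.length_lt {a : V × Bool} {c s : Forest (V × Bool)}
    (hT : (node a c s).IsReduced) {l : List V} (h : c.IsDown l) :
    l.length < (if a.2 then 1 else 0) + c.requiredVerts.length :=
  h.length_lt_of_isReduced_node hT (h.length_add_roots_le hT.2.1)

theorem IsFork.length_add_roots_le (hT : T.IsReduced) {l₁ l₂ : List V} (h : T.IsFork l₁ l₂) :
    l₁.length + l₂.length + T.roots.length ≤ T.requiredVerts.length + 2 := by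
  induction T with
  | nil =>
    obtain ⟨rfl, rfl⟩ := h
    exact Nat.zero_le 2
  | node a c s _ hs =>
    rw [length_requiredVerts_node, roots, List.length_cons]
    rcases h with ⟨l, rfl, hl, h⟩ | ⟨l, rfl, hl, h⟩ | h
    · have := hl.length_lt hT
      have := h.length_add_roots_le hT.2.2
      rw [List.length_cons]
      omega
    · have := hl.length_lt hT
      have := h.length_add_roots_le hT.2.2
      rw [List.length_cons]
      omega
    · have := c.isDown_nil.length_lt hT
      have := hs hT.2.2 h
      omega

theorem IsFork.length_le {a : V × Bool} {c s : Forest (V × Bool)}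
    (hT : (node a c s).IsReduced) {l₁ l₂ : List V} (h : c.IsFork l₁ l₂) :
    l₁.length + l₂.length ≤ (if a.2 then 1 else 0) + c.requiredVerts.length := by
  have hlen := h.length_add_roots_le hT.2.1
  by_cases hroots : 2 ≤ c.roots.length
  · omega
  · rcases h.eq_nil_or_eq_nil hroots with rfl | rfl
    · have := h.right.length_lt hT
      rw [List.length_nil]
      omega
    · have := h.left.length_lt hT
      rw [List.length_nil]
      omega

theorem IsBend.length_le_of_isReduced_node {a : V × Bool} {c s : Forest (V × Bool)}
    (hT : (node a c s).IsReduced) {p : List V} (h : c.IsBend p)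
    (hp : p.length + c.roots.length ≤ c.requiredVerts.length + 2) :
    p.length ≤ (if a.2 then 1 else 0) + c.requiredVerts.length := by
  rcases Nat.eq_zero_or_pos c.roots.length with hroots | hroots
  · obtain rfl := eq_nil_of_length_roots_eq_zero hroots
    obtain rfl : p = [] := h
    exact Nat.zero_le _
  · split_ifs with ha
    · omega
    · have := hT.1.resolve_left ha
      omega

theorem IsBend.length_add_roots_le (hT : T.IsReduced) {p : List V} (h : T.IsBend p) :
    p.length + T.roots.length ≤ T.requiredVerts.length + 2 := by
  induction T with
  | nil =>
    obtain rfl : p = [] := h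
    exact Nat.zero_le 2
  | node a c s hc hs =>
    have := hT.2.2.roots_le
    rw [length_requiredVerts_node, roots, List.length_cons]
    rcases h with ⟨l₁, l₂, h, rfl⟩ | h | h
    · have := h.length_le hT
      rw [List.length_append, List.length_reverse, List.length_cons]
      omega
    · have := h.length_le_of_isReduced_node hT (hc hT.2.1 h)
      omega
    · have := c.isDown_nil.length_lt hT
      have := hs hT.2.2 h
      omega

theorem IsFork.length_roots_eq_two {a : V × Bool} {c s : Forest (V × Bool)}
    (hT : (node a c s).IsReduced) {l₁ l₂ : List V} (h : c.IsFork l₁ l₂)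
    (hlen : (if a.2 then 1 else 0) + c.requiredVerts.length ≤ l₁.length + l₂.length) :
    l₁ ≠ [] ∧ l₂ ≠ [] ∧ c.roots.length = 2 := by
  have hl₁ : l₁ ≠ [] := by
    rintro rfl
    have := h.right.length_lt hT
    rw [List.length_nil] at hlen
    omega
  have hl₂ : l₂ ≠ [] := by
    rintro rfl
    have := h.left.length_lt hT
    rw [List.length_nil] at hlen
    omega
  refine ⟨hl₁, hl₂, ?_⟩
  have := h.length_add_roots_le hT.2.1
  have : 2 ≤ c.roots.length := by
    by_contra hroots
    exact (h.eq_nil_or_eq_nil hroots).elim hl₁ hl₂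
  omega

/-- Only a path through the root can have more vertices than the forest has required vertices, and
only if the root is a Steiner vertex with two children. -/
theorem IsBend.exists_of_length (hT : T.IsReduced) {p : List V} (h : T.IsBend p)
    (hp : T.requiredVerts.length < p.length) :
    ∃ a c₁ d₁ c₂ d₂ l₁ l₂, T = node a (node c₁ d₁ (node c₂ d₂ nil)) nil ∧
      (node c₁ d₁ (node c₂ d₂ nil)).IsFork l₁ l₂ ∧ l₁ ≠ [] ∧ l₂ ≠ [] ∧
      p = l₁.reverse ++ a.1 :: l₂ ∧ l₁.length + l₂.length ≤ T.requiredVerts.length := by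
  have hroots := h.length_add_roots_le hT
  match T with
  | nil =>
    obtain rfl : p = [] := h
    cases hp
  | node a c (node _ _ _) =>
    simp only [roots, List.length_cons] at hroots
    omega
  | node a c nil =>
    rw [length_requiredVerts_node] at hp ⊢
    change _ + 0 < _ at hp
    rcases h with ⟨l₁, l₂, h, rfl⟩ | h | h
    · rw [List.length_append, List.length_reverse, List.length_cons] at hp
      obtain ⟨hl₁, hl₂, hc⟩ := h.length_roots_eq_two hT (by omega)
      match c with
      | nil => cases hc
      | node c₁ d₁ nil => cases hc
      | node c₁ d₁ (node c₂ d₂ nil) =>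
        exact ⟨a, c₁, d₁, c₂, d₂, l₁, l₂, rfl, h, hl₁, hl₂, rfl, h.length_le hT⟩
      | node c₁ d₁ (node c₂ d₂ (node _ _ _)) =>
        simp only [roots, List.length_cons] at hc
        omega
    · have := h.length_le_of_isReduced_node hT (h.length_add_roots_le hT.2.1)
      omega
    · obtain rfl : p = [] := h
      cases hp

end TreeSpanner.Forest

namespace TreeSpanner.Forest

variable {V : Type} {T F G : Forest (V × Bool)}

/-! ### Paths in pruned forests -/

theorem mem_verts_append {x : V} : x ∈ (F.append G).verts ↔ x ∈ F.verts ∨ x ∈ G.verts := by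
  rw [verts, labels_append, List.map_append, List.mem_append, verts, verts]

section Node

variable {a : V × Bool} {c s : Forest (V × Bool)} {x : V}

theorem pruned_node_cases (hT : (node a c s).verts.Nodup) :
    a.1 ∈ (node a c s).pruned.verts ∧ (node a c s).pruned = node a c.pruned s.pruned ∨
      a.1 ∉ (node a c s).pruned.verts ∧ (node a c s).pruned = c.pruned.append s.pruned ∧
        ¬ 2 ≤ c.pruned.roots.length := by
  obtain ⟨hac, has, -⟩ := nodup_verts_node.1 hT
  match a with
  | (v, true) => exact .inl ⟨List.mem_cons_self, rfl⟩
  | (v, false) =>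
    rw [pruned_false]
    split_ifs with hroots
    · exact .inl ⟨List.mem_cons_self, rfl⟩
    · refine .inr ⟨fun h => ?_, rfl, hroots⟩
      exact (mem_verts_append.1 h).elim (fun h => hac (c.verts_pruned_sublist.subset h))
        fun h => has (s.verts_pruned_sublist.subset h)

theorem mem_verts_pruned_node (hT : (node a c s).verts.Nodup) (hx : x ≠ a.1) :
    x ∈ (node a c s).pruned.verts ↔ x ∈ c.pruned.verts ∨ x ∈ s.pruned.verts := by
  rcases pruned_node_cases hT with ⟨-, h⟩ | ⟨-, h, -⟩ <;> rw [h]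
  · rw [verts_node, List.mem_cons, List.mem_append, or_iff_right hx]
  · exact mem_verts_append

/-- The Boolean predicate `keep` selects the vertices of `T` that survive pruning. -/
def SelectsPruned (keep : V → Bool) (T : Forest (V × Bool)) : Prop :=
  ∀ x ∈ T.verts, keep x ↔ x ∈ T.pruned.verts

variable {keep : V → Bool}

theorem SelectsPruned.left (hT : (node a c s).verts.Nodup)
    (h : SelectsPruned keep (node a c s)) : SelectsPruned keep c := by
  obtain ⟨hac, -, -, -, hdisj⟩ := nodup_verts_node.1 hT
  intro x hx
  rw [h x (by rw [verts_node]; exact List.mem_cons_of_mem _ (List.mem_append_left _ hx)),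
    mem_verts_pruned_node hT (ne_of_mem_of_not_mem hx hac)]
  exact or_iff_left fun hxs => hdisj x hx (s.verts_pruned_sublist.subset hxs)

theorem SelectsPruned.right (hT : (node a c s).verts.Nodup)
    (h : SelectsPruned keep (node a c s)) : SelectsPruned keep s := by
  obtain ⟨-, has, -, -, hdisj⟩ := nodup_verts_node.1 hT
  intro x hx
  rw [h x (by rw [verts_node]; exact List.mem_cons_of_mem _ (List.mem_append_right _ hx)),
    mem_verts_pruned_node hT (ne_of_mem_of_not_mem hx has)]
  exact or_iff_right fun hxc => hdisj x (c.verts_pruned_sublist.subset hxc) hx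

theorem SelectsPruned.cases (hT : (node a c s).verts.Nodup)
    (h : SelectsPruned keep (node a c s)) :
    keep a.1 = true ∧ (node a c s).pruned = node a c.pruned s.pruned ∨
      keep a.1 = false ∧ (node a c s).pruned = c.pruned.append s.pruned ∧
        ¬ 2 ≤ c.pruned.roots.length := by
  have ha := h a.1 (by rw [verts_node]; exact List.mem_cons_self)
  exact (pruned_node_cases hT).imp (And.imp_left ha.2)
    (And.imp_left fun hroot => Bool.eq_false_iff.2 (hroot ∘ ha.1))

end Node

section Filter

variable {keep : V → Bool}

theorem IsDown.filter_pruned (hT : T.verts.Nodup) (hkeep : SelectsPruned keep T) {l : List V}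
    (h : T.IsDown l) : T.pruned.IsDown (l.filter keep) := by
  induction T generalizing l with
  | nil =>
    obtain rfl : l = [] := h
    exact isDown_nil _
  | node a c s hc hs =>
    obtain ⟨-, -, hTc, hTs, -⟩ := nodup_verts_node.1 hT
    have hdown_c {l} := hc (l := l) hTc (hkeep.left hT)
    have hdown_s := hs (l := l) hTs (hkeep.right hT)
    rcases hkeep.cases hT with ⟨ha, hprune⟩ | ⟨ha, hprune, -⟩ <;> rw [hprune] <;>
      rcases h with ⟨l, rfl, h⟩ | h
    · exact .inl ⟨_, List.filter_cons_of_pos ha, hdown_c h⟩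
    · exact .inr (hdown_s h)
    · rw [List.filter_cons_of_neg (by rw [ha]; exact Bool.false_ne_true)]
      exact (hdown_c h).append_left
    · exact (hdown_s h).append_right

theorem IsFork.filter_pruned (hT : T.verts.Nodup) (hkeep : SelectsPruned keep T)
    {l₁ l₂ : List V} (h : T.IsFork l₁ l₂) :
    T.pruned.IsFork (l₁.filter keep) (l₂.filter keep) := by
  induction T with
  | nil =>
    obtain ⟨rfl, rfl⟩ := h
    exact (isDown_nil _).isFork
  | node a c s _ hs =>
    obtain ⟨-, -, hTc, hTs, -⟩ := nodup_verts_node.1 hT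
    have hbranches : ∀ l l', c.IsDown l → s.IsDown l' →
        (node a c s).pruned.IsFork ((a.1 :: l).filter keep) (l'.filter keep) := by
      intro l l' hl hl'
      replace hl := hl.filter_pruned hTc (hkeep.left hT)
      replace hl' := hl'.filter_pruned hTs (hkeep.right hT)
      rcases hkeep.cases hT with ⟨ha, hprune⟩ | ⟨ha, hprune, -⟩ <;> rw [hprune]
      · exact .inl ⟨_, List.filter_cons_of_pos ha, hl, hl'⟩
      · rw [List.filter_cons_of_neg (by rw [ha]; exact Bool.false_ne_true)]
        exact hl.isFork_append hl'
    rcases h with ⟨l, rfl, hl, h⟩ | ⟨l, rfl, hl, h⟩ | h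
    · exact hbranches l l₂ hl h
    · exact (hbranches l l₁ hl h).symm
    · replace h := hs hTs (hkeep.right hT) h
      rcases hkeep.cases hT with ⟨-, hprune⟩ | ⟨-, hprune, -⟩ <;> rw [hprune]
      · exact .inr (.inr h)
      · exact h.append_right

theorem IsBend.filter_pruned (hT : T.verts.Nodup) (hkeep : SelectsPruned keep T) {p : List V}
    (h : T.IsBend p) : T.pruned.IsBend (p.filter keep) := by
  induction T with
  | nil =>
    obtain rfl : p = [] := h
    exact isBend_nil _
  | node a c s hc hs =>
    obtain ⟨-, -, hTc, hTs, -⟩ := nodup_verts_node.1 hT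
    have hbend_c := hc hTc (hkeep.left hT)
    have hbend_s := hs hTs (hkeep.right hT)
    rcases hkeep.cases hT with ⟨ha, hprune⟩ | ⟨ha, hprune, hroots⟩ <;> rw [hprune] <;>
      rcases h with ⟨l₁, l₂, h, rfl⟩ | h | h
    · refine .inl ⟨_, _, h.filter_pruned hTc (hkeep.left hT), ?_⟩
      rw [List.filter_append, List.filter_reverse, List.filter_cons_of_pos ha]
    · exact .inr (.inl (hbend_c h))
    · exact .inr (.inr (hbend_s h))
    · replace h := h.filter_pruned hTc (hkeep.left hT)
      rw [List.filter_append, List.filter_reverse,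
        List.filter_cons_of_neg (by rw [ha]; exact Bool.false_ne_true)]
      -- The bend has lost its top, but only one of its branches can be non-empty.
      rcases h.eq_nil_or_eq_nil hroots with hnil | hnil <;> rw [hnil]
      · exact h.right.isBend.append_left
      · rw [List.append_nil]
        exact h.left.isBend_reverse.append_left
    · exact (hbend_c h).append_left
    · exact (hbend_s h).append_right

end Filter

theorem IsPathList.exists_pruned (hT : T.verts.Nodup) {p : List V} (h : T.IsPathList p) :
    ∃ p', p'.Sublist p ∧ (∀ x ∈ p, x ∈ T.pruned.verts → x ∈ p') ∧ T.pruned.IsPathList p' := by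
  classical
  have hkeep : SelectsPruned (fun x => decide (x ∈ T.pruned.verts)) T :=
    fun _ _ => decide_eq_true_iff
  have hbend := (h.isBend hT).filter_pruned hT hkeep
  exact ⟨_, List.filter_sublist, fun x hx hx' => List.mem_filter.2 ⟨hx, decide_eq_true hx'⟩,
    h.nodup.filter _, hbend.mem, hbend.isChain⟩

end TreeSpanner.Forest

namespace TreeSpanner

variable {V : Type}

/-! ### The decomposition -/

/-- Inclusion of components, without regard to which vertices are required. -/
structure Component.IsPartOf (t t' : Component V) : Prop where
  mem : ∀ x ∈ t.tree.verts, x ∈ t'.tree.verts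
  linked : ∀ x y, t.tree.Linked x y → t'.tree.Linked x y
  border : ∀ x ∈ t.border, x ∈ t'.border

theorem Component.IsPartOf.refl (t : Component V) : t.IsPartOf t :=
  ⟨fun _ => id, fun _ _ => id, fun _ => id⟩

/-- The component `t`, obtained by removal of the vertices in `C`, accounts for the edge `xy`, where
`x` is not in `C`. -/
structure Component.Attaches (C : List V) (t : Component V) (x y : V) :
    Prop where
  mem : x ∈ t.tree.verts
  linked : y ∉ C → t.tree.Linked x y
  border : y ∈ C → y ∈ t.border

theorem Component.Attaches.mono {t t' : Component V} {x y : V}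
    (h : t.Attaches C x y) (ht : t.IsPartOf t') : t'.Attaches C x y :=
  ⟨ht.mem x h.mem, fun hy => ht.linked x y (h.linked hy), fun hy => ht.border y (h.border hy)⟩

namespace Forest

theorem labels_map {A B : Type} (f : A → B) (T : Forest A) :
    (T.map f).labels = T.labels.map f := by
  induction T with
  | nil => rfl
  | node a c s hc hs => rw [map, labels, labels, hc, hs, List.map_cons, List.map_append]

theorem roots_map {A B : Type} (f : A → B) (T : Forest A) : (T.map f).roots = T.roots.map f := by
  induction T with
  | nil => rfl
  | node a c s _ hs => rw [map, roots, roots, hs, List.map_cons]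

theorem length_requiredVerts_eq_countP (T : Forest (V × Bool)) :
    T.requiredVerts.length = T.labels.countP (·.2) := by
  induction T with
  | nil => rfl
  | node a c s hc hs =>
    rw [length_requiredVerts_node, labels, List.countP_cons, List.countP_append, hc, hs]
    omega

theorem label_unique {T : Forest (V × Bool)} (hT : T.verts.Nodup) {v : V} {b b' : Bool}
    (h : (v, b) ∈ T.labels) (h' : (v, b') ∈ T.labels) : b = b' :=
  congrArg Prod.snd (List.inj_on_of_nodup_map hT h h' rfl)

/-- The forest underlying a forest with cut marks. -/
def unmarked (M : Forest (V × Bool × Bool)) : Forest (V × Bool) := M.map fun a => (a.1, a.2.1)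

theorem unmarked_decomposed (ℓ : ℕ) (T : Forest (V × Bool)) : (T.decomposed ℓ).1.unmarked = T := by
  induction T with
  | nil => rfl
  | node a c s hc hs =>
    rw [unmarked] at hc hs ⊢
    rw [decomposed]
    split_ifs <;> rw [map, hc, hs]

theorem isChild_recolored {M : Forest (V × Bool × Bool)} {x y : V} :
    M.recolored.IsChild x y ↔ M.unmarked.IsChild x y := by
  rw [recolored, unmarked]
  induction M with
  | nil => rfl
  | node a c s hc hs => simp [map, IsChild, hc, hs, roots_map]

theorem verts_recolored (M : Forest (V × Bool × Bool)) :
    M.recolored.verts = M.unmarked.verts := by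
  simp only [recolored, unmarked, verts, labels_map, List.map_map, Function.comp_def]

theorem IsPathList.recolored {M : Forest (V × Bool × Bool)} {p : List V}
    (h : M.unmarked.IsPathList p) : M.recolored.IsPathList p :=
  ⟨h.nodup, fun x hx => verts_recolored M ▸ h.mem x hx,
    h.chain.imp fun _ _ => Or.imp isChild_recolored.2 isChild_recolored.2⟩

theorem mul_length_cutVertices_add_le (ℓ : ℕ) (T : Forest (V × Bool)) :
    (ℓ + 1) * (T.decomposed ℓ).1.recolored.requiredVerts.length + (T.decomposed ℓ).2 ≤
      T.requiredVerts.length := by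
  induction T with
  | nil => exact le_rfl
  | node a c s hc hs =>
    obtain ⟨v, b⟩ := a
    rw [recolored] at hc hs ⊢
    rw [length_requiredVerts_node, decomposed]
    split_ifs with hb <;> rw [map, length_requiredVerts_node, mul_add, mul_add] <;>
      simp only [if_true, mul_one, Bool.false_eq_true, if_false, mul_zero] <;> omega

/-- The marks of `M` are set exactly at the vertices in `C`. -/
def IsMarkedBy (M : Forest (V × Bool × Bool)) (C : List V) : Prop :=
  ∀ a ∈ M.labels, a.2.2 ↔ a.1 ∈ C

theorem IsMarkedBy.of_node {a : V × Bool × Bool} {c s : Forest (V × Bool × Bool)} {C : List V}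
    (h : (node a c s).IsMarkedBy C) : (a.2.2 ↔ a.1 ∈ C) ∧ c.IsMarkedBy C ∧ s.IsMarkedBy C :=
  ⟨h a List.mem_cons_self,
    fun x hx => h x (List.mem_cons_of_mem _ (List.mem_append_left _ hx)),
    fun x hx => h x (List.mem_cons_of_mem _ (List.mem_append_right _ hx))⟩

theorem isMarkedBy_requiredVerts {M : Forest (V × Bool × Bool)} (hM : M.unmarked.verts.Nodup) :
    M.IsMarkedBy M.recolored.requiredVerts := by
  rw [← verts_recolored] at hM
  intro a ha
  have ha' : (a.1, a.2.2) ∈ M.recolored.labels := by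
    rw [recolored, labels_map]
    exact List.mem_map_of_mem ha
  rw [mem_requiredVerts]
  refine ⟨fun h => ?_, fun h => label_unique hM ha' h⟩
  rwa [h] at ha'

theorem splitted_below_fst (u : Option V) (M : Forest (V × Bool × Bool)) :
    (M.splitted (.below u)).1 = nil := by
  induction M with
  | nil => rfl
  | node a c s _ hs => obtain ⟨w, b, _ | _⟩ := a <;> rwa [splitted]

/-- The components into which the removal of the cut vertices splits a forest, including the part
that is attached to the current subtree if the forest lies inside one. -/
def parts : Position V → Forest (V × Bool × Bool) → List (Component V)
  | .inside, M => ⟨(M.splitted .inside).1, (M.splitted .inside).2.1⟩ :: (M.splitted .inside).2.2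
  | .below u, M => (M.splitted (.below u)).2.2

theorem perm_labels_splitted (pos : Position V) (M : Forest (V × Bool × Bool)) :
    ((M.splitted pos).1.labels ++ (M.splitted pos).2.2.flatMap (·.tree.labels)).Perm
      ((M.labels.filter fun a => !a.2.2).map fun a => (a.1, a.2.1)) := by
  classical
  induction M generalizing pos with
  | nil => cases pos <;> exact .refl _
  | node a c s hc hs =>
    simp only [List.perm_iff_count, List.count_append] at hc hs ⊢
    intro e
    have hs := hs pos e
    obtain ⟨v, b, _ | _⟩ := a
    · have hc := hc .inside e
      cases pos <;> simp [splitted, labels, List.count_cons] <;> omega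
    · have hc := hc (.below (some v)) e
      rw [splitted_below_fst, labels, List.count_nil] at hc
      simp [splitted, labels]
      omega

theorem perm_labels_parts (pos : Position V) (M : Forest (V × Bool × Bool)) :
    ((M.parts pos).flatMap (·.tree.labels)).Perm
      ((M.labels.filter fun a => !a.2.2).map fun a => (a.1, a.2.1)) := by
  have h := perm_labels_splitted pos M
  match pos with
  | .inside => exact h
  | .below u => rwa [splitted_below_fst] at h

section Parts

variable {a : V × Bool × Bool} {c s M : Forest (V × Bool × Bool)} {C : List V}

theorem exists_isPartOf_root (pos : Position V) (ha : a.2.2 = false) :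
    ∃ t ∈ (node a c s).parts pos, Component.IsPartOf
      ⟨node (a.1, a.2.1) (c.splitted .inside).1 nil, (c.splitted .inside).2.1⟩ t := by
  obtain ⟨v, b, _⟩ := a
  subst ha
  cases pos with
  | inside =>
    refine ⟨_, List.mem_cons_self, fun x hx => ?_, fun x y h => ?_, fun x hx => ?_⟩
    · rw [splitted, verts_node, List.mem_cons, List.mem_append]
      rw [verts_node, verts_nil, List.append_nil, List.mem_cons] at hx
      exact hx.imp_right .inl
    · rw [splitted]
      exact h.imp (Or.imp_right (Or.imp_right False.elim)) (Or.imp_right (Or.imp_right False.elim))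
    · rw [splitted]
      exact List.mem_append_right _ hx
  | below u =>
    refine ⟨⟨node (v, b) (c.splitted .inside).1 nil, u.toList ++ (c.splitted .inside).2.1⟩, ?_,
      fun x hx => hx, fun x y h => h, fun x hx => List.mem_append_right _ hx⟩
    rw [parts, splitted]
    exact List.mem_append_right _ List.mem_cons_self

theorem exists_isPartOf_left_of_unmarked (pos : Position V) (ha : a.2.2 = false)
    {t : Component V} (ht : t ∈ c.parts .inside) :
    ∃ t' ∈ (node a c s).parts pos, t.IsPartOf t' := by
  rcases List.mem_cons.1 ht with rfl | ht
  · obtain ⟨t', ht', h⟩ := exists_isPartOf_root (c := c) (s := s) pos ha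
    refine ⟨t', ht', fun x hx => h.mem x ?_, fun x y hxy => h.linked x y hxy.node_left, h.border⟩
    rw [verts_node]
    exact List.mem_cons_of_mem _ (List.mem_append_left _ hx)
  · refine ⟨t, ?_, .refl t⟩
    obtain ⟨v, b, _⟩ := a
    subst ha
    cases pos <;> rw [parts, splitted]
    · exact List.mem_cons_of_mem _ (List.mem_append_right _ ht)
    · exact List.mem_append_right _ (List.mem_cons_of_mem _ ht)

theorem mem_parts_node_of_marked (pos : Position V) (ha : a.2.2 = true)
    {t : Component V} (ht : t ∈ c.parts (.below (some a.1))) : t ∈ (node a c s).parts pos := by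
  obtain ⟨v, b, _⟩ := a
  subst ha
  cases pos <;> rw [parts, splitted]
  · exact List.mem_cons_of_mem _ (List.mem_append_right _ ht)
  · exact List.mem_append_right _ ht

theorem exists_isPartOf_right (pos : Position V) {t : Component V} (ht : t ∈ s.parts pos) :
    ∃ t' ∈ (node a c s).parts pos, t.IsPartOf t' := by
  cases pos with
  | inside =>
    rcases List.mem_cons.1 ht with rfl | ht
    · refine ⟨_, List.mem_cons_self, ?_⟩
      obtain ⟨v, b, _ | _⟩ := a <;> rw [splitted] <;>
        refine ⟨fun x hx => ?_, fun x y h => ?_, fun x hx => List.mem_append_left _ hx⟩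
      · rw [verts_node]
        exact List.mem_cons_of_mem _ (List.mem_append_right _ hx)
      · exact h.node_right
      · exact hx
      · exact h
    · refine ⟨t, List.mem_cons_of_mem _ ?_, .refl t⟩
      obtain ⟨v, b, _ | _⟩ := a <;> rw [splitted] <;> exact List.mem_append_left _ ht
  | below u =>
    refine ⟨t, ?_, .refl t⟩
    obtain ⟨v, b, _ | _⟩ := a <;> rw [parts, splitted] <;> exact List.mem_append_left _ ht

theorem mem_roots_splitted (hM : M.IsMarkedBy C) {y : V} (hy : y ∈ M.unmarked.roots.map Prod.fst)
    (hyC : y ∉ C) : y ∈ (M.splitted .inside).1.roots.map Prod.fst := by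
  induction M with
  | nil => exact hy
  | node a c s _ hs =>
    obtain ⟨ha, -, hsM⟩ := hM.of_node
    obtain ⟨v, b, _ | _⟩ := a <;> rw [splitted] <;> rcases List.mem_cons.1 hy with rfl | hy
    · exact List.mem_cons_self
    · exact List.mem_cons_of_mem _ (hs hsM hy)
    · exact (hyC (ha.1 rfl)).elim
    · exact hs hsM hy

theorem mem_border_splitted (hM : M.IsMarkedBy C) {y : V}
    (hy : y ∈ M.unmarked.roots.map Prod.fst) (hyC : y ∈ C) : y ∈ (M.splitted .inside).2.1 := by
  induction M with
  | nil => cases hy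
  | node a c s _ hs =>
    obtain ⟨ha, -, hsM⟩ := hM.of_node
    obtain ⟨v, b, _ | _⟩ := a <;> rw [splitted] <;> rcases List.mem_cons.1 hy with rfl | hy
    · exact (Bool.false_ne_true (ha.2 hyC)).elim
    · exact List.mem_append_left _ (hs hsM hy)
    · exact List.mem_append_right _ (List.mem_singleton_self _)
    · exact List.mem_append_left _ (hs hsM hy)

theorem exists_part_of_mem_roots (hM : M.IsMarkedBy C) {y u : V}
    (hy : y ∈ M.unmarked.roots.map Prod.fst) (hyC : y ∉ C) :
    ∃ t ∈ M.parts (.below (some u)), y ∈ t.tree.verts ∧ u ∈ t.border := by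
  induction M with
  | nil => cases hy
  | node a c s _ hs =>
    obtain ⟨ha, -, hsM⟩ := hM.of_node
    rcases List.mem_cons.1 hy with rfl | hy
    · obtain ⟨v, b, _ | _⟩ := a <;> rw [parts, splitted]
      · refine ⟨_, List.mem_append_right _ List.mem_cons_self, ?_, List.mem_cons_self⟩
        rw [verts_node]
        exact List.mem_cons_self
      · exact (hyC (ha.1 rfl)).elim
    · obtain ⟨t, ht, hyt, hut⟩ := hs hsM hy
      obtain ⟨t', ht', h⟩ := exists_isPartOf_right (a := a) (c := c) _ ht
      exact ⟨t', ht', h.mem y hyt, h.border u hut⟩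

theorem exists_attaches_root_child (hM : (node a c s).IsMarkedBy C) (pos : Position V) {y : V}
    (ha : a.1 ∉ C) (hy : y ∈ c.unmarked.roots.map Prod.fst) :
    ∃ t ∈ (node a c s).parts pos, t.Attaches C a.1 y := by
  obtain ⟨hroot, hcM, -⟩ := hM.of_node
  obtain ⟨t, ht, h⟩ := exists_isPartOf_root (c := c) (s := s) pos
    (Bool.eq_false_iff.2 fun h => ha (hroot.1 h))
  refine ⟨t, ht, .mono ⟨?_, fun hyC => ?_, fun hyC => mem_border_splitted hcM hy hyC⟩ h⟩
  · rw [verts_node]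
    exact List.mem_cons_self
  · exact .inl (.inl ⟨rfl, mem_roots_splitted hcM hy hyC⟩)

theorem exists_attaches_child_root (hM : (node a c s).IsMarkedBy C) (pos : Position V) {x : V}
    (hx : x ∈ c.unmarked.roots.map Prod.fst) (hxC : x ∉ C) :
    ∃ t ∈ (node a c s).parts pos, t.Attaches C x a.1 := by
  obtain ⟨hroot, hcM, -⟩ := hM.of_node
  by_cases ha : a.1 ∈ C
  · obtain ⟨t, ht, hxt, hat⟩ := exists_part_of_mem_roots (u := a.1) hcM hx hxC
    exact ⟨t, mem_parts_node_of_marked pos (hroot.2 ha) ht, hxt, fun h => (h ha).elim,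
      fun _ => hat⟩
  · obtain ⟨t, ht, h⟩ := exists_isPartOf_root (c := c) (s := s) pos
      (Bool.eq_false_iff.2 fun h => ha (hroot.1 h))
    have hroots := mem_roots_splitted hcM hx hxC
    refine ⟨t, ht, .mono ⟨?_, fun _ => ?_, fun h => (ha h).elim⟩ h⟩
    · rw [verts_node]
      exact List.mem_cons_of_mem _ (List.mem_append_left _ (mem_verts_of_mem_roots hroots))
    · exact .inr (.inl ⟨rfl, hroots⟩)

theorem exists_attaches (hM : M.IsMarkedBy C) (pos : Position V) {x y : V}
    (h : M.unmarked.Linked x y) (hx : x ∉ C) : ∃ t ∈ M.parts pos, t.Attaches C x y := by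
  induction M generalizing pos with
  | nil => exact (h.elim id id).elim
  | node a c s hc hs =>
    obtain ⟨-, hcM, hsM⟩ := hM.of_node
    have hleft (hxy : c.unmarked.Linked x y) :
        ∃ t ∈ (node a c s).parts pos, t.Attaches C x y := by
      cases ha : a.2.2 with
      | false =>
        obtain ⟨t, ht, h⟩ := hc hcM .inside hxy
        obtain ⟨t', ht', htt'⟩ := exists_isPartOf_left_of_unmarked (s := s) pos ha ht
        exact ⟨t', ht', h.mono htt'⟩
      | true =>
        obtain ⟨t, ht, h⟩ := hc hcM _ hxy
        exact ⟨t, mem_parts_node_of_marked pos ha ht, h⟩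
    have hright (hxy : s.unmarked.Linked x y) :
        ∃ t ∈ (node a c s).parts pos, t.Attaches C x y := by
      obtain ⟨t, ht, h⟩ := hs hsM pos hxy
      obtain ⟨t', ht', htt'⟩ := exists_isPartOf_right (a := a) (c := c) pos ht
      exact ⟨t', ht', h.mono htt'⟩
    rcases h with (⟨rfl, h⟩ | h | h) | (⟨rfl, h⟩ | h | h)
    · exact exists_attaches_root_child hM pos hx h
    · exact hleft (.inl h)
    · exact hright (.inl h)
    · exact exists_attaches_child_root hM pos h hx
    · exact hleft (.inr h)
    · exact hright (.inr h)

end Parts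

theorem border_splitted_subset {C : Set V} (pos : Position V) (M : Forest (V × Bool × Bool))
    (hM : ∀ x ∈ M.recolored.requiredVerts, x ∈ C) (hpos : ∀ u, pos = .below (some u) → u ∈ C) :
    (∀ x ∈ (M.splitted pos).2.1, x ∈ C) ∧ ∀ t ∈ (M.splitted pos).2.2, ∀ x ∈ t.border, x ∈ C := by
  induction M generalizing pos with
  | nil => cases pos <;> simp [splitted]
  | node a c s hc hs =>
    have hcs : ∀ x, x ∈ s.recolored.requiredVerts ++ c.recolored.requiredVerts → x ∈ C := by
      intro x hx
      obtain ⟨v, b, _ | _⟩ := a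
      · exact hM x hx
      · exact hM x (List.mem_cons_of_mem _ hx)
    replace hc {pos} := hc pos fun x hx => hcs x (List.mem_append_right _ hx)
    replace hs := hs pos (fun x hx => hcs x (List.mem_append_left _ hx)) hpos
    obtain ⟨v, b, _ | _⟩ := a
    · replace hc := hc (pos := .inside) fun _ => nofun
      cases pos <;> simp only [splitted, List.forall_mem_append, List.forall_mem_cons]
      · exact ⟨⟨hs.1, hc.1⟩, hs.2, hc.2⟩
      · exact ⟨hs.1, hs.2, ⟨fun x hx => hpos x (by rw [Option.mem_toList.1 hx]), hc.1⟩, hc.2⟩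
    · have hv : v ∈ C := hM v List.mem_cons_self
      replace hc := hc (pos := .below (some v)) fun u hu => by cases hu; exact hv
      simp only [splitted, List.forall_mem_append, List.forall_mem_singleton]
      exact ⟨⟨hs.1, hv⟩, hs.2, hc.2⟩

/-- A cut vertex is adjacent to any number of components below it, but to at most one above it. -/
theorem sum_border_splitted_le (pos : Position V) (M : Forest (V × Bool × Bool)) :
    ((M.splitted pos).2.2.map fun t => t.border.length - 1).sum + (M.splitted pos).2.1.length ≤
      M.recolored.requiredVerts.length := by
  induction M generalizing pos with
  | nil => cases pos <;> exact le_rfl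
  | node a c s hc hs =>
    rw [recolored] at hc hs ⊢
    rw [map, length_requiredVerts_node]
    replace hs := hs pos
    obtain ⟨v, b, _ | _⟩ := a
    · replace hc := hc .inside
      rcases pos with _ | _ | u <;> simp [splitted] <;> omega
    · replace hc := hc (.below (some v))
      simp [splitted]
      omega

theorem length_requiredVerts_splitted (ℓ : ℕ) (T : Forest (V × Bool)) :
    ((T.decomposed ℓ).1.splitted .inside).1.requiredVerts.length = (T.decomposed ℓ).2 := by
  induction T with
  | nil => rfl
  | node a c s hc hs =>
    obtain ⟨v, b⟩ := a
    simp only [decomposed]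
    split_ifs <;> simp only [splitted, length_requiredVerts_node, if_true, Bool.false_eq_true,
      if_false, *] <;> omega

theorem length_requiredVerts_component_le (ℓ : ℕ) (pos : Position V) (T : Forest (V × Bool)) :
    ∀ t ∈ ((T.decomposed ℓ).1.splitted pos).2.2, t.tree.requiredVerts.length ≤ ℓ := by
  induction T generalizing pos with
  | nil => cases pos <;> exact List.forall_mem_nil _
  | node a c s hc hs =>
    obtain ⟨v, b⟩ := a
    rw [decomposed]
    by_cases hsize : ℓ < if b then (c.decomposed ℓ).2 + 1 else (c.decomposed ℓ).2
    · rw [if_pos hsize]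
      exact List.forall_mem_append.2 ⟨hs pos, hc _⟩
    · rw [if_neg hsize]
      cases pos with
      | inside => exact List.forall_mem_append.2 ⟨hs _, hc _⟩
      | below u =>
        refine List.forall_mem_append.2 ⟨hs _, List.forall_mem_cons.2 ⟨?_, hc _⟩⟩
        rw [length_requiredVerts_node, length_requiredVerts_splitted]
        split_ifs at hsize ⊢ <;> simp only [requiredVerts, List.length_nil] <;> omega

theorem one_le_size_splitted (pos : Position V) (M : Forest (V × Bool × Bool)) :
    ∀ t ∈ (M.splitted pos).2.2, 1 ≤ t.tree.size := by
  induction M generalizing pos with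
  | nil => cases pos <;> exact List.forall_mem_nil _
  | node a c s hc hs =>
    obtain ⟨v, b, _ | _⟩ := a
    · cases pos with
      | inside => exact List.forall_mem_append.2 ⟨hs _, hc _⟩
      | below u =>
        exact List.forall_mem_append.2 ⟨hs _, List.forall_mem_cons.2 ⟨Nat.le_add_left 1 _, hc _⟩⟩
    · rw [splitted]
      exact List.forall_mem_append.2 ⟨hs _, hc _⟩

end Forest

end TreeSpanner

namespace TreeSpanner

variable {V : Type}

open Forest

/-! ### Monotone paths with few edges -/

/-- Adjacency in the graph with a given list of edges. -/
def Joined (E : List (V × V)) (x y : V) : Prop := (x, y) ∈ E ∨ (y, x) ∈ E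

theorem Joined.symm {E : List (V × V)} {x y : V} (h : Joined E x y) : Joined E y x := Or.symm h

theorem Joined.mono {E E' : List (V × V)} (h : E ⊆ E') {x y : V} (hxy : Joined E x y) :
    Joined E' x y := hxy.imp (fun he => h he) (fun he => h he)

/-- `q` has the same ends as `p`, and its vertices form a subsequence of `p`. -/
structure Shortens (q p : List V) : Prop where
  sublist : q.Sublist p
  head : q.head? = p.head?
  last : q.getLast? = p.getLast?

theorem Shortens.trans {p q r : List V} (hpq : Shortens p q) (hqr : Shortens q r) : Shortens p r :=
  ⟨hpq.sublist.trans hqr.sublist, hpq.head.trans hqr.head, hpq.last.trans hqr.last⟩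

theorem Shortens.reverse {q p : List V} (h : Shortens q p) : Shortens q.reverse p.reverse :=
  ⟨h.sublist.reverse, by rw [List.head?_reverse, List.head?_reverse, h.last],
    by rw [List.getLast?_reverse, List.getLast?_reverse, h.head]⟩

theorem head?_eq_of_sublist {l l' : List V} (hl : l.Nodup) (h : l'.Sublist l)
    (hu : ∀ u ∈ l.head?, u ∈ l') : l'.head? = l.head? := by
  cases h with
  | slnil => rfl
  | cons a h => exact ((List.nodup_cons.1 hl).1 (h.subset (hu a rfl))).elim
  | cons_cons a h => rfl

theorem shortens_of_mem {l l' : List V} (hl : l.Nodup) (h : l'.Sublist l)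
    (hu : ∀ u ∈ l.head?, u ∈ l') (hv : ∀ v ∈ l.getLast?, v ∈ l') : Shortens l' l := by
  refine ⟨h, head?_eq_of_sublist hl h hu, ?_⟩
  rw [List.getLast?_eq_head?_reverse, List.getLast?_eq_head?_reverse]
  refine head?_eq_of_sublist (List.nodup_reverse.2 hl) h.reverse fun v hvl => ?_
  exact List.mem_reverse.2 (hv v (by rwa [List.getLast?_eq_head?_reverse]))

/-- Along the path `p` there is a path with edges in `E` that has at most `k` edges. -/
def HasShortcut (E : List (V × V)) (k : ℕ) (p : List V) : Prop :=
  ∃ q, Shortens q p ∧ q.IsChain (Joined E) ∧ q.length ≤ k + 1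

section HasShortcut

variable {E E' : List (V × V)} {k k' : ℕ} {p : List V}

theorem HasShortcut.mono (h : HasShortcut E k p) (hE : E ⊆ E') (hk : k ≤ k') :
    HasShortcut E' k' p :=
  let ⟨q, hqp, hq, hlen⟩ := h
  ⟨q, hqp, hq.imp fun _ _ => .mono hE, by omega⟩

theorem HasShortcut.reverse (h : HasShortcut E k p) : HasShortcut E k p.reverse :=
  let ⟨q, hqp, hq, hlen⟩ := h
  ⟨q.reverse, hqp.reverse, List.isChain_reverse.2 (hq.imp fun _ _ => .symm),
    by rwa [List.length_reverse]⟩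

theorem HasShortcut.append_left {p₁ : List V} {x : V} (h : HasShortcut E k (x :: p))
    (hx : ∀ u ∈ p₁.head?, Joined E u x) : HasShortcut E (k + 1) (p₁ ++ x :: p) := by
  cases p₁ with
  | nil => exact h.mono (List.Subset.refl E) k.le_succ
  | cons u l =>
    obtain ⟨q, hqp, hq, hlen⟩ := h
    obtain ⟨r, rfl⟩ := List.head?_eq_some_iff.1 hqp.head
    refine ⟨u :: x :: r,
      ⟨.cons_cons u (hqp.sublist.trans (List.sublist_append_right l _)), rfl, ?_⟩,
      hq.cons_cons (hx u rfl), Nat.succ_le_succ hlen⟩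
    rw [List.getLast?_cons_cons, hqp.last, List.getLast?_append_of_ne_nil _ (List.cons_ne_nil x p)]

end HasShortcut

/-- Every path in `T` between two vertices of `R` has a shortcut with at most `k` edges. -/
def HasShortcuts (T : Forest (V × Bool)) (R : List V) (E : List (V × V)) (k : ℕ) : Prop :=
  ∀ p, T.IsPathList p → (∀ u ∈ p.head?, u ∈ R) → (∀ v ∈ p.getLast?, v ∈ R) → HasShortcut E k p

theorem HasShortcuts.of_pruned {T : Forest (V × Bool)} (hT : T.verts.Nodup) {E : List (V × V)}
    {k : ℕ} (h : HasShortcuts T.pruned T.pruned.requiredVerts E k) :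
    HasShortcuts T T.requiredVerts E k := by
  intro p hp hu hv
  obtain ⟨p', hsub, hmem, hp'⟩ := hp.exists_pruned hT
  have hreq {x} (hx : x ∈ T.requiredVerts) : x ∈ T.pruned.requiredVerts :=
    (perm_requiredVerts_pruned T).mem_iff.2 hx
  have hkeep {x} (hxp : x ∈ p) (hx : x ∈ T.requiredVerts) : x ∈ p' :=
    hmem x hxp (mem_verts_of_mem_requiredVerts (hreq hx))
  have hshort : Shortens p' p := shortens_of_mem hp.nodup hsub
    (fun u hup => hkeep (List.mem_of_mem_head? hup) (hu u hup))
    (fun v hvp => hkeep (List.mem_of_getLast? hvp) (hv v hvp))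
  obtain ⟨q, hqp, hq⟩ := h p' hp' (fun u hup => hreq (hu u (hshort.head ▸ hup)))
    (fun v hvp => hreq (hv v (hshort.last ▸ hvp)))
  exact ⟨q, hqp.trans hshort, hq⟩

theorem HasShortcuts.of_recolored {M : Forest (V × Bool × Bool)} {E : List (V × V)} {k : ℕ}
    (h : HasShortcuts M.recolored M.recolored.requiredVerts E k) :
    HasShortcuts M.unmarked M.recolored.requiredVerts E k :=
  fun p hp => h p hp.recolored

end TreeSpanner

namespace TreeSpanner

variable {V : Type}

open Forest

/-! ### Components -/

/-- The subtrees `T₁, …, T_g` into which the removal of the cut vertices splits `T`. -/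
def components (ℓ : ℕ) (T : Forest (V × Bool)) : List (Component V) :=
  (T.decomposed ℓ).1.parts (.below none)

/-- The set `CV_ℓ` of the cut vertices of `T`, as a list. -/
def cutSet (ℓ : ℕ) (T : Forest (V × Bool)) : List V :=
  (T.decomposed ℓ).1.recolored.requiredVerts

section Counts

variable (ℓ : ℕ) (T : Forest (V × Bool))

theorem exists_perm_labels_components :
    ∃ L, ((components ℓ T).flatMap (·.tree.labels)).Perm L ∧ L.Sublist T.labels := by
  refine ⟨_, perm_labels_parts (.below none) (T.decomposed ℓ).1, ?_⟩
  conv_rhs => rw [← unmarked_decomposed ℓ T, unmarked, labels_map]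
  exact List.filter_sublist.map _

theorem sum_countP_components_le (f : V × Bool → Bool) :
    ((components ℓ T).map fun t => t.tree.labels.countP f).sum ≤ T.labels.countP f := by
  obtain ⟨L, hperm, hsub⟩ := exists_perm_labels_components ℓ T
  have h := hsub.countP_le (p := f)
  rwa [← hperm.countP_eq, List.countP_flatMap] at h

theorem sum_length_requiredVerts_components_le :
    ((components ℓ T).map fun t => t.tree.requiredVerts.length).sum ≤ T.requiredVerts.length := by
  simpa only [length_requiredVerts_eq_countP] using sum_countP_components_le ℓ T (·.2)

theorem sum_size_components_le : ((components ℓ T).map fun t => t.tree.size).sum ≤ T.size := by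
  simpa only [List.countP_true, length_labels] using sum_countP_components_le ℓ T fun _ => true

theorem length_components_le : (components ℓ T).length ≤ T.size := by
  have h := List.sum_le_sum (l := components ℓ T) (f := fun _ => 1) (g := fun t => t.tree.size)
    (one_le_size_splitted _ _)
  rw [List.map_const', List.sum_replicate, smul_eq_mul, mul_one] at h
  exact h.trans (sum_size_components_le ℓ T)

theorem mul_length_cutSet_le : (ℓ + 1) * (cutSet ℓ T).length ≤ T.requiredVerts.length :=
  (Nat.le_add_right _ _).trans (mul_length_cutVertices_add_le ℓ T)

theorem sum_border_components_le :
    ((components ℓ T).map fun t => t.tree.requiredVerts.length * t.border.length).sum ≤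
      2 * T.requiredVerts.length := by
  have hborder : ((components ℓ T).map fun t => t.border.length - 1).sum ≤ (cutSet ℓ T).length :=
    (Nat.le_add_right _ _).trans (sum_border_splitted_le (.below none) (T.decomposed ℓ).1)
  calc ((components ℓ T).map fun t => t.tree.requiredVerts.length * t.border.length).sum
      ≤ ((components ℓ T).map fun t =>
          t.tree.requiredVerts.length + ℓ * (t.border.length - 1)).sum := by
        refine List.sum_le_sum fun t ht => ?_
        have hle := length_requiredVerts_component_le ℓ (.below none) T t ht
        cases t.border.length with
        | zero => exact Nat.zero_le _
        | succ b =>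
          rw [Nat.mul_succ, Nat.add_sub_cancel, add_comm]
          exact Nat.add_le_add_left (Nat.mul_le_mul_right b hle) _
    _ = ((components ℓ T).map fun t => t.tree.requiredVerts.length).sum +
          ℓ * ((components ℓ T).map fun t => t.border.length - 1).sum := by
        rw [List.sum_map_add, List.sum_map_mul_left]
    _ ≤ T.requiredVerts.length + (ℓ + 1) * (cutSet ℓ T).length :=
        Nat.add_le_add (sum_length_requiredVerts_components_le ℓ T)
          (Nat.mul_le_mul ℓ.le_succ hborder)
    _ ≤ 2 * T.requiredVerts.length := by
        rw [two_mul]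
        exact Nat.add_le_add_left (mul_length_cutSet_le ℓ T) _

end Counts

section Components

variable {ℓ : ℕ} {T : Forest (V × Bool)} {t : Component V}

theorem mem_labels_of_component (ht : t ∈ components ℓ T) {a : V × Bool}
    (ha : a ∈ t.tree.labels) : a ∈ T.labels := by
  obtain ⟨L, hperm, hsub⟩ := exists_perm_labels_components ℓ T
  exact hsub.subset (hperm.subset (List.mem_flatMap_of_mem ht ha))

theorem mem_verts_of_component (ht : t ∈ components ℓ T) {x : V} (hx : x ∈ t.tree.verts) :
    x ∈ T.verts := by
  obtain ⟨a, ha, rfl⟩ := List.mem_map.1 hx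
  exact List.mem_map_of_mem (mem_labels_of_component ht ha)

theorem mem_verts_of_mem_cutSet {x : V} (hx : x ∈ cutSet ℓ T) : x ∈ T.verts := by
  have h := mem_verts_of_mem_requiredVerts hx
  rwa [verts_recolored, unmarked_decomposed] at h

theorem mem_cutSet_of_mem_border (ht : t ∈ components ℓ T) {x : V} (hx : x ∈ t.border) :
    x ∈ cutSet ℓ T :=
  (border_splitted_subset (C := {x | x ∈ cutSet ℓ T}) (.below none) _ (fun _ h => h)
    (fun _ => nofun)).2 t ht x hx

theorem isMarkedBy_cutSet (hT : T.verts.Nodup) (ℓ : ℕ) :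
    (T.decomposed ℓ).1.IsMarkedBy (cutSet ℓ T) :=
  isMarkedBy_requiredVerts (by rwa [unmarked_decomposed])

theorem notMem_cutSet_of_component (hT : T.verts.Nodup) (ht : t ∈ components ℓ T) {x : V}
    (hx : x ∈ t.tree.verts) : x ∉ cutSet ℓ T := by
  obtain ⟨a, ha, rfl⟩ := List.mem_map.1 hx
  obtain ⟨b, hb, rfl⟩ := List.mem_map.1 <|
    (perm_labels_parts (.below none) _).subset (List.mem_flatMap_of_mem ht ha)
  obtain ⟨hb, hmark⟩ := List.mem_filter.1 hb
  rw [← isMarkedBy_cutSet hT ℓ b hb]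
  simpa using hmark

theorem exists_component (hT : T.verts.Nodup) {x : V} (hx : x ∈ T.verts)
    (hxC : x ∉ cutSet ℓ T) : ∃ t ∈ components ℓ T, x ∈ t.tree.verts := by
  rw [← unmarked_decomposed ℓ T, unmarked, verts, labels_map, List.map_map] at hx
  obtain ⟨a, ha, rfl⟩ := List.mem_map.1 hx
  have hmark : (!a.2.2) = true := by simpa using mt (isMarkedBy_cutSet hT ℓ a ha).1 hxC
  obtain ⟨t, ht, hat⟩ := List.mem_flatMap.1 <| (perm_labels_parts (.below none) _).symm.subset
    (List.mem_map_of_mem (List.mem_filter.2 ⟨ha, hmark⟩))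
  exact ⟨t, ht, List.mem_map_of_mem hat⟩

theorem nodup_components (hT : T.verts.Nodup) :
    ((components ℓ T).flatMap (·.tree.verts)).Nodup := by
  obtain ⟨L, hperm, hsub⟩ := exists_perm_labels_components ℓ T
  have h := (hperm.map Prod.fst).nodup_iff.2 ((hsub.map Prod.fst).nodup hT)
  rwa [List.map_flatMap] at h

theorem nodup_component (hT : T.verts.Nodup) (ht : t ∈ components ℓ T) : t.tree.verts.Nodup :=
  (List.nodup_flatMap.1 (nodup_components hT)).1 t ht

theorem component_unique (hT : T.verts.Nodup) {t' : Component V} (ht : t ∈ components ℓ T)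
    (ht' : t' ∈ components ℓ T) {x : V} (hx : x ∈ t.tree.verts) (hx' : x ∈ t'.tree.verts) :
    t = t' := by
  by_contra hne
  have : Std.Symm (Function.onFun List.Disjoint fun t : Component V => t.tree.verts) :=
    ⟨fun _ _ h => List.Disjoint.symm h⟩
  exact (List.nodup_flatMap.1 (nodup_components hT)).2.forall ht ht' hne hx hx'

theorem attaches_component (hT : T.verts.Nodup) (ht : t ∈ components ℓ T) {x y : V}
    (h : T.Linked x y) (hx : x ∈ t.tree.verts) : t.Attaches (cutSet ℓ T) x y := by
  rw [← unmarked_decomposed ℓ T] at h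
  obtain ⟨t', ht', htt'⟩ := exists_attaches (isMarkedBy_cutSet hT ℓ) (.below none) h
    (notMem_cutSet_of_component hT ht hx)
  rwa [component_unique hT ht ht' hx htt'.mem]

theorem exists_component_of_isPathList (hT : T.verts.Nodup) {p : List V} (hp : T.IsPathList p)
    (hne : p ≠ []) (hpC : ∀ x ∈ p, x ∉ cutSet ℓ T) :
    ∃ t ∈ components ℓ T, t.tree.IsPathList p := by
  obtain ⟨x, l, rfl⟩ := List.exists_cons_of_ne_nil hne
  obtain ⟨hxC, hlC⟩ := List.forall_mem_cons.1 hpC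
  obtain ⟨t, ht, hx⟩ := exists_component hT (hp.mem x List.mem_cons_self) hxC
  have hstep (y z) (hyz : T.Linked y z) (hz : z ∉ cutSet ℓ T) (hy : y ∈ t.tree.verts) :
      z ∈ t.tree.verts ∧ t.tree.Linked y z :=
    have h := (attaches_component hT ht hyz hy).linked hz
    ⟨h.mem.2, h⟩
  obtain ⟨hmem, hchain⟩ := isChain_of_invariant hstep hp.chain hlC hx
  exact ⟨t, ht, hp.nodup, hmem, hchain⟩

theorem mem_requiredVerts_component (hT : T.verts.Nodup) (ht : t ∈ components ℓ T) {x : V}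
    (hx : x ∈ t.tree.verts) (hxT : x ∈ T.requiredVerts) : x ∈ t.tree.requiredVerts := by
  obtain ⟨⟨v, b⟩, ha, rfl⟩ := List.mem_map.1 hx
  obtain rfl := label_unique hT (mem_labels_of_component ht ha) (mem_requiredVerts.1 hxT)
  exact mem_requiredVerts.2 ha

theorem mem_crossPairs {border l : List V} {e : V × V} :
    e ∈ crossPairs border l ↔ e.1 ∈ border ∧ e.2 ∈ l := by
  obtain ⟨x, y⟩ := e
  simp [crossPairs, and_comm]

theorem mem_borderPairs {comps : List (Component V)} {e : V × V} :
    e ∈ borderPairs comps ↔ ∃ t ∈ comps, e.1 ∈ t.border ∧ e.2 ∈ t.tree.requiredVerts := by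
  simp [borderPairs, mem_crossPairs]

end Components

section Combination

variable {ℓ k : ℕ} {T : Forest (V × Bool)} {E E' : List (V × V)}

/-- The subtree that contains the vertices before the first cut vertex `x` of a path is adjacent
to `x`. -/
theorem joined_of_isPathList (hT : T.verts.Nodup) {l : List V} {u x : V}
    (hp : T.IsPathList (l ++ [x])) (hu : u ∈ l.head?) (huT : u ∈ T.requiredVerts)
    (hl : ∀ z ∈ l, z ∉ cutSet ℓ T) (hx : x ∈ cutSet ℓ T) :
    Joined (borderPairs (components ℓ T)) u x := by
  have hne : l ≠ [] := List.ne_nil_of_mem (List.mem_of_mem_head? hu)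
  obtain ⟨t, ht, hpt⟩ := exists_component_of_isPathList hT
    (hp.infix (List.prefix_append l [x]).isInfix) hne hl
  have hlast : T.Linked (l.getLast hne) x :=
    (List.isChain_append.1 hp.chain).2.2 _ (List.getLast?_eq_some_getLast hne) x rfl
  refine .inr (mem_borderPairs.2 ⟨t, ht, ?_, ?_⟩)
  · exact (attaches_component hT ht hlast (hpt.mem _ (List.getLast_mem hne))).border hx
  · exact mem_requiredVerts_component hT ht (hpt.mem u (List.mem_of_mem_head? hu)) huT

theorem HasShortcut.append_left_of_mem_cutSet (hT : T.verts.Nodup)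
    (hE : borderPairs (components ℓ T) ⊆ E) {p₁ p₂ : List V} {x : V}
    (hp : T.IsPathList (p₁ ++ x :: p₂)) (hu : ∀ u ∈ p₁.head?, u ∈ T.requiredVerts)
    (hp₁ : ∀ z ∈ p₁, z ∉ cutSet ℓ T) (hx : x ∈ cutSet ℓ T) (h : HasShortcut E k (x :: p₂)) :
    HasShortcut E (k + 1) (p₁ ++ x :: p₂) := by
  refine h.append_left fun u hup => .mono hE ?_
  refine joined_of_isPathList hT (hp.infix ⟨[], p₂, ?_⟩) hup (hu u hup) hp₁ hx
  rw [List.nil_append, List.append_assoc, List.singleton_append]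

theorem exists_first_mem {C : List V} {p : List V} (h : ∃ x ∈ p, x ∈ C) :
    ∃ p₁ x p₂, p = p₁ ++ x :: p₂ ∧ x ∈ C ∧ ∀ z ∈ p₁, z ∉ C := by
  classical
  obtain ⟨y, hy, hyC⟩ := h
  obtain ⟨x, p₁, p₂, hp₁, hx, hp, -⟩ := List.exists_of_eraseP (p := (· ∈ C)) hy
    (decide_eq_true hyC)
  exact ⟨p₁, x, p₂, hp, of_decide_eq_true hx, fun z hz hzC => hp₁ z hz (decide_eq_true hzC)⟩

theorem hasShortcut_of_mem_cutSet (hT : T.verts.Nodup) (hE' : E' ⊆ E)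
    (hcut : HasShortcuts T (cutSet ℓ T) E' k) (hborder : borderPairs (components ℓ T) ⊆ E)
    {p : List V} (hp : T.IsPathList p) (hu : ∀ u ∈ p.head?, u ∈ T.requiredVerts)
    (hv : ∀ v ∈ p.getLast?, v ∈ T.requiredVerts) (hpC : ∃ x ∈ p, x ∈ cutSet ℓ T) :
    HasShortcut E (k + 2) p := by
  obtain ⟨p₁, x, l, rfl, hx, hp₁⟩ := exists_first_mem hpC
  obtain ⟨p₂, y, m, hl, hy, hp₂⟩ := exists_first_mem (p := (x :: l).reverse)
    ⟨x, List.mem_reverse.2 List.mem_cons_self, hx⟩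
  have hpath : T.IsPathList (p₂ ++ y :: m) :=
    hl ▸ (hp.infix (List.suffix_append _ _).isInfix).reverse
  have hmid : HasShortcut E k (y :: m) := by
    have hmx : (y :: m).getLast? = some x := by
      rw [← List.getLast?_append_of_ne_nil p₂ (List.cons_ne_nil y m), ← hl, List.getLast?_reverse]
      rfl
    rw [← List.reverse_reverse (y :: m)]
    refine (hcut _ (hpath.infix (List.suffix_append _ _).isInfix).reverse ?_ ?_).reverse.mono hE'
      le_rfl
    · rw [List.head?_reverse, hmx]
      exact fun z hz => Option.mem_some.1 hz ▸ hx
    · rw [List.getLast?_reverse]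
      exact fun z hz => Option.mem_some.1 hz ▸ hy
  refine .append_left_of_mem_cutSet hT hborder hp ?_ hp₁ hx ?_
  · intro u hup
    exact hu u (List.mem_head?_append_of_mem_head? hup)
  · rw [← List.reverse_reverse (x :: l), hl]
    refine (hmid.append_left_of_mem_cutSet hT hborder hpath (fun v hvp => hv v ?_) hp₂ hy).reverse
    rw [List.getLast?_append_of_ne_nil _ (List.cons_ne_nil x l), ← List.head?_reverse, hl]
    exact List.mem_head?_append_of_mem_head? hvp

theorem HasShortcuts.combine (hT : T.verts.Nodup) (hE' : E' ⊆ E)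
    (hcut : HasShortcuts T (cutSet ℓ T) E' k) (hborder : borderPairs (components ℓ T) ⊆ E)
    (hcomp : ∀ t ∈ components ℓ T, ∃ F ⊆ E, HasShortcuts t.tree t.tree.requiredVerts F (k + 2)) :
    HasShortcuts T T.requiredVerts E (k + 2) := by
  intro p hp hu hv
  by_cases hpC : ∃ x ∈ p, x ∈ cutSet ℓ T
  · exact hasShortcut_of_mem_cutSet hT hE' hcut hborder hp hu hv hpC
  rcases eq_or_ne p [] with rfl | hne
  · exact ⟨[], ⟨.slnil, rfl, rfl⟩, .nil, Nat.zero_le _⟩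
  obtain ⟨t, ht, hpt⟩ := exists_component_of_isPathList hT hp hne
    fun x hx hxC => hpC ⟨x, hx, hxC⟩
  obtain ⟨F, hF, h⟩ := hcomp t ht
  have hreq {x} (hxp : x ∈ p) (hx : x ∈ T.requiredVerts) : x ∈ t.tree.requiredVerts :=
    mem_requiredVerts_component hT ht (hpt.mem x hxp) hx
  exact (h p hpt (fun u hup => hreq (List.mem_of_mem_head? hup) (hu u hup))
    (fun v hvp => hreq (List.mem_of_getLast? hvp) (hv v hvp))).mono hF le_rfl

end Combination

end TreeSpanner

namespace TreeSpanner

variable {V : Type}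

open Forest

/-! ### The edges -/

/-- The ends of the edges in `E` are distinct vertices of `T`. -/
def EdgesIn (T : Forest (V × Bool)) (E : List (V × V)) : Prop :=
  ∀ e ∈ E, e.1 ∈ T.verts ∧ e.2 ∈ T.verts ∧ e.1 ≠ e.2

section EdgesIn

variable {T : Forest (V × Bool)}

theorem edgesIn_nil (T : Forest (V × Bool)) : EdgesIn T [] := List.forall_mem_nil _

theorem EdgesIn.append {E F : List (V × V)} (hE : EdgesIn T E) (hF : EdgesIn T F) :
    EdgesIn T (E ++ F) := List.forall_mem_append.2 ⟨hE, hF⟩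

theorem EdgesIn.of_subset {T' : Forest (V × Bool)} {E : List (V × V)} (hE : EdgesIn T E)
    (h : T.verts ⊆ T'.verts) : EdgesIn T' E :=
  fun e he => ⟨h (hE e he).1, h (hE e he).2.1, (hE e he).2.2⟩

theorem mem_parentEdges {p : Option V} {x y : V} :
    (x, y) ∈ T.parentEdges p ↔ (p = some x ∧ y ∈ T.roots.map Prod.fst) ∨ T.IsChild x y := by
  induction T generalizing p with
  | nil => simp [parentEdges, roots, IsChild]
  | node a c s hc hs =>
    simp only [parentEdges, List.mem_append, List.mem_map, Option.mem_toList, Prod.mk.injEq, hc, hs,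
      roots, List.map_cons, List.mem_cons, IsChild, Option.some.injEq]
    grind

theorem length_parentEdges_some (v : V) (T : Forest (V × Bool)) :
    (T.parentEdges (some v)).length = T.size := by
  induction T generalizing v with
  | nil => rfl
  | node a c s hc hs =>
    simp [parentEdges, size, hc, hs]
    omega

theorem length_parentEdges_none (T : Forest (V × Bool)) :
    (T.parentEdges none).length + T.roots.length = T.size := by
  induction T with
  | nil => rfl
  | node a c s _ hs =>
    simp [parentEdges, size, length_parentEdges_some, roots]
    omega

theorem edgesIn_parentEdges (hT : T.verts.Nodup) : EdgesIn T (T.parentEdges none) := by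
  rintro ⟨x, y⟩ h
  have h : T.IsChild x y := (mem_parentEdges.1 h).resolve_left nofun
  exact ⟨h.mem.1, h.mem.2, h.ne hT⟩

theorem length_borderPairs (comps : List (Component V)) : (borderPairs comps).length =
    (comps.map fun t => t.tree.requiredVerts.length * t.border.length).sum := by
  simp [borderPairs, crossPairs, List.length_flatMap]

theorem edgesIn_borderPairs (hT : T.verts.Nodup) (ℓ : ℕ) :
    EdgesIn T (borderPairs (components ℓ T)) := by
  rintro ⟨x, y⟩ h
  obtain ⟨t, ht, hx, hy⟩ := mem_borderPairs.1 h
  have hxC := mem_cutSet_of_mem_border ht hx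
  have hyt := mem_verts_of_mem_requiredVerts hy
  exact ⟨mem_verts_of_mem_cutSet hxC, mem_verts_of_component ht hyt,
    fun h : x = y => notMem_cutSet_of_component hT ht hyt (h ▸ hxC)⟩

end EdgesIn

section CompletePairs

variable {l : List V}

theorem length_completePairs_le (l : List V) : (completePairs l).length ≤ l.length * l.length := by
  induction l with
  | nil => exact le_rfl
  | cons v l ih =>
    rw [completePairs, List.length_append, List.length_reverse, List.length_map, List.length_cons]
    linarith

theorem mem_of_mem_completePairs (hl : l.Nodup) {e : V × V} (he : e ∈ completePairs l) :
    e.1 ∈ l ∧ e.2 ∈ l ∧ e.1 ≠ e.2 := by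
  induction l with
  | nil => exact (List.not_mem_nil he).elim
  | cons v l ih =>
    obtain ⟨hv, hl⟩ := List.nodup_cons.1 hl
    simp only [completePairs, List.mem_append, List.mem_reverse, List.mem_map] at he
    rcases he with he | ⟨u, hu, rfl⟩
    · obtain ⟨h₁, h₂, hne⟩ := ih hl he
      exact ⟨List.mem_cons_of_mem v h₁, List.mem_cons_of_mem v h₂, hne⟩
    · exact ⟨List.mem_cons_of_mem v hu, List.mem_cons_self, fun h : u = v => hv (h ▸ hu)⟩

theorem joined_completePairs {x y : V} (hx : x ∈ l) (hy : y ∈ l) (h : x ≠ y) :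
    Joined (completePairs l) x y := by
  induction l with
  | nil => cases hx
  | cons v l ih =>
    simp only [Joined, completePairs, List.mem_append, List.mem_reverse, List.mem_map,
      Prod.mk.injEq]
    rw [List.mem_cons] at hx hy
    grind [Joined]

end CompletePairs

/-! ### Trees that are not decomposed -/

theorem hasShortcut_of_length_le {E : List (V × V)} {p : List V} {k : ℕ}
    (hp : p.IsChain (Joined E)) (hk : p.length ≤ k + 1) : HasShortcut E k p :=
  ⟨p, ⟨.refl p, rfl, rfl⟩, hp, hk⟩

theorem hasShortcuts_of_length_le_one (T : Forest (V × Bool)) {R : List V} (hR : R.length ≤ 1)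
    (E : List (V × V)) : HasShortcuts T R E 0 := by
  intro p hp hu hv
  match p with
  | [] => exact hasShortcut_of_length_le .nil (Nat.zero_le _)
  | [x] => exact hasShortcut_of_length_le (.singleton x) le_rfl
  | x :: y :: l =>
    have hx := hu x rfl
    have hlast := hv _ (List.getLast?_eq_some_getLast (List.cons_ne_nil x (y :: l)))
    have heq : x = (y :: l).getLast (List.cons_ne_nil y l) := by
      match R with
      | [z] => rw [List.mem_singleton.1 hx, ← List.mem_singleton.1 hlast]; rfl
    exact ((List.nodup_cons.1 hp.nodup).1 (heq ▸ List.getLast_mem _)).elim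

theorem hasShortcuts_completePairs (T : Forest (V × Bool)) (R : List V) :
    HasShortcuts T R (completePairs R) 1 := by
  intro p hp hu hv
  match p with
  | [] => exact hasShortcut_of_length_le .nil (Nat.zero_le _)
  | [x] => exact hasShortcut_of_length_le (.singleton x) (Nat.le_add_left 1 1)
  | x :: y :: l =>
    set z := (y :: l).getLast (List.cons_ne_nil y l)
    have hzl : z ∈ y :: l := List.getLast_mem _
    have hlast : (x :: y :: l).getLast? = some z :=
      List.getLast?_eq_some_getLast (List.cons_ne_nil x (y :: l))
    have hxz : x ≠ z := fun h => (List.nodup_cons.1 hp.nodup).1 (h ▸ hzl)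
    refine ⟨[x, z], ⟨.cons_cons x (List.singleton_sublist.2 hzl), rfl, hlast.symm⟩, ?_, le_rfl⟩
    exact List.isChain_pair.2 (joined_completePairs (hu x rfl) (hv z hlast) hxz)

section Short

variable {T : Forest (V × Bool)} {k : ℕ}

theorem Forest.IsPathList.isChain_joined_parentEdges {p : List V} (hp : T.IsPathList p) :
    p.IsChain (Joined (T.parentEdges none)) :=
  hp.chain.imp fun _ _ =>
    Or.imp (fun h => mem_parentEdges.2 (.inr h)) (fun h => mem_parentEdges.2 (.inr h))

theorem hasShortcuts_parentEdges (hT : T.verts.Nodup) (hred : T.IsReduced)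
    (hk : T.requiredVerts.length ≤ k) :
    HasShortcuts T T.requiredVerts (T.parentEdges none) k := by
  intro p hp _ _
  refine hasShortcut_of_length_le hp.isChain_joined_parentEdges ?_
  have hlen := (hp.isBend hT).length_add_roots_le hred
  rcases Nat.eq_zero_or_pos T.roots.length with h | h
  · obtain rfl := eq_nil_of_length_roots_eq_zero h
    obtain rfl : p = [] := hp.isBend hT
    exact Nat.zero_le _
  · omega

/-- The edge between the children of the root, if there are exactly two. -/
def rootChord : Forest (V × Bool) → List (V × V)
  | node _ (node c₁ _ (node c₂ _ nil)) nil => [(c₁.1, c₂.1)]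
  | _ => []

theorem length_rootChord_le (T : Forest (V × Bool)) : (rootChord T).length ≤ 1 := by
  unfold rootChord
  split <;> simp

theorem edgesIn_rootChord (hT : T.verts.Nodup) : EdgesIn T (rootChord T) := by
  unfold rootChord
  split
  · rename_i c₁ d₁ c₂ d₂
    refine List.forall_mem_singleton.2 ?_
    simp only [verts_node, List.nodup_cons, List.mem_append, List.mem_cons] at hT ⊢
    grind
  · exact edgesIn_nil _

theorem Forest.IsDown.eq_of_mem_head? {a : V × Bool} {d : Forest (V × Bool)} {l : List V}
    (h : (node a d nil).IsDown l) {x : V} (hx : x ∈ l.head?) : x = a.1 := by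
  rcases h with ⟨l', rfl, -⟩ | rfl
  · exact (Option.mem_some.1 hx).symm
  · cases hx

theorem Forest.IsFork.joined_heads {c₁ c₂ : V × Bool} {d₁ d₂ : Forest (V × Bool)}
    {l₁ l₂ : List V} (h : (node c₁ d₁ (node c₂ d₂ nil)).IsFork l₁ l₂) {x y : V}
    (hx : x ∈ l₁.head?) (hy : y ∈ l₂.head?) : Joined [(c₁.1, c₂.1)] x y := by
  rcases h with ⟨l', rfl, -, h⟩ | ⟨l', rfl, -, h⟩ | h
  · obtain rfl := Option.mem_some.1 hx
    exact .inl (h.eq_of_mem_head? hy ▸ List.mem_singleton_self _)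
  · obtain rfl := Option.mem_some.1 hy
    exact .inr (h.eq_of_mem_head? hx ▸ List.mem_singleton_self _)
  · rcases h.eq_nil_or_eq_nil (fun h : 2 ≤ 1 => by omega) with rfl | rfl
    · cases hx
    · cases hy

theorem hasShortcuts_rootChord (hT : T.verts.Nodup) (hred : T.IsReduced)
    (hk : T.requiredVerts.length = k + 1) :
    HasShortcuts T T.requiredVerts (T.parentEdges none ++ rootChord T) k := by
  intro p hp _ _
  have hchain : p.IsChain (Joined (T.parentEdges none ++ rootChord T)) :=
    hp.isChain_joined_parentEdges.imp fun _ _ => .mono (List.subset_append_left _ _)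
  rcases le_or_gt p.length (k + 1) with hlen | hlen
  · exact hasShortcut_of_length_le hchain hlen
  obtain ⟨a, c₁, d₁, c₂, d₂, l₁, l₂, rfl, hfork, hl₁, hl₂, rfl, hle⟩ :=
    (hp.isBend hT).exists_of_length hred (hk ▸ hlen)
  obtain ⟨hchain₁, hchain₂, -⟩ := List.isChain_append.1 hchain
  refine ⟨l₁.reverse ++ l₂, ⟨(List.sublist_cons_self _ _).append_left _, ?_, ?_⟩,
    List.isChain_append.2 ⟨hchain₁, (List.isChain_cons.1 hchain₂).2, fun x hx y hy => ?_⟩, ?_⟩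
  · rw [List.head?_append_of_ne_nil _ (List.reverse_ne_nil_iff.2 hl₁),
      List.head?_append_of_ne_nil _ (List.reverse_ne_nil_iff.2 hl₁)]
  · rw [List.getLast?_append_of_ne_nil _ hl₂,
      List.getLast?_append_of_ne_nil _ (List.cons_ne_nil _ _), List.getLast?_cons_of_ne_nil hl₂]
  · rw [List.getLast?_reverse] at hx
    exact (hfork.joined_heads hx hy).mono (List.subset_append_right _ _)
  · rw [List.length_append, List.length_reverse]
    exact hle.trans hk.le

end Short

end TreeSpanner

namespace TreeSpanner

variable {V : Type}

open Forest Filter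

/-! ### The recursion -/

/-- From some depth bound on, `p` puts the edges `E` in front of its argument, in `steps` steps. -/
def EventuallyAdds (p : ℕ → List (V × V) → Alg (List (V × V))) (E : List (V × V)) (steps : ℕ) :
    Prop :=
  ∀ᶠ d in atTop, ∀ acc, Returns (p d acc) (E ++ acc) steps

theorem EventuallyAdds.of_succ {p : ℕ → List (V × V) → Alg (List (V × V))} {E : List (V × V)}
    {steps : ℕ} (h : ∀ᶠ d in atTop, ∀ acc, Returns (p (d + 1) acc) (E ++ acc) steps) :
    EventuallyAdds p E steps := by
  rwa [EventuallyAdds, ← map_add_atTop_eq_nat 1, eventually_map]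

/-- The bounds that the induction proves for the edges `E` found on `T` and for the number of
steps, with a constant `K`. -/
structure IsResult (K k : ℕ) (T : Forest (V × Bool)) (E : List (V × V)) (steps : ℕ) : Prop where
  edgesIn : EdgesIn T E
  hasShortcuts : HasShortcuts T T.requiredVerts E k
  length_le_of_even : Even k →
    E.length ≤ 2 * T.requiredVerts.length * alphaPrime k T.requiredVerts.length
  length_le_of_odd : Odd k →
    E.length ≤ 3 * T.requiredVerts.length * alphaPrime k T.requiredVerts.length + 2
  eq_nil : T.requiredVerts.length ≤ 1 → E = []
  steps_le : steps ≤ K * T.requiredVerts.length * alphaPrime k T.requiredVerts.length +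
    K * T.requiredVerts.length + 2

/-- The algorithm terminates on `T`, with a result as in `IsResult`. -/
def Succeeds (K k : ℕ) (T : Forest (V × Bool)) : Prop :=
  ∃ E steps, EventuallyAdds (fun d => tree1Spanner d T T.requiredVerts.length k) E steps ∧
    IsResult K k T E steps

section Base

variable {K k : ℕ} {T : Forest (V × Bool)}

/-- The edges that the algorithm returns for `n ≤ k + 1`. -/
def baseEdges (k : ℕ) (T : Forest (V × Bool)) : List (V × V) :=
  T.parentEdges none ++ if T.requiredVerts.length = k + 1 then rootChord T else []

theorem returns_tree1Spanner_of_le (d : ℕ) (h : T.requiredVerts.length ≤ k + 1)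
    (acc : List (V × V)) :
    Returns (tree1Spanner (d + 1) T T.requiredVerts.length k acc) (baseEdges k T ++ acc)
      (2 * T.size + 2) := by
  unfold tree1Spanner
  rcases h.lt_or_eq with hlt | heq
  · rw [if_pos (Nat.lt_succ_iff.1 hlt), baseEdges, if_neg hlt.ne, List.append_nil]
    exact .tick_bind (T.returns_treeEdges none acc)
  · rw [if_neg (by omega), if_pos heq, baseEdges, if_pos heq, List.append_assoc]
    refine .tick_bind ?_
    split
    · exact returns_treeEdges none _ _
    · rw [rootChord]
      exacts [T.returns_treeEdges none acc, ‹_›]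

theorem one_le_alphaPrime_of_even {n : ℕ} (hk : Even k) (hn : 2 ≤ n) (hnk : n ≤ k + 3) :
    1 ≤ alphaPrime (k + 2) n := by
  obtain ⟨j, rfl⟩ := hk.two_dvd
  rw [alphaPrime_small _ n hnk, alpha_even_small hnk]
  split_ifs <;> omega

theorem length_baseEdges_le (k : ℕ) (hred : T.IsReduced) : (baseEdges k T).length ≤
    2 * T.requiredVerts.length - 2 + if T.requiredVerts.length = k + 1 then 1 else 0 := by
  have hsize := hred.size_add_roots_le
  have hroots : T.size = 0 ∨ 1 ≤ T.roots.length := (Nat.eq_zero_or_pos _).imp_left fun h => by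
    rw [eq_nil_of_length_roots_eq_zero h, size]
  have hparent := length_parentEdges_none T
  have hchord := length_rootChord_le T
  rw [baseEdges, List.length_append]
  split_ifs
  · omega
  · rw [List.length_nil]
    omega

theorem edgesIn_baseEdges (k : ℕ) (hT : T.verts.Nodup) : EdgesIn T (baseEdges k T) := by
  refine (edgesIn_parentEdges hT).append ?_
  split_ifs
  exacts [edgesIn_rootChord hT, edgesIn_nil T]

theorem hasShortcuts_baseEdges (hT : T.verts.Nodup) (hred : T.IsReduced)
    (hn : T.requiredVerts.length ≤ k + 1) :
    HasShortcuts T T.requiredVerts (baseEdges k T) k := by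
  rw [baseEdges]
  split_ifs with h
  · exact hasShortcuts_rootChord hT hred h
  · rw [List.append_nil]
    exact hasShortcuts_parentEdges hT hred (by omega)

theorem isResult_baseEdges (hK : 4 ≤ K) (hT : T.verts.Nodup) (hred : T.IsReduced)
    (hn : T.requiredVerts.length ≤ k + 3) :
    IsResult K (k + 2) T (baseEdges (k + 2) T) (2 * T.size + 2) := by
  have hlen := length_baseEdges_le (k + 2) hred
  refine ⟨edgesIn_baseEdges _ hT, hasShortcuts_baseEdges hT hred hn, fun he => ?_, fun _ => ?_,
    fun h => ?_, ?_⟩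
  · rcases Nat.lt_or_ge T.requiredVerts.length 2 with h | h
    · rw [if_neg (by omega)] at hlen
      omega
    · have := Nat.mul_le_mul_left (2 * T.requiredVerts.length)
        (one_le_alphaPrime_of_even ((Nat.even_add.1 he).2 even_two) h hn)
      split_ifs at hlen <;> omega
  · rcases Nat.lt_or_ge T.requiredVerts.length 3 with h | h
    · rw [if_neg (by omega)] at hlen
      omega
    · have := Nat.mul_le_mul_left (3 * T.requiredVerts.length)
        ((alpha_pos k h).trans_eq (alphaPrime_small k _ hn).symm)
      split_ifs at hlen <;> omega
  · rw [if_neg (by omega)] at hlen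
    exact List.eq_nil_of_length_eq_zero (by omega)
  · have := hred.size_add_roots_le
    have := Nat.mul_le_mul_right T.requiredVerts.length hK
    omega

theorem succeeds_of_le (hK : 4 ≤ K) (hT : T.verts.Nodup) (hred : T.IsReduced)
    (hn : T.requiredVerts.length ≤ k + 3) : Succeeds K (k + 2) T :=
  ⟨_, _, .of_succ (.of_forall fun d => returns_tree1Spanner_of_le d hn),
    isResult_baseEdges hK hT hred hn⟩

end Base

end TreeSpanner

namespace TreeSpanner

variable {V : Type}

open Forest Filter

/-! ### The edges between the cut vertices -/

/-- Step (2) of `tree1Spanner` with parameter `k + 2`, for the forest `M` with marked cut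
vertices. -/
def innerEdges (d : ℕ) (M : Forest (V × Bool × Bool)) :
    ℕ → List (V × V) → Alg (List (V × V))
  | 0, acc => pure acc
  | 1, acc => cutVertices M [] >>= fun cv => completeEdges cv acc
  | k + 2, acc => recolor M >>= fun τ => prune τ >>= fun τ' => cutVertices M [] >>= fun cv =>
      count cv >>= fun m => tree1Spanner d τ' m (k + 2) acc

theorem tree1Spanner_of_lt (d : ℕ) (T : Forest (V × Bool)) {n k : ℕ} (h : k + 4 ≤ n)
    (acc : List (V × V)) :
    tree1Spanner (d + 1) T n (k + 2) acc =
      tick >>= fun _ => computeAlpha d k n >>= fun ℓ => decomp ℓ T >>= fun M =>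
        innerEdges d M.1 k acc >>= fun acc => split (.below none) M.1 [] [] >>= fun r =>
          borderEdges r.2.2 acc >>= fun acc =>
            spanComponents (fun T' m acc => tree1Spanner d T' m (k + 2) acc) r.2.2 acc := by
  conv_lhs => unfold tree1Spanner
  rw [if_neg (by omega), if_neg (by omega)]
  match k with
  | 0 | 1 | k + 2 => simp [innerEdges]

/-- The bounds for the edges `E` between the cut vertices that step (2) finds with parameter
`k + 2`, and for the number of steps. -/
structure IsInnerResult (K k ℓ : ℕ) (T : Forest (V × Bool)) (E : List (V × V)) (steps : ℕ) :
    Prop where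
  edgesIn : EdgesIn T E
  hasShortcuts : HasShortcuts T (cutSet ℓ T) E k
  length_le_of_even : Even k → E.length ≤ 2 * T.requiredVerts.length
  length_le_of_odd : Odd k → E.length ≤ 3 * T.requiredVerts.length + 2
  steps_le : steps ≤ (K + 20) * T.requiredVerts.length

section Inner

variable {K k : ℕ} {T : Forest (V × Bool)}

theorem Forest.size_map {A B : Type} (f : A → B) (T : Forest A) : (T.map f).size = T.size := by
  rw [← length_labels, labels_map, List.length_map, length_labels]

theorem Forest.size_decomposed (ℓ : ℕ) (T : Forest (V × Bool)) :
    (T.decomposed ℓ).1.size = T.size := by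
  conv_rhs => rw [← unmarked_decomposed ℓ T, unmarked, size_map]

theorem Forest.size_recolored_decomposed (ℓ : ℕ) (T : Forest (V × Bool)) :
    (T.decomposed ℓ).1.recolored.size = T.size := (size_map _ _).trans (size_decomposed ℓ T)

theorem nodup_verts_recolored_decomposed (hT : T.verts.Nodup) (ℓ : ℕ) :
    (T.decomposed ℓ).1.recolored.verts.Nodup := by
  rwa [verts_recolored, unmarked_decomposed]

theorem HasShortcuts.of_pruned_recolored {E : List (V × V)} {ℓ : ℕ} (hT : T.verts.Nodup)
    (h : HasShortcuts (T.decomposed ℓ).1.recolored.pruned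
      (T.decomposed ℓ).1.recolored.pruned.requiredVerts E k) :
    HasShortcuts T (cutSet ℓ T) E k := by
  have h := (h.of_pruned (nodup_verts_recolored_decomposed hT ℓ)).of_recolored
  rwa [unmarked_decomposed] at h

theorem isInnerResult_zero {ℓ : ℕ} (hℓ : T.requiredVerts.length < (ℓ + 1) * 2) :
    IsInnerResult K 0 ℓ T [] 0 := by
  have hcut : (cutSet ℓ T).length < 2 :=
    lt_of_mul_lt_mul_left ((mul_length_cutSet_le ℓ T).trans_lt hℓ) (Nat.zero_le _)
  exact ⟨edgesIn_nil T, hasShortcuts_of_length_le_one T (Nat.lt_succ_iff.1 hcut) [],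
    fun _ => Nat.zero_le _, fun _ => Nat.zero_le _, Nat.zero_le _⟩

theorem isInnerResult_completePairs {ℓ steps : ℕ} (hT : T.verts.Nodup) (hred : T.IsReduced)
    (hℓ : T.requiredVerts.length ≤ ℓ ^ 2) (hn : 1 ≤ T.requiredVerts.length)
    (hsteps : steps ≤ ((cutSet ℓ T).length + 1) * ((cutSet ℓ T).length + 1)) :
    IsInnerResult K 1 ℓ T (completePairs (cutSet ℓ T)) (2 * T.size + 1 + steps) := by
  have hmul := mul_length_cutSet_le ℓ T
  have hcut : (cutSet ℓ T).length ≤ ℓ := by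
    by_contra! h
    have := Nat.mul_le_mul_left (ℓ + 1) h.le
    nlinarith
  have hsq : (cutSet ℓ T).length * (cutSet ℓ T).length ≤ T.requiredVerts.length := by nlinarith
  have hlen := length_completePairs_le (cutSet ℓ T)
  refine ⟨fun e he => ?_, hasShortcuts_completePairs T _, fun _ => by omega, fun _ => by omega, ?_⟩
  · obtain ⟨h₁, h₂, hne⟩ :=
      mem_of_mem_completePairs (nodup_requiredVerts (nodup_verts_recolored_decomposed hT ℓ)) he
    exact ⟨mem_verts_of_mem_cutSet h₁, mem_verts_of_mem_cutSet h₂, hne⟩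
  · have := hred.size_add_roots_le
    nlinarith

theorem length_requiredVerts_pruned_recolored (ℓ : ℕ) (T : Forest (V × Bool)) :
    (T.decomposed ℓ).1.recolored.pruned.requiredVerts.length = (cutSet ℓ T).length :=
  (perm_requiredVerts_pruned _).length_eq

theorem isInnerResult_of_isResult {ℓ s : ℕ} {E : List (V × V)} (hT : T.verts.Nodup)
    (hred : T.IsReduced) (hn : 1 ≤ T.requiredVerts.length)
    (hℓ : alphaPrime k T.requiredVerts.length ≤ ℓ)
    (h : IsResult K k (T.decomposed ℓ).1.recolored.pruned E s) :
    IsInnerResult K k ℓ T E (3 * (2 * T.size + 1) + ((cutSet ℓ T).length + 1) + s) := by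
  obtain ⟨hin, hshort, heven, hodd, -, hsteps⟩ := h
  rw [length_requiredVerts_pruned_recolored] at heven hodd hsteps
  have hmul := mul_length_cutSet_le ℓ T
  have hα : alphaPrime k (cutSet ℓ T).length ≤ ℓ :=
    (alphaPrime_mono k ((Nat.le_mul_of_pos_left _ ℓ.succ_pos).trans hmul)).trans hℓ
  have hmα : (cutSet ℓ T).length * alphaPrime k (cutSet ℓ T).length +
      (cutSet ℓ T).length ≤ T.requiredVerts.length := by nlinarith
  refine ⟨hin.of_subset fun x hx => ?_, hshort.of_pruned_recolored hT, fun hk => ?_, fun hk => ?_,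
    ?_⟩
  · have h := (verts_pruned_sublist _).subset hx
    rwa [verts_recolored, unmarked_decomposed] at h
  · nlinarith [heven hk]
  · nlinarith [hodd hk]
  · have := Nat.mul_le_mul_left K hmα
    have := hred.size_add_roots_le
    nlinarith

theorem exists_innerEdges (hT : T.verts.Nodup) (hred : T.IsReduced)
    (hn : 1 ≤ T.requiredVerts.length)
    (ih : 2 ≤ k → ∀ T' : Forest (V × Bool), T'.verts.Nodup → T'.IsReduced → Succeeds K k T')
    {ℓ : ℕ} (hℓ : alphaPrime k T.requiredVerts.length = ℓ) :
    ∃ E steps, EventuallyAdds (fun d => innerEdges d (T.decomposed ℓ).1 k) E steps ∧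
      IsInnerResult K k ℓ T E steps := by
  have hcut := (T.decomposed ℓ).1.returns_cutVertices []
  rw [List.append_nil, size_decomposed] at hcut
  match k with
  | 0 =>
    rw [alphaPrime_zero, alpha_zero_eq] at hℓ
    exact ⟨[], 0, .of_forall fun _ _ => .pure _, isInnerResult_zero (by omega)⟩
  | 1 =>
    obtain ⟨steps, hsteps, hrun⟩ := exists_returns_completeEdges (cutSet ℓ T)
    have hsq := le_alpha_one_sq T.requiredVerts.length
    rw [← alphaPrime_one, hℓ] at hsq
    exact ⟨_, _, .of_forall fun _ acc => hcut.bind (hrun acc),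
      isInnerResult_completePairs hT hred hsq hn hsteps⟩
  | k + 2 =>
    obtain ⟨E, s, hE, hres⟩ := ih (Nat.le_add_left 2 k) (T.decomposed ℓ).1.recolored.pruned
      ((verts_pruned_sublist _).nodup (nodup_verts_recolored_decomposed hT ℓ)) (isReduced_pruned _)
    rw [length_requiredVerts_pruned_recolored] at hE
    refine ⟨E, _, hE.mono fun d hd acc => ?_, isInnerResult_of_isResult hT hred hn hℓ.le hres⟩
    have hrecolor := (T.decomposed ℓ).1.returns_recolor
    have hprune := (T.decomposed ℓ).1.recolored.returns_prune
    rw [size_decomposed] at hrecolor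
    rw [size_recolored_decomposed] at hprune
    refine .congr (hrecolor.bind (hprune.bind (hcut.bind ((returns_count _).bind (hd acc))))) rfl ?_
    rw [cutSet]
    omega

end Inner

end TreeSpanner

namespace TreeSpanner

variable {V : Type}

open Forest Filter

/-! ### Combining the recursive calls -/

section Combine

variable {c K k ℓ s' : ℕ} {T : Forest (V × Bool)} {E' : List (V × V)}
  {E : Component V → List (V × V)} {s : Component V → ℕ}

/-- The edges `E' ∪ E'' ∪ ⋃ Eᵢ` of step (6). -/
def combinedEdges (ℓ : ℕ) (T : Forest (V × Bool)) (E' : List (V × V))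
    (E : Component V → List (V × V)) : List (V × V) :=
  (components ℓ T).reverse.flatMap E ++ (borderPairs (components ℓ T) ++ E')

/-- The number of steps taken if step (2) takes `s'` steps and the recursive call for the component
`t` takes `s t` steps. -/
noncomputable def combinedSteps (k ℓ : ℕ) (T : Forest (V × Bool)) (s' : ℕ)
    (s : Component V → ℕ) : ℕ :=
  alphaCost k T.requiredVerts.length + 2 * (2 * T.size + 1) + s' +
    (((components ℓ T).map fun t =>
      3 + 2 * t.tree.size + t.tree.requiredVerts.length * (t.border.length + 2)).sum + 1) +
    (((components ℓ T).map fun t =>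
      s t + 4 * t.tree.size + t.tree.requiredVerts.length + 4).sum + 1) + 1

theorem eventuallyAdds_combinedEdges (hn : k + 4 ≤ T.requiredVerts.length)
    (hℓ : alphaPrime k T.requiredVerts.length = ℓ)
    (hinner : EventuallyAdds (fun d => innerEdges d (T.decomposed ℓ).1 k) E' s')
    (hcomp : ∀ t ∈ components ℓ T, EventuallyAdds
      (fun d => tree1Spanner d t.tree.pruned t.tree.requiredVerts.length (k + 2)) (E t) (s t)) :
    EventuallyAdds (fun d => tree1Spanner d T T.requiredVerts.length (k + 2))
      (combinedEdges ℓ T E' E) (combinedSteps k ℓ T s' s) := by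
  have hcomp := (eventually_all_finite (components ℓ T).finite_toSet).2 hcomp
  refine .of_succ ?_
  filter_upwards [eventuallyReturns_computeAlpha k T.requiredVerts.length, hinner, hcomp]
    with d hα hinner hcomp acc
  have hsplit := returns_split (.below none) (T.decomposed ℓ).1 [] []
  rw [List.append_nil, List.append_nil, size_decomposed] at hsplit
  rw [hℓ] at hα
  rw [tree1Spanner_of_lt d T hn]
  refine .congr (.tick_bind (hα.bind ((returns_decomp ℓ T).bind ((hinner acc).bind (hsplit.bind
    ((returns_borderEdges _ _).bind (returns_spanComponents hcomp _))))))) ?_ ?_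
  · rw [combinedEdges, List.append_assoc, List.append_assoc]
    rfl
  · dsimp only
    rw [combinedSteps, components, parts]
    omega

theorem edgesIn_combinedEdges (hT : T.verts.Nodup) (hE' : EdgesIn T E')
    (hE : ∀ t ∈ components ℓ T, EdgesIn t.tree.pruned (E t)) :
    EdgesIn T (combinedEdges ℓ T E' E) := by
  refine .append (fun e he => ?_) ((edgesIn_borderPairs hT ℓ).append hE')
  obtain ⟨t, ht, he⟩ := List.mem_flatMap.1 he
  rw [List.mem_reverse] at ht
  exact (hE t ht).of_subset
    (fun x hx => mem_verts_of_component ht ((verts_pruned_sublist _).subset hx)) e he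

theorem hasShortcuts_combinedEdges (hT : T.verts.Nodup) (hE' : HasShortcuts T (cutSet ℓ T) E' k)
    (hE : ∀ t ∈ components ℓ T,
      HasShortcuts t.tree.pruned t.tree.pruned.requiredVerts (E t) (k + 2)) :
    HasShortcuts T T.requiredVerts (combinedEdges ℓ T E' E) (k + 2) := by
  refine .combine hT ?_ hE' ?_ fun t ht =>
    ⟨E t, ?_, (hE t ht).of_pruned (nodup_component hT ht)⟩
  · exact List.subset_append_of_subset_right _ (List.subset_append_right _ _)
  · exact List.subset_append_of_subset_right _ (List.subset_append_left _ _)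
  · exact List.subset_append_of_subset_left _
      fun e he => List.mem_flatMap.2 ⟨t, List.mem_reverse.2 ht, he⟩

theorem length_combinedEdges_le : (combinedEdges ℓ T E' E).length ≤
    ((components ℓ T).map fun t => (E t).length).sum + 2 * T.requiredVerts.length + E'.length := by
  have hborder := sum_border_components_le ℓ T
  rw [combinedEdges, List.length_append, List.length_append, List.length_flatMap, List.map_reverse,
    List.sum_reverse, length_borderPairs]
  omega

theorem sum_components_le_mul {f : Component V → ℕ} {a : ℕ}
    (h : ∀ t ∈ components ℓ T, f t ≤ a * t.tree.requiredVerts.length) :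
    ((components ℓ T).map f).sum ≤ a * T.requiredVerts.length := by
  refine (List.sum_le_sum h).trans ?_
  rw [List.sum_map_mul_left]
  exact Nat.mul_le_mul_left a (sum_length_requiredVerts_components_le ℓ T)

theorem alphaPrime_component_le {t : Component V} (ht : t ∈ components ℓ T) (k : ℕ) :
    alphaPrime k t.tree.requiredVerts.length ≤ alphaPrime k ℓ :=
  alphaPrime_mono k (length_requiredVerts_component_le ℓ (.below none) T t ht)

theorem sum_length_le_of_even (hk : Even k)
    (h : ∀ t ∈ components ℓ T, IsResult K k t.tree.pruned (E t) (s t)) :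
    ((components ℓ T).map fun t => (E t).length).sum ≤
      2 * alphaPrime k ℓ * T.requiredVerts.length := by
  refine sum_components_le_mul fun t ht => ((h t ht).length_le_of_even hk).trans ?_
  rw [mul_right_comm, (perm_requiredVerts_pruned t.tree).length_eq]
  gcongr
  exact alphaPrime_component_le ht k

theorem sum_length_le_of_odd (hk : Odd k)
    (h : ∀ t ∈ components ℓ T, IsResult K k t.tree.pruned (E t) (s t)) :
    ((components ℓ T).map fun t => (E t).length).sum ≤
      (3 * alphaPrime k ℓ + 1) * T.requiredVerts.length := by
  refine sum_components_le_mul fun t ht => ?_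
  have hlen := (h t ht).length_le_of_odd hk
  have hnil := (h t ht).eq_nil
  rw [(perm_requiredVerts_pruned t.tree).length_eq] at hlen hnil
  rcases Nat.lt_or_ge 1 t.tree.requiredVerts.length with hreq | hreq
  · have := Nat.mul_le_mul_left (3 * t.tree.requiredVerts.length) (alphaPrime_component_le ht k)
    linarith
  · rw [hnil hreq]
    exact Nat.zero_le _

theorem sum_steps_le (h : ∀ t ∈ components ℓ T, IsResult K k t.tree.pruned (E t) (s t)) :
    ((components ℓ T).map s).sum ≤
      (K * alphaPrime k ℓ + K) * T.requiredVerts.length + 2 * T.size := by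
  have hle : ((components ℓ T).map fun t => s t - 2).sum ≤
      (K * alphaPrime k ℓ + K) * T.requiredVerts.length := sum_components_le_mul fun t ht => by
    have hsteps := (h t ht).steps_le
    rw [(perm_requiredVerts_pruned t.tree).length_eq] at hsteps
    have := Nat.mul_le_mul_left (K * t.tree.requiredVerts.length) (alphaPrime_component_le ht k)
    rw [tsub_le_iff_right]
    linarith
  have hcount := length_components_le ℓ T
  calc ((components ℓ T).map s).sum
      ≤ ((components ℓ T).map fun t => (s t - 2) + 2).sum :=
        List.sum_le_sum fun t _ => le_tsub_add
    _ = ((components ℓ T).map fun t => s t - 2).sum + (components ℓ T).length * 2 := by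
        rw [List.sum_map_add, List.map_const', List.sum_replicate, smul_eq_mul]
    _ ≤ _ := by omega

theorem combinedSteps_le (hred : T.IsReduced)
    (hα : alphaCost k T.requiredVerts.length ≤ c * T.requiredVerts.length) :
    combinedSteps k ℓ T s' s ≤
      (c + 60) * T.requiredVerts.length + s' + ((components ℓ T).map s).sum + 5 := by
  have hborder := sum_border_components_le ℓ T
  have hreq := sum_length_requiredVerts_components_le ℓ T
  have hsize := sum_size_components_le ℓ T
  have hcount := length_components_le ℓ T
  have hred := hred.size_add_roots_le
  simp only [combinedSteps, mul_add, List.sum_map_add, List.map_const', List.sum_replicate,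
    List.sum_map_mul_left, List.sum_map_mul_right, smul_eq_mul, add_mul]
  omega

theorem isResult_combinedEdges (hT : T.verts.Nodup) (hred : T.IsReduced)
    (hn : k + 4 ≤ T.requiredVerts.length) (hK : c + 100 ≤ K)
    (hα : alphaCost k T.requiredVerts.length ≤ c * T.requiredVerts.length)
    (hℓ : alphaPrime k T.requiredVerts.length = ℓ)
    (hinner : IsInnerResult K k ℓ T E' s')
    (hcomp : ∀ t ∈ components ℓ T, IsResult K (k + 2) t.tree.pruned (E t) (s t)) :
    IsResult K (k + 2) T (combinedEdges ℓ T E' E) (combinedSteps k ℓ T s' s) := by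
  have hrec := alphaPrime_rec k T.requiredVerts.length hn
  rw [hℓ] at hrec
  have hlen := length_combinedEdges_le (ℓ := ℓ) (T := T) (E' := E') (E := E)
  refine ⟨edgesIn_combinedEdges hT hinner.edgesIn fun t ht => (hcomp t ht).edgesIn,
    hasShortcuts_combinedEdges hT hinner.hasShortcuts fun t ht => (hcomp t ht).hasShortcuts,
    fun hk => ?_, fun hk => ?_, fun h => by omega, ?_⟩ <;> rw [hrec]
  · have := hinner.length_le_of_even ((Nat.even_add.1 hk).2 even_two)
    linarith [sum_length_le_of_even hk hcomp]
  · have := hinner.length_le_of_odd ((Nat.odd_add.1 hk).2 even_two)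
    linarith [sum_length_le_of_odd hk hcomp]
  · have := combinedSteps_le (ℓ := ℓ) (s' := s') (s := s) hred hα
    have := hinner.steps_le
    have := sum_steps_le hcomp
    have := hred.size_add_roots_le
    have := Nat.mul_le_mul_right T.requiredVerts.length hK
    linarith

theorem succeeds_of_lt (hT : T.verts.Nodup) (hred : T.IsReduced)
    (hn : k + 4 ≤ T.requiredVerts.length) (hK : c + 100 ≤ K)
    (hα : alphaCost k T.requiredVerts.length ≤ c * T.requiredVerts.length)
    (ih : 2 ≤ k → ∀ T' : Forest (V × Bool), T'.verts.Nodup → T'.IsReduced → Succeeds K k T')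
    (ih' : ∀ T' : Forest (V × Bool), T'.verts.Nodup → T'.IsReduced →
      T'.requiredVerts.length < T.requiredVerts.length → Succeeds K (k + 2) T') :
    Succeeds K (k + 2) T := by
  obtain ⟨ℓ, hℓ⟩ : ∃ ℓ, alphaPrime k T.requiredVerts.length = ℓ := ⟨_, rfl⟩
  obtain ⟨E', s', hE', hinner⟩ := exists_innerEdges hT hred (by omega) ih hℓ
  have hcomp (t : Component V) (ht : t ∈ components ℓ T) : ∃ E s, EventuallyAdds
      (fun d => tree1Spanner d t.tree.pruned t.tree.requiredVerts.length (k + 2)) E s ∧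
      IsResult K (k + 2) t.tree.pruned E s := by
    rw [← (perm_requiredVerts_pruned t.tree).length_eq]
    refine ih' _ ((verts_pruned_sublist _).nodup (nodup_component hT ht)) (isReduced_pruned _) ?_
    rw [(perm_requiredVerts_pruned t.tree).length_eq]
    exact (length_requiredVerts_component_le ℓ (.below none) T t ht).trans_lt
      (hℓ.symm.trans_lt (alphaPrime_lt hn))
  choose! E s hE hcomp using hcomp
  exact ⟨_, _, eventuallyAdds_combinedEdges hn hℓ hE' hE,
    isResult_combinedEdges hT hred hn hK hα hℓ hinner hcomp⟩

theorem succeeds (hα : ∀ k n, k + 2 ≤ n → alphaCost k n ≤ c * n) (hK : c + 100 ≤ K) (k : ℕ)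
    (T : Forest (V × Bool)) (hT : T.verts.Nodup) (hred : T.IsReduced) : Succeeds K (k + 2) T := by
  induction k using Nat.strongRec generalizing T with
  | _ k ihk =>
    induction h : T.requiredVerts.length using Nat.strongRec generalizing T with
    | _ n ihn =>
      subst h
      rcases Nat.lt_or_ge T.requiredVerts.length (k + 4) with h | h
      · exact succeeds_of_le (by omega) hT hred (Nat.lt_succ_iff.1 h)
      · refine succeeds_of_lt hT hred h hK (hα k _ (by omega)) (fun hk T' hT' hred' => ?_)
          fun T' hT' hred' hlt => ihn _ hlt T' hT' hred' rfl
        obtain ⟨j, rfl⟩ := Nat.exists_eq_add_of_le' hk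
        exact ihk j (by omega) T' hT' hred'

end Combine

end TreeSpanner

namespace TreeSpanner.Forest

variable {V : Type} {T : Forest (V × Bool)}

/-! ### Pruned trees are reduced -/

theorem IsChild.exists_verts_eq {x y : V} (h : T.IsChild x y) :
    ∃ l₁ l₂, T.verts = l₁ ++ x :: l₂ ∧ y ∈ l₂ := by
  induction T with
  | nil => exact h.elim
  | node a c s hc hs =>
    rcases h with ⟨rfl, h⟩ | h | h
    · exact ⟨[], c.verts ++ s.verts, verts_node ..,
        List.mem_append_left _ (mem_verts_of_mem_roots h)⟩
    · obtain ⟨l₁, l₂, hl, hy⟩ := hc h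
      exact ⟨a.1 :: l₁, l₂ ++ s.verts, by simp [hl], List.mem_append_left _ hy⟩
    · obtain ⟨l₁, l₂, hl, hy⟩ := hs h
      exact ⟨a.1 :: (c.verts ++ l₁), l₂, by simp [hl], hy⟩

theorem IsChild.idxOf_lt [DecidableEq V] (hT : T.verts.Nodup) {x y : V} (h : T.IsChild x y) :
    T.verts.idxOf x < T.verts.idxOf y := by
  obtain ⟨l₁, l₂, hl, hy⟩ := h.exists_verts_eq
  rw [hl, List.nodup_append', List.nodup_cons, List.disjoint_cons_right] at hT
  obtain ⟨-, ⟨hx₂, -⟩, hx₁, hdisj⟩ := hT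
  have hxy : x ≠ y := fun hxy => hx₂ (hxy ▸ hy)
  rw [hl, List.idxOf_append_of_notMem hx₁, List.idxOf_append_of_notMem fun h => hdisj h hy,
    List.idxOf_cons_self, List.idxOf_cons_ne _ hxy]
  omega

theorem IsChild.not_isAncestor (hT : T.verts.Nodup) {x y : V} (h : T.IsChild x y) :
    ¬ T.IsAncestor y x := by
  classical
  have idxOf_le {z : V} (hyz : T.IsAncestor y z) : T.verts.idxOf y ≤ T.verts.idxOf z := by
    induction hyz with
    | refl => exact le_rfl
    | tail _ hbc ih => exact ih.trans (hbc.idxOf_lt hT).le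
  exact fun hyx => (h.idxOf_lt hT).not_ge (idxOf_le hyx)

theorem IsPruned.exists_children_ne (hT : T.verts.Nodup) (h : T.IsPruned) {x : V}
    (hx : x ∈ T.steiner) : ∃ y z, y ≠ z ∧ T.IsChild x y ∧ T.IsChild x z := by
  obtain ⟨u, hu, v, hv, hxu, hxv, hmin⟩ := h x hx
  have exists_child {w : V} (hw : w ∈ T.required) (hxw : T.IsAncestor x w) :
      ∃ y, T.IsChild x y ∧ T.IsAncestor y w := by
    rcases Relation.ReflTransGen.cases_head hxw with rfl | h
    · exact absurd (label_unique hT hx hw) Bool.false_ne_true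
    · exact h
  obtain ⟨y, hxy, hyu⟩ := exists_child hu hxu
  obtain ⟨z, hxz, hzv⟩ := exists_child hv hxv
  exact ⟨y, z, fun hyz => hxy.not_isAncestor hT (hmin y hyu (hyz ▸ hzv)), hxy, hxz⟩

theorem eq_of_mem_of_length_le_one {α : Type*} {l : List α} (hl : l.length ≤ 1) {x y : α}
    (hx : x ∈ l) (hy : y ∈ l) : x = y := by
  obtain ⟨a, rfl⟩ := List.length_eq_one_iff.1 (hl.antisymm (List.length_pos_of_mem hx))
  rw [List.mem_singleton.1 hx, List.mem_singleton.1 hy]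

theorem isReduced_of_exists_children_ne (hT : T.verts.Nodup)
    (h : ∀ x ∈ T.steiner, ∃ y z, y ≠ z ∧ T.IsChild x y ∧ T.IsChild x z) : T.IsReduced := by
  induction T with
  | nil => trivial
  | node a c s hc hs =>
    obtain ⟨hac, has, hTc, hTs, hdisj⟩ := nodup_verts_node.1 hT
    refine ⟨?_, hc hTc fun x hx => ?_, hs hTs fun x hx => ?_⟩
    · obtain ⟨v, _ | _⟩ := a
      · obtain ⟨y, z, hyz, hy, hz⟩ := h v List.mem_cons_self
        have mem_roots {y : V} (hy : (node (v, false) c s).IsChild v y) :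
            y ∈ c.roots.map Prod.fst := Linked.mem_roots hT (.inl hy)
        refine .inr (Nat.succ_le_of_lt (lt_of_not_ge fun hlen => hyz ?_))
        exact eq_of_mem_of_length_le_one ((List.length_map _).trans_le hlen) (mem_roots hy)
          (mem_roots hz)
      · exact .inl rfl
    · have hxc : x ∈ c.verts := List.mem_map_of_mem hx
      have restrict {y : V} (hy : (node a c s).IsChild x y) : c.IsChild x y := by
        rcases hy with ⟨rfl, -⟩ | hy | hy
        exacts [(hac hxc).elim, hy, (hdisj x hxc hy.mem.1).elim]
      obtain ⟨y, z, hyz, hy, hz⟩ := h x (List.mem_cons_of_mem _ (List.mem_append_left _ hx))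
      exact ⟨y, z, hyz, restrict hy, restrict hz⟩
    · have hxs : x ∈ s.verts := List.mem_map_of_mem hx
      have restrict {y : V} (hy : (node a c s).IsChild x y) : s.IsChild x y := by
        rcases hy with ⟨rfl, -⟩ | hy | hy
        exacts [(has hxs).elim, (hdisj x hy.mem.1 hxs).elim, hy]
      obtain ⟨y, z, hyz, hy, hz⟩ := h x (List.mem_cons_of_mem _ (List.mem_append_right _ hx))
      exact ⟨y, z, hyz, restrict hy, restrict hz⟩

theorem IsPruned.isReduced (hT : T.verts.Nodup) (h : T.IsPruned) : T.IsReduced :=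
  isReduced_of_exists_children_ne hT fun _ hx => h.exists_children_ne hT hx

theorem ncard_required (hT : T.verts.Nodup) : T.required.ncard = T.requiredVerts.length := by
  classical
  have heq : T.required = (T.requiredVerts.toFinset : Set V) := by
    ext x
    rw [List.coe_toFinset, Set.mem_ofPred_eq, mem_requiredVerts]
  rw [heq, Set.ncard_coe_finset, List.toFinset_card_of_nodup (nodup_requiredVerts hT)]

/-! ### Monotone paths -/

theorem graph_adj (hT : T.verts.Nodup) {x y : V} : T.graph.Adj x y ↔ T.Linked x y := by
  rw [graph, SimpleGraph.fromRel_adj]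
  exact ⟨fun h => h.2, fun h => ⟨h.elim (fun h => h.ne hT) (fun h => (h.ne hT).symm), h⟩⟩

theorem isPathList_support (hT : T.verts.Nodup) {u v : V} (hu : u ∈ T.verts)
    {p : T.graph.Walk u v} (hp : p.IsPath) : T.IsPathList p.support := by
  have hchain : (u :: p.support.tail).IsChain T.graph.Adj :=
    p.cons_tail_support ▸ p.isChain_adj_support
  have hlinked := isChain_of_invariant (P := (· ∈ T.verts)) (Q := fun _ => True)
    (fun x y hxy _ _ => ⟨((graph_adj hT).1 hxy).mem.2, (graph_adj hT).1 hxy⟩) hchain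
    (fun _ _ => trivial) hu
  rw [p.cons_tail_support] at hlinked
  exact ⟨hp.support_nodup, hlinked.1, hlinked.2⟩

theorem exists_root_isAncestor {x : V} (hx : x ∈ T.verts) :
    ∃ r ∈ T.roots.map Prod.fst, T.IsAncestor r x := by
  induction T with
  | nil => cases hx
  | node a c s hc hs =>
    rw [verts_node, List.mem_cons, List.mem_append] at hx
    rcases hx with rfl | hx | hx
    · exact ⟨a.1, List.mem_cons_self, .refl⟩
    · obtain ⟨r, hr, h⟩ := hc hx
      exact ⟨a.1, List.mem_cons_self, .head (.inl ⟨rfl, hr⟩)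
        (Relation.ReflTransGen.mono (fun _ _ h => .inr (.inl h)) _ _ h)⟩
    · obtain ⟨r, hr, h⟩ := hs hx
      exact ⟨r, List.mem_cons_of_mem _ hr,
        Relation.ReflTransGen.mono (fun _ _ h => .inr (.inr h)) _ _ h⟩

theorem IsAncestor.reachable (hT : T.verts.Nodup) {x y : V} (h : T.IsAncestor x y) :
    T.graph.Reachable x y := by
  induction h with
  | refl => exact .refl _
  | tail _ hbc ih => exact ih.trans ((graph_adj hT).2 (.inl hbc)).reachable

theorem IsSteinerTree.reachable (hT : T.IsSteinerTree) {x y : V} (hx : x ∈ T.verts)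
    (hy : y ∈ T.verts) : T.graph.Reachable x y := by
  obtain ⟨r, hr, hrx⟩ := exists_root_isAncestor hx
  obtain ⟨r', hr', hry⟩ := exists_root_isAncestor hy
  obtain rfl : r = r' :=
    eq_of_mem_of_length_le_one ((List.length_map _).trans_le hT.2) hr hr'
  exact (hrx.reachable hT.1).symm.trans (hry.reachable hT.1)

end TreeSpanner.Forest

namespace TreeSpanner

open Forest

open scoped ENNReal

variable {V : Type}

section Monotone

variable {T : Forest (V × Bool)} {E : List (V × V)} {k : ℕ}

theorem Joined.graphOf_adj (hE : EdgesIn T E) {x y : V} (h : Joined E x y) :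
    (graphOf E).Adj x y := by
  rw [graphOf, SimpleGraph.fromEdgeSet_adj]
  rcases h with h | h
  · exact ⟨⟨_, h, rfl⟩, (hE _ h).2.2⟩
  · exact ⟨⟨_, h, Sym2.eq_swap⟩, (hE _ h).2.2.symm⟩

theorem exists_walk_of_isChain {G : SimpleGraph V} {q : List V} {u v : V} (hu : q.head? = some u)
    (hv : q.getLast? = some v) (hq : q.IsChain G.Adj) : ∃ w : G.Walk u v, w.support = q := by
  obtain ⟨hne, rfl⟩ := List.mem_getLast?_eq_getLast hv
  obtain rfl : q.head hne = u := Option.some_inj.1 (List.head?_eq_some_head hne ▸ hu)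
  exact ⟨.ofSupport q hne hq, SimpleGraph.Walk.support_ofSupport ..⟩

theorem exists_walk_of_hasShortcuts (hT : T.verts.Nodup) (hE : EdgesIn T E)
    (h : HasShortcuts T T.requiredVerts E k) {u v : V} (hu : u ∈ T.required)
    (hv : v ∈ T.required) {p : T.graph.Walk u v} (hp : p.IsPath) :
    ∃ q : (graphOf E).Walk u v, q.support.Sublist p.support ∧ q.length ≤ k := by
  rw [← mem_requiredVerts] at hu hv
  have hhead : p.support.head? = some u := by rw [← p.cons_tail_support]; rfl
  have hlast : p.support.getLast? = some v := by
    rw [List.getLast?_eq_some_getLast p.support_ne_nil, p.getLast_support]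
  obtain ⟨q, hqp, hchain, hlen⟩ := h p.support
    (isPathList_support hT (mem_verts_of_mem_requiredVerts hu) hp)
    (fun x hx => Option.some_inj.1 (hhead.symm.trans hx) ▸ hu)
    (fun x hx => Option.some_inj.1 (hlast.symm.trans hx) ▸ hv)
  obtain ⟨w, rfl⟩ := exists_walk_of_isChain (G := graphOf E) (hqp.head.trans hhead)
    (hqp.last.trans hlast) (hchain.imp fun _ _ h => h.graphOf_adj hE)
  rw [SimpleGraph.Walk.length_support] at hlen
  exact ⟨w, hqp.sublist, Nat.le_of_succ_le_succ hlen⟩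

theorem monotoneDiam_le (hT : T.IsSteinerTree) (hE : EdgesIn T E)
    (h : HasShortcuts T T.requiredVerts E k) :
    monotoneDiam T.graph (graphOf E) T.required ≤ k := by
  refine iSup₂_le fun u hu => iSup₂_le fun v hv => ?_
  have mem_verts {x : V} (hx : x ∈ T.required) : x ∈ T.verts :=
    mem_verts_of_mem_requiredVerts (mem_requiredVerts.2 hx)
  obtain ⟨p, hp⟩ := (hT.reachable (mem_verts hu) (mem_verts hv)).exists_isPath
  obtain ⟨q, hqp, hlen⟩ := exists_walk_of_hasShortcuts hT.1 hE h hu hv hp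
  exact (iInf₂_le q ⟨p, hp, hqp⟩).trans (Nat.cast_le.2 hlen)

end Monotone

/-! ### Distances -/

section Distances

variable {G H : SimpleGraph V} {w : V → V → ℝ≥0∞} {u v : V}

theorem weightedDist_self (G : SimpleGraph V) (w : V → V → ℝ≥0∞) (u : V) :
    weightedDist G w u u = 0 :=
  nonpos_iff_eq_zero.1 (iInf_le_of_le .nil le_rfl)

theorem weightedDist_triangle (G : SimpleGraph V) (w : V → V → ℝ≥0∞) (u x v : V) :
    weightedDist G w u v ≤ weightedDist G w u x + weightedDist G w x v :=
  ENNReal.le_iInf_add_iInf fun p q => (iInf_le _ (p.append q)).trans_eq <| by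
    rw [SimpleGraph.Walk.darts_append, List.map_append, List.sum_append]

theorem weightedDist_le_of_adj (h : G.Adj u v) : weightedDist G w u v ≤ w u v :=
  (iInf_le _ h.toWalk).trans_eq <| List.sum_singleton

theorem weightedDist_le_weightedDist_weightedDist (u v : V) :
    weightedDist G w u v ≤ weightedDist H (weightedDist G w) u v := by
  refine le_iInf fun q => ?_
  induction q with
  | nil => exact (weightedDist_self G w _).trans_le zero_le
  | @cons u x v h q ih => exact (weightedDist_triangle G w u x v).trans (add_le_add_right ih _)

/-- The sum of the weights of the pairs of consecutive entries of a list. -/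
noncomputable def listWeight (w : V → V → ℝ≥0∞) : List V → ℝ≥0∞
  | [] => 0
  | [_] => 0
  | a :: b :: l => w a b + listWeight w (b :: l)

theorem sum_darts_eq_listWeight (w : V → V → ℝ≥0∞) (p : G.Walk u v) :
    (p.darts.map fun d => w d.fst d.snd).sum = listWeight w p.support := by
  induction p with
  | nil => rfl
  | cons h p ih =>
    rw [SimpleGraph.Walk.darts_cons, SimpleGraph.Walk.support_cons, List.map_cons, List.sum_cons,
      ih, ← p.cons_tail_support]
    rfl

theorem listWeight_weightedDist_le {r l : List V} (h : r.Sublist l) (a : V) {b : V}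
    (hl : (b :: l).IsChain G.Adj) :
    listWeight (weightedDist G w) (a :: r) ≤ weightedDist G w a b + listWeight w (b :: l) := by
  have step {a b c : V} (hbc : G.Adj b c) :
      weightedDist G w a c ≤ weightedDist G w a b + w b c :=
    (weightedDist_triangle G w a b c).trans (by gcongr; exact weightedDist_le_of_adj hbc)
  induction h generalizing a b with
  | slnil => exact zero_le
  | @cons r l c _ ih =>
    rw [List.isChain_cons_cons] at hl
    rw [listWeight, ← add_assoc]
    exact (ih a hl.2).trans (by gcongr; exact step hl.1)
  | @cons_cons r l c _ ih =>
    rw [List.isChain_cons_cons] at hl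
    have hrest := ih c hl.2
    rw [weightedDist_self, zero_add] at hrest
    rw [listWeight, listWeight, ← add_assoc]
    gcongr
    exact step hl.1

theorem sum_darts_le_of_sublist (w : V → V → ℝ≥0∞) {p : G.Walk u v} {q : H.Walk u v}
    (h : q.support.Sublist p.support) :
    (q.darts.map fun d => weightedDist G w d.fst d.snd).sum ≤
      (p.darts.map fun d => w d.fst d.snd).sum := by
  have hchain := p.isChain_adj_support
  rw [sum_darts_eq_listWeight, sum_darts_eq_listWeight]
  rw [← p.cons_tail_support] at h hchain ⊢
  rw [← q.cons_tail_support] at h ⊢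
  have hle := listWeight_weightedDist_le (w := w) h.of_cons_cons u hchain
  rwa [weightedDist_self, zero_add] at hle

theorem isOneSpanner_of_hasShortcuts {T : Forest (V × Bool)} (hT : T.verts.Nodup)
    {E : List (V × V)} (hE : EdgesIn T E) {k : ℕ} (h : HasShortcuts T T.requiredVerts E k) :
    IsOneSpanner T.graph (graphOf E) T.required := by
  classical
  intro w u hu v hv
  refine le_antisymm (le_iInf fun p => ?_) (weightedDist_le_weightedDist_weightedDist u v)
  obtain ⟨q, hq, -⟩ := exists_walk_of_hasShortcuts hT hE h hu hv p.bypass_isPath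
  refine (iInf_le _ q).trans ((sum_darts_le_of_sublist _ hq).trans ?_)
  exact (p.darts_bypass_sublist_darts.map _).sum_le_sum fun _ _ => zero_le

end Distances

/-! ### Sizes -/

theorem ncard_edgeSet_graphOf_le (E : List (V × V)) : (graphOf E).edgeSet.ncard ≤ E.length := by
  classical
  have hsub : (graphOf E).edgeSet ⊆ ((E.map fun e => s(e.1, e.2)).toFinset : Set (Sym2 V)) := by
    intro e he
    rw [graphOf, SimpleGraph.edgeSet_fromEdgeSet] at he
    obtain ⟨e, hmem, rfl⟩ := he.1
    exact List.mem_toFinset.2 (List.mem_map_of_mem hmem)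
  calc (graphOf E).edgeSet.ncard
      ≤ ((E.map fun e => s(e.1, e.2)).toFinset : Set (Sym2 V)).ncard :=
        Set.ncard_le_ncard hsub (Finset.finite_toSet _)
    _ = (E.map fun e => s(e.1, e.2)).toFinset.card := Set.ncard_coe_finset _
    _ ≤ (E.map fun e => s(e.1, e.2)).length := List.toFinset_card_le _
    _ = E.length := List.length_map _

theorem mul_alphaPrime_le (K j n : ℕ) :
    K * n * alphaPrime (j + 2) n + K * n + 2 ≤ (40 * K + 2) * (n * alpha (j + 2) n + 1) := by
  have hprime := Nat.mul_le_mul_left (K * n) (alphaPrime_le_two_mul_alpha j n)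
  have hn : n ≤ n * alpha (j + 2) n + 2 := by
    rcases Nat.lt_or_ge n 3 with h | h
    · omega
    · exact (Nat.le_mul_of_pos_right n (alpha_pos j h)).trans (Nat.le_add_right _ _)
  have hKn := Nat.mul_le_mul_left K hn
  nlinarith [Nat.zero_le (K * (n * alpha (j + 2) n)), Nat.zero_le (n * alpha (j + 2) n)]

theorem IsResult.length_le {K k steps : ℕ} {T : Forest (V × Bool)} {E : List (V × V)}
    (h : IsResult K k T E steps) (hK : 3 ≤ K) :
    E.length ≤ K * T.requiredVerts.length * alphaPrime k T.requiredVerts.length +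
      K * T.requiredVerts.length + 2 := by
  have bound {b : ℕ} (hb : b ≤ K) : b * T.requiredVerts.length *
      alphaPrime k T.requiredVerts.length ≤
        K * T.requiredVerts.length * alphaPrime k T.requiredVerts.length := by gcongr
  rcases Nat.even_or_odd k with hk | hk
  · have := h.length_le_of_even hk
    have := bound (b := 2) (by omega)
    omega
  · have := h.length_le_of_odd hk
    have := bound hK
    omega

end TreeSpanner

theorem mainTheorem1 :
    ∃ C : ℕ, ∀ (V : Type) (T : TreeSpanner.Forest (V × Bool)) (k n : ℕ),
      2 ≤ k → T.IsSteinerTree → T.IsPruned → T.required.ncard = n →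
      ∃ (E : List (V × V)) (steps : ℕ),
        (∃ d₀, ∀ d ≥ d₀,
          (TreeSpanner.tree1Spanner d T n k []).run 0 = some (E, steps)) ∧
        (∀ e ∈ E, e.1 ∈ T.verts ∧ e.2 ∈ T.verts ∧ e.1 ≠ e.2) ∧
        TreeSpanner.IsOneSpanner T.graph (TreeSpanner.graphOf E) T.required ∧
        TreeSpanner.monotoneDiam T.graph (TreeSpanner.graphOf E) T.required ≤ (k : ℕ∞) ∧
        (Even k →
          (TreeSpanner.graphOf E).edgeSet.ncard ≤ 2 * n * TreeSpanner.alphaPrime k n) ∧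
        (Odd k →
          (TreeSpanner.graphOf E).edgeSet.ncard ≤ 3 * n * TreeSpanner.alphaPrime k n + 2) ∧
        (TreeSpanner.graphOf E).edgeSet.ncard ≤ C * (n * TreeSpanner.alpha k n + 1) ∧
        steps ≤ C * (n * TreeSpanner.alpha k n + 1) := by
  obtain ⟨c, hc⟩ := TreeSpanner.exists_alphaCost_le
  refine ⟨40 * (c + 100) + 2, fun V T k n hk hT hpruned hn => ?_⟩
  obtain ⟨j, rfl⟩ := Nat.exists_eq_add_of_le' hk
  obtain rfl : T.requiredVerts.length = n := (TreeSpanner.Forest.ncard_required hT.1).symm.trans hn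
  obtain ⟨E, steps, hadds, hres⟩ :=
    TreeSpanner.succeeds hc le_rfl j T hT.1 (hpruned.isReduced hT.1)
  obtain ⟨d₀, hrun⟩ := Filter.eventually_atTop.1 hadds
  have hE := TreeSpanner.ncard_edgeSet_graphOf_le E
  have hbound := TreeSpanner.mul_alphaPrime_le (c + 100) j T.requiredVerts.length
  refine ⟨E, steps, ⟨d₀, fun d hd => ?_⟩, hres.edgesIn,
    TreeSpanner.isOneSpanner_of_hasShortcuts hT.1 hres.edgesIn hres.hasShortcuts,
    TreeSpanner.monotoneDiam_le hT hres.edgesIn hres.hasShortcuts,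
    fun hk => hE.trans (hres.length_le_of_even hk), fun hk => hE.trans (hres.length_le_of_odd hk),
    hE.trans ((hres.length_le (by omega)).trans hbound), hres.steps_le.trans hbound⟩
  rw [hrun d hd [] 0, List.append_nil, Nat.zero_add]
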